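/- A $\beta(1,0)$-tree is a rooted plane tree labelled with positive integers such that leaves have label $1$, and, if the tree has at least two nodes, the root has label equal to the sum of its children's labels and any other internal node has label no greater than the sum of its children's labels. (The single node of the one-node tree, called leaf, has label $1$.) For a tree $t$ whose root has label $k$ and $1\le i\le k$, let $\lambda_i t$ be obtained from $t$ by joining a new root by an edge to the old root and giving both of them label $i$. For trees $u,v$ with at least two nodes each, let $u\oplus v$ be the tree whose root label is the sum of the root labels of $u$ and $v$ and whose subtrees are those of $u$ followed by those of $v$. An avoider of length $n$ is a permutation $a_1\cdots a_n$ of $[n]=\{1,\dots,n\}$ with no $i<j<k<l$ such that $a_j<a_l<a_i<a_k$ (it avoids 3-1-4-2) and no $i<j<j+1<k$ such that $a_{j+1}<a_i<a_k<a_j$ (it avoids 2-41-3); $\varepsilon$ is the empty permutation. For words write $\alpha\prec\beta$ if every letter of $\alpha$ is smaller than every letter of $\beta$. For permutations, $\sigma\oplus\tau=\sigma\tau'$, where $\tau'$ is obtained from $\tau$ by adding $|\sigma|$ to each letter. The map $\psi$ is defined on avoiders $\pi=\sigma n\tau$ of length $n$ with $\sigma\neq\varepsilon$ and $n-1$ in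 $\tau$ as follows. Let $\sigma_1\prec\dots\prec\sigma_k$ be the maximal factors of $\sigma$ whose letters form a set of consecutive integers, and $\sigma_{k+1}=\varepsilon$. For $1\le i\le k$ let $w_i$ be the subsequence of $\tau$ of the letters $x$ with $\sigma_i\prec x\prec\sigma_{i+1}$, write $w_i=u_i\hat 0_i v_i$ with $\hat 0_i=\min w_i$, and let $m_i$ be the number of letters $x$ in $v_i$ with $x\prec u_i$. Let $L=\bigcup_i\{x+m_i+1: x\in\sigma_i\}$ and $R=[n-1]\setminus L$. Then $\psi(\pi)=\sigma' n\tau'$, where $\sigma'$ and $\tau'$ are the words on the letter sets $L$ and $R$ that are order isomorphic to $\sigma$ and $\tau$. For an avoider $\pi$ of length $n-1$ and $1\le i\le\mathrm{lmax}(\pi)$, let $\hat\pi$ be obtained by inserting $n$ immediately to the left of the $i$th left-to-right maximum of $\pi$; put $\varphi_1\pi=\hat\pi$ and $\varphi_i\pi=\psi(\hat\pi)$ for $i>1$. Also $\varphi_1\varepsilon=1$. **Theorem.** There is exactly one map $f$ from $\beta(1,0)$-trees to words such that $f(\text{leaf})=\varepsilon$, $f(\lambda_i t)=\varphi_i f(t)$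 and $f(u\oplus v)=f(u)\oplus f(v)$. For every $n\ge 0$ it restricts to a bijection from $\beta(1,0)$-trees on $n+1$ nodes onto avoiders of length $n$. For every $\beta(1,0)$-tree $t$, with $\pi=f(t)$, $$(\mathrm{sub},\mathrm{leaves},\mathrm{root},\mathrm{lpath},\mathrm{rpath},\mathrm{lsub},\mathrm{stemhm})(t)=(\mathrm{comp},1+\mathrm{asc},\mathrm{lmax},\mathrm{lmin},\mathrm{rmax},\mathrm{ldr},\mathrm{lir})(\pi).$$ Here, for trees: $\mathrm{sub}$ is the number of children of the root; $\mathrm{leaves}$ the number of leaves; $\mathrm{root}$ the label of the root; $\mathrm{lpath}$ and $\mathrm{rpath}$ the number of edges on the path from the root to the leftmost, respectively rightmost, leaf; $\mathrm{lsub}$ the number of labels $1$ below the root on the former path. To compute $\mathrm{stemhm}$, let $\ell_1,\ell_2,\dots$ be the leaves from left to right; for $i=1,2,\dots$, if no node other than $\ell_i$ on the path from $\ell_i$ to the root currently has label $1$, reduce the labels on that path by $1$, delete $\ell_i$ and continue with $\ell_{i+1}$; otherwise stop, and $\mathrm{stemhm}=i$. By convention $\mathrm{root}$ and $\mathrm{stemhm}$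 of the one-node tree are $0$. For permutations: $\mathrm{asc}$ is the number of ascents; $\mathrm{lmax}$, $\mathrm{lmin}$, $\mathrm{rmax}$ the numbers of left-to-right maxima, left-to-right minima and right-to-left maxima; $\mathrm{ldr}$ and $\mathrm{lir}$ the largest $i$ with $a_1>\dots>a_i$, respectively $a_1<\dots<a_i$; $\mathrm{comp}$ the number of components, a component being a nonempty factor $\tau$ with $\pi=\sigma\tau\rho$, $\sigma\prec\tau\prec\rho$, such that $\tau=\alpha\beta$ with $\alpha\prec\beta$ forces $\alpha$ or $\beta$ to be empty. All permutation statistics of $\varepsilon$ are $0$. -/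

import Mathlib

/-! ### Labelled rooted plane trees -/

/-- Rooted plane trees whose nodes carry natural number labels: a node is its label together
with the list of its subtrees, from left to right. -/
inductive LTree : Type where
  | node (label : ℕ) (children : List LTree) : LTree

namespace LTree

/-- The label written on the root node. -/
def label : LTree → ℕ
  | node a _ => a

/-- The subtrees of the root, from left to right. -/
def children : LTree → List LTree
  | node _ cs => cs

/-- The sum of the labels of the children of the root. -/
def childSum (t : LTree) : ℕ := (t.children.map label).sum

/-- The number of nodes. -/
def nodes : LTree → ℕ
  | node _ cs => 1 + (cs.map nodes).sum

/-- The condition on the subtree hanging at a node other than the root: all labels are positive,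
leaves have label `1`, every other node has label at most the sum of its children's labels. -/
inductive IsBelow : LTree → Prop where
  | leaf : IsBelow (node 1 [])
  | node (a : ℕ) (cs : List LTree) (hne : cs ≠ []) (hpos : 1 ≤ a)
      (hle : a ≤ (cs.map label).sum) (hcs : ∀ c ∈ cs, IsBelow c) : IsBelow (node a cs)

/-- The tree with a single node, with label `1` as for every leaf. -/
def leaf : LTree := node 1 []

/-- β(1,0)-trees: the one-node tree, and the trees on two or more nodes in which leaves have
label `1`, the root has label equal to the sum of its children's labels, and any other node has a
positive label no greater than the sum of its children's labels. -/
def IsBeta (t : LTree) : Prop :=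
  t = leaf ∨ (t.children ≠ [] ∧ t.label = t.childSum ∧ ∀ c ∈ t.children, IsBelow c)

/-! ### Statistics on trees -/

/-- The number of children of the root. -/
def sub (t : LTree) : ℕ := t.children.length

/-- The number of leaves. -/
def leaves : LTree → ℕ
  | node _ cs => if cs = [] then 1 else (cs.map leaves).sum

/-- The statistic `root`: the label of the root, where the one-node tree has value `0` by
convention. -/
def root (t : LTree) : ℕ := if t.children = [] then 0 else t.label

/-- The labels of the nodes on the left path other than the root, from top to bottom. -/
def leftLabels : LTree → List ℕ
  | node _ [] => []
  | node _ (c :: _) => c.label :: leftLabels c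

/-- The number of edges on the path from the root to the leftmost leaf. -/
def lpath (t : LTree) : ℕ := t.leftLabels.length

/-- The number of edges on the path from the root to the rightmost leaf. -/
def rpath : LTree → ℕ
  | node _ [] => 0
  | node _ (c :: cs) => 1 + rpath ((c :: cs).getLast (List.cons_ne_nil c cs))
termination_by t => sizeOf t
decreasing_by
  have h := List.sizeOf_lt_of_mem (List.getLast_mem (List.cons_ne_nil c cs))
  simp only [LTree.node.sizeOf_spec]
  omega

/-- The number of `1`s below the root on the left path. -/
def lsub (t : LTree) : ℕ := t.leftLabels.count 1

/-- The labels of the nodes on the left path other than the leftmost leaf. -/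
def innerLeftLabels : LTree → List ℕ
  | node _ [] => []
  | node a (c :: _) => a :: innerLeftLabels c

/-- Reduce by one the labels of all nodes on the left path and delete the leftmost leaf
(the one-node tree is left alone). -/
def peel : LTree → LTree
  | node a [] => node a []
  | node a (node _ [] :: cs) => node (a - 1) cs
  | node a (node b (d :: ds) :: cs) => node (a - 1) (peel (node b (d :: ds)) :: cs)

/-- The statistic obtained by peeling off the leaves `ℓ₁, ℓ₂, …` from left to right: the first
`i ≥ 1` such that, after `ℓ₁, …, ℓ_{i-1}` are peeled off, some node other than `ℓ_i` on the path
from `ℓ_i` to the root has label `1`. The one-node tree has value `0` by convention. -/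
noncomputable def stemhm (t : LTree) : ℕ :=
  if t.children = [] then 0
  else sInf {i : ℕ | 1 ≤ i ∧ 1 ∈ (peel^[i - 1] t).innerLeftLabels}

/-! ### The two constructions on trees -/

/-- `λ(i, t)`: join a new root by an edge to the old root, and give both of them label `i`. -/
def lam (i : ℕ) (t : LTree) : LTree := node i [node i t.children]

/-- `u ⊕ v`: the root labels are added, and the subtrees of `u` are followed by those of `v`. -/
def oplus (u v : LTree) : LTree := node (u.root + v.root) (u.children ++ v.children)

theorem isBeta_leaf : IsBeta leaf := Or.inl rfl

theorem IsBeta.isBelow_lower {t : LTree} (ht : t.IsBeta) {i : ℕ} (h1 : 1 ≤ i)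
    (h2 : i ≤ t.label) : IsBelow (node i t.children) := by
  rcases ht with rfl | ⟨hne, hl, hc⟩
  · have h3 : i ≤ 1 := h2
    obtain rfl : i = 1 := by omega
    exact IsBelow.leaf
  · refine IsBelow.node i _ hne h1 ?_ hc
    rw [hl] at h2
    exact h2

theorem IsBeta.lam {t : LTree} (ht : t.IsBeta) {i : ℕ} (h1 : 1 ≤ i) (h2 : i ≤ t.label) :
    IsBeta (lam i t) := by
  refine Or.inr ⟨by simp [LTree.lam, children], by simp [LTree.lam, childSum, children, label], ?_⟩
  intro c hc
  have h3 : c = node i t.children := by simpa [LTree.lam, children] using hc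
  rw [h3]
  exact ht.isBelow_lower h1 h2

theorem IsBeta.oplus {u v : LTree} (hu : u.IsBeta) (hv : v.IsBeta) (hu' : u ≠ leaf)
    (hv' : v ≠ leaf) : IsBeta (oplus u v) := by
  rcases hu with hu | ⟨hne, hl, hc⟩
  · exact absurd hu hu'
  rcases hv with hv | ⟨hne2, hl2, hc2⟩
  · exact absurd hv hv'
  refine Or.inr ⟨by simp [LTree.oplus, children]; tauto, ?_, ?_⟩
  · have h1 : (LTree.oplus u v).childSum = u.childSum + v.childSum := by
      simp [LTree.oplus, childSum, children]
    rw [h1, ← hl, ← hl2]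
    simp [LTree.oplus, root, hne, hne2, label]
  · intro c h
    have h3 : c ∈ u.children ∨ c ∈ v.children := by simpa [LTree.oplus, children] using h
    exact h3.elim (hc c) (hc2 c)

end LTree

/-- The type of β(1,0)-trees. -/
abbrev BetaTree : Type := {t : LTree // t.IsBeta}

namespace BetaTree

/-- The one-node β(1,0)-tree. -/
def leaf : BetaTree := ⟨LTree.leaf, LTree.isBeta_leaf⟩

/-- `λ(i, t)` for `1 ≤ i ≤ k`, where `k` is the label on the root of `t`. -/
def lam (i : ℕ) (t : BetaTree) (h1 : 1 ≤ i) (h2 : i ≤ t.1.label) : BetaTree :=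
  ⟨LTree.lam i t.1, t.2.lam h1 h2⟩

/-- `u ⊕ v` for β(1,0)-trees with at least one edge each. -/
def oplus (u v : BetaTree) (hu : u ≠ leaf) (hv : v ≠ leaf) : BetaTree :=
  ⟨LTree.oplus u.1 v.1,
    u.2.oplus v.2 (fun h => hu (Subtype.ext h)) (fun h => hv (Subtype.ext h))⟩

end BetaTree

/-! ### Permutations, written as words `a₁ a₂ ⋯ aₙ` -/

namespace Word

/-- `w` is a permutation of `[n] = {1, …, n}` in one-line notation. -/
def IsPerm (n : ℕ) (w : List ℕ) : Prop := w.Perm (List.range' 1 n)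

/-- The letter at position `i`, positions being counted from `0`. -/
def letter (w : List ℕ) (i : ℕ) : ℕ := w.getD i 0

/-- No occurrence of 3-1-4-2: no four positions `i < j < k < l` whose letters are order
isomorphic to `3142`. -/
def Avoids3142 (w : List ℕ) : Prop :=
  ¬ ∃ i j k l : ℕ, i < j ∧ j < k ∧ k < l ∧ l < w.length ∧
    letter w j < letter w l ∧ letter w l < letter w i ∧ letter w i < letter w k

/-- No occurrence of 2-41-3: no four positions `i < j < j + 1 < k` whose letters are order
isomorphic to `2413`. -/
def Avoids2413 (w : List ℕ) : Prop :=
  ¬ ∃ i j k : ℕ, i < j ∧ j + 1 < k ∧ k < w.length ∧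
    letter w (j + 1) < letter w i ∧ letter w i < letter w k ∧ letter w k < letter w j

/-- The avoiders of length `n`. -/
def IsAvoider (n : ℕ) (w : List ℕ) : Prop := IsPerm n w ∧ Avoids3142 w ∧ Avoids2413 w

/-- `α ≺ β`: each letter of `α` is smaller than each letter of `β`. -/
def Prec (α β : List ℕ) : Prop := ∀ a ∈ α, ∀ b ∈ β, a < b

/-! ### Statistics on permutations -/

/-- The number of ascents. -/
def asc (w : List ℕ) : ℕ :=
  ((List.range (w.length - 1)).filter (fun p => letter w p < letter w (p + 1))).length

/-- The positions of the left-to-right maxima, in increasing order. -/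
def lmaxPos (w : List ℕ) : List ℕ :=
  (List.range w.length).filter (fun p => ∀ q < p, letter w q < letter w p)

/-- The number of left-to-right maxima. -/
def lmax (w : List ℕ) : ℕ := (lmaxPos w).length

/-- The number of left-to-right minima. -/
def lmin (w : List ℕ) : ℕ :=
  ((List.range w.length).filter (fun p => ∀ q < p, letter w p < letter w q)).length

/-- The number of right-to-left maxima. -/
def rmax (w : List ℕ) : ℕ := lmax w.reverse

/-- The length of the leftmost decreasing run: the largest `i` with `a₁ > a₂ > ⋯ > aᵢ`. -/
def ldr (w : List ℕ) : ℕ :=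
  Nat.findGreatest (fun i => (w.take i).Pairwise (fun a b => a > b)) w.length

/-- The length of the leftmost increasing run: the largest `i` with `a₁ < a₂ < ⋯ < aᵢ`. -/
def lir (w : List ℕ) : ℕ :=
  Nat.findGreatest (fun i => (w.take i).Pairwise (fun a b => a < b)) w.length

/-- `τ` is a component of `w`. -/
def IsComponent (w τ : List ℕ) : Prop :=
  τ ≠ [] ∧ (∃ σ ρ : List ℕ, w = σ ++ τ ++ ρ ∧ Prec σ τ ∧ Prec τ ρ) ∧
    ∀ α β : List ℕ, τ = α ++ β → Prec α β → α = [] ∨ β = []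

/-- The number of components (the letters of a permutation being distinct, different
components are different words). -/
noncomputable def comp (w : List ℕ) : ℕ := {τ : List ℕ | IsComponent w τ}.ncard

/-! ### The two constructions on permutations -/

/-- `σ ⊕ τ = σ τ'`, where `τ'` is obtained from `τ` by adding `|σ|` to each letter. -/
def oplus (σ τ : List ℕ) : List ℕ := σ ++ τ.map (fun x => x + σ.length)

/-- The standardization of a word with distinct letters: a letter is replaced by its rank,
counted from `1`. -/
def st (w : List ℕ) : List ℕ := w.map (fun x => w.countP (fun y => y ≤ x))

/-- The inverse of the standardization for the letter set `V`: the letter `i` is replaced by the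
`i`th smallest element of `V`. -/
def unst (V : Finset ℕ) (w : List ℕ) : List ℕ :=
  w.map (fun i => (V.sort (fun a b => a ≤ b)).getD (i - 1) 0)

/-- The letters `x` and `z` of `σ` lie in a common interval of `σ`: every value between them is
a letter of `σ`. -/
def SameInterval (σ : List ℕ) (x z : ℕ) : Prop := ∀ y ∈ Finset.Icc (min x z) (max x z), y ∈ σ

instance (σ : List ℕ) (x z : ℕ) : Decidable (SameInterval σ x z) := by
  unfold SameInterval; infer_instance

/-- For a letter `x` in the (maximal) interval `σᵢ` of `σ`, the subsequence `wᵢ` of `τ` of all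
letters `y` with `σᵢ ≺ y ≺ σᵢ₊₁`, where `σ₁ ≺ σ₂ ≺ ⋯` are the intervals of `σ` and the last
one is followed by the empty word. -/
def above (σ τ : List ℕ) (x : ℕ) : List ℕ :=
  τ.filter (fun y => (∀ z ∈ σ, SameInterval σ x z → z < y) ∧
    (∀ z ∈ σ, x < z → ¬ SameInterval σ x z → y < z))

/-- For `w = u 0̂ v` with `0̂ = min w`, the number of letters of `v` that are smaller than all
letters of `u`. -/
def shift (w : List ℕ) : ℕ :=
  let z := w.min?.getD 0
  let u := w.takeWhile (fun y => y ≠ z)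
  let v := (w.dropWhile (fun y => y ≠ z)).tail
  (v.filter (fun y => ∀ a ∈ u, y < a)).length

/-- The map `ψ`. With `π = σ n τ`, the new set of letters `L` to the left of `n` is obtained by
adding `mᵢ + 1` to the letters of the `i`th interval of `σ`; then `L` and `[n-1] \ L` are filled
in to the left and to the right of `n` with the patterns of `σ` and `τ`. -/
def psi (π : List ℕ) : List ℕ :=
  let n := π.length
  let σ := π.takeWhile (fun y => y ≠ n)
  let τ := (π.dropWhile (fun y => y ≠ n)).tail
  let L : Finset ℕ := (σ.map (fun x => x + shift (above σ τ x) + 1)).toFinset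
  let R : Finset ℕ := Finset.Icc 1 (n - 1) \ L
  unst L (st σ) ++ n :: unst R (st τ)

/-- `π̂`: insert a new largest letter immediately to the left of the `i`th left-to-right maximum
(at the only possible place if `π` is empty). -/
def hat (i : ℕ) (π : List ℕ) : List ℕ :=
  π.insertIdx ((lmaxPos π).getD (i - 1) π.length) (π.length + 1)

/-- The map `φ`. -/
def phi (i : ℕ) (π : List ℕ) : List ℕ := if i = 1 then hat 1 π else psi (hat i π)

end Word

/-- The defining recursion of the map `f`:
`f(leaf) = ε`, `f(λ(i,t)) = φ(i, f(t))`, and `f(u ⊕ v) = f(u) ⊕ f(v)`. -/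
def SatisfiesRecursion (f : BetaTree → List ℕ) : Prop :=
  f BetaTree.leaf = [] ∧
  (∀ (i : ℕ) (t : BetaTree) (h1 : 1 ≤ i) (h2 : i ≤ t.1.label),
    f (BetaTree.lam i t h1 h2) = Word.phi i (f t)) ∧
  (∀ (u v : BetaTree) (hu : u ≠ BetaTree.leaf) (hv : v ≠ BetaTree.leaf),
    f (BetaTree.oplus u v hu hv) = Word.oplus (f u) (f v))

-- Write a permutation as `σ n τ`. It is determined by the patterns of `σ` and `τ` together with its
-- cuts: the letter of rank `i` on the left exceeds exactly `c i` letters on the right. A forbidden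
-- pattern that uses both sides turns into a condition on the cuts. The permutation is an avoider if
-- and only if both patterns are avoiders, `c` is weakly increasing and constant on the inversions
-- of `σ`, and each value `c i` is admissible for `τ`, which is a condition on `τ` and that one
-- number (`isAvoider_of_isConfig`, `isConfig_of_avoids`).
--
-- The admissible cuts of `τ` include `0` and `|τ|`, and `ψ` keeps both patterns and moves every cut
-- to the next admissible one: `mᵢ + 1` is precisely the distance to it (`nextCut_of_pos`,
-- `shift_filter`, `psi_build`). So `ψ` is undone by moving every cut back. An admissible cut below
-- `|τ|` is below the first letter of `τ`; hence the configurations with all cuts below `|τ|` are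
-- those with `n` inserted at the front or just before a left-to-right maximum (`phi_base`,
-- `exists_base`). The configurations with all cuts positive are the words that are not a sum of two
-- nonempty words (`indec_build`, `pos_of_indec`). Altogether `φ` is a bijection from the pairs `(i,
-- w)` to the indecomposable avoiders with one more letter, and `i` is recovered as the number of
-- left-to-right maxima.
--
-- Trees split in the same way: `λ` yields the trees whose root has one child, and `⊕` concatenates
-- lists of subtrees, as words are concatenated from components. Existence, uniqueness and
-- bijectivity of `f` follow by induction along this decomposition.
--
-- Each pair of statistics satisfies one and the same recursion. Under `φ` the patterns of `σ` and
-- `τ` persist, which settles `asc`, `ldr` and `rmax`. The number of left-to-right minima grows by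
-- one since exactly one left-to-right minimum of `τ` has its value between consecutive admissible
-- cuts (`lminUpTo_nextCut`), and `lir` becomes `min i (lir w)` for nonempty `w` (`lir_build_next`).
-- On trees the peeling process is first turned into a recursion of that same shape (`IsBelow.peel`,
-- `IsBeta.stemhm_eq`).

namespace Word

/-! ### Letters -/

theorem letter_append_left {u : List ℕ} (v : List ℕ) {i : ℕ} (h : i < u.length) :
    letter (u ++ v) i = letter u i := by
  simp [letter, List.getElem?_append_left h]

theorem letter_append_right (u v : List ℕ) (i : ℕ) :
    letter (u ++ v) (u.length + i) = letter v i := by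
  rw [letter, letter, List.getD_append_right _ _ _ _ (by omega)]; simp

theorem letter_append_right' {u : List ℕ} (v : List ℕ) {i : ℕ} (h : u.length ≤ i) :
    letter (u ++ v) i = letter v (i - u.length) := by
  obtain ⟨j, rfl⟩ := Nat.exists_eq_add_of_le h
  rw [letter_append_right]; simp

theorem letter_eq_getElem {w : List ℕ} {i : ℕ} (h : i < w.length) : letter w i = w[i] := by
  simp [letter, h]

theorem letter_map (g : ℕ → ℕ) {w : List ℕ} {i : ℕ} (h : i < w.length) :
    letter (w.map g) i = g (letter w i) := by
  simp [letter, h]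

theorem letter_mem {w : List ℕ} {i : ℕ} (h : i < w.length) : letter w i ∈ w := by
  rw [letter_eq_getElem h]; exact List.getElem_mem h

theorem exists_letter_of_mem {w : List ℕ} {x : ℕ} (h : x ∈ w) :
    ∃ i < w.length, letter w i = x := by
  obtain ⟨i, hi, rfl⟩ := List.getElem_of_mem h
  exact ⟨i, hi, letter_eq_getElem hi⟩

theorem letter_inj {w : List ℕ} (hw : w.Nodup) {i j : ℕ} (hi : i < w.length) (hj : j < w.length)
    (h : letter w i = letter w j) : i = j := by
  rw [letter_eq_getElem hi, letter_eq_getElem hj] at h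
  exact (hw.getElem_inj_iff).1 h

/-! ### Permutations -/

theorem isPerm_iff {n : ℕ} {w : List ℕ} :
    IsPerm n w ↔ w.Nodup ∧ w.length = n ∧ ∀ x ∈ w, 1 ≤ x ∧ x ≤ n := by
  constructor
  · intro h
    refine ⟨h.nodup_iff.2 List.nodup_range', by simpa using h.length_eq, fun x hx => ?_⟩
    have := h.mem_iff.1 hx
    rw [List.mem_range'_1] at this
    omega
  · rintro ⟨h1, h2, h3⟩
    refine (List.subperm_of_subset h1 fun x hx => ?_).perm_of_length_le (by simp [h2])
    rw [List.mem_range'_1]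
    have := h3 x hx
    omega

theorem IsPerm.nodup {n : ℕ} {w : List ℕ} (h : IsPerm n w) : w.Nodup := (isPerm_iff.1 h).1

theorem IsPerm.length {n : ℕ} {w : List ℕ} (h : IsPerm n w) : w.length = n := (isPerm_iff.1 h).2.1

theorem IsPerm.mem_iff {n : ℕ} {w : List ℕ} (h : IsPerm n w) {x : ℕ} :
    x ∈ w ↔ 1 ≤ x ∧ x ≤ n := by
  rw [List.Perm.mem_iff h, List.mem_range'_1]
  omega

theorem IsPerm.exists_letter {n : ℕ} {w : List ℕ} (h : IsPerm n w) {x : ℕ} (h1 : 1 ≤ x)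
    (h2 : x ≤ n) : ∃ i < n, letter w i = x := by
  obtain ⟨i, hi, hx⟩ := exists_letter_of_mem (h.mem_iff.2 ⟨h1, h2⟩)
  exact ⟨i, by rwa [h.length] at hi, hx⟩

theorem IsPerm.letter_bounds {n : ℕ} {w : List ℕ} (h : IsPerm n w) {i : ℕ} (hi : i < n) :
    1 ≤ letter w i ∧ letter w i ≤ n :=
  h.mem_iff.1 (letter_mem (by rwa [h.length]))

theorem isPerm_zero {w : List ℕ} : IsPerm 0 w ↔ w = [] := by
  simp [IsPerm]

/-! ### Order preserving relabellings -/

/-- `g` is strictly increasing on the letters of `w`. -/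
def IncOn (g : ℕ → ℕ) (w : List ℕ) : Prop := ∀ a ∈ w, ∀ b ∈ w, a < b → g a < g b

theorem IncOn.lt_iff {g : ℕ → ℕ} {w : List ℕ} (h : IncOn g w) {a b : ℕ} (ha : a ∈ w)
    (hb : b ∈ w) : g a < g b ↔ a < b := by
  refine ⟨fun h1 => ?_, h a ha b hb⟩
  by_contra h2
  rcases Nat.lt_or_eq_of_le (not_lt.1 h2) with h3 | h3
  · have := h b hb a ha h3; omega
  · subst h3; omega

theorem IncOn.letter_lt_iff {g : ℕ → ℕ} {w : List ℕ} (h : IncOn g w) {i j : ℕ}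
    (hi : i < w.length) (hj : j < w.length) :
    letter (w.map g) i < letter (w.map g) j ↔ letter w i < letter w j := by
  rw [letter_map g hi, letter_map g hj, h.lt_iff (letter_mem hi) (letter_mem hj)]

theorem IncOn.avoids3142_map {g : ℕ → ℕ} {w : List ℕ} (h : IncOn g w) :
    Avoids3142 (w.map g) ↔ Avoids3142 w := by
  unfold Avoids3142
  refine not_congr ⟨?_, ?_⟩
  · rintro ⟨i, j, k, l, h1, h2, h3, h4, h5, h6, h7⟩
    rw [List.length_map] at h4
    exact ⟨i, j, k, l, h1, h2, h3, h4, (h.letter_lt_iff (by omega) (by omega)).1 h5,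
      (h.letter_lt_iff (by omega) (by omega)).1 h6, (h.letter_lt_iff (by omega) (by omega)).1 h7⟩
  · rintro ⟨i, j, k, l, h1, h2, h3, h4, h5, h6, h7⟩
    exact ⟨i, j, k, l, h1, h2, h3, by simpa using h4,
      (h.letter_lt_iff (by omega) (by omega)).2 h5, (h.letter_lt_iff (by omega) (by omega)).2 h6,
      (h.letter_lt_iff (by omega) (by omega)).2 h7⟩

theorem IncOn.avoids2413_map {g : ℕ → ℕ} {w : List ℕ} (h : IncOn g w) :
    Avoids2413 (w.map g) ↔ Avoids2413 w := by
  unfold Avoids2413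
  refine not_congr ⟨?_, ?_⟩
  · rintro ⟨i, j, k, h1, h2, h3, h4, h5, h6⟩
    rw [List.length_map] at h3
    exact ⟨i, j, k, h1, h2, h3, (h.letter_lt_iff (by omega) (by omega)).1 h4,
      (h.letter_lt_iff (by omega) (by omega)).1 h5, (h.letter_lt_iff (by omega) (by omega)).1 h6⟩
  · rintro ⟨i, j, k, h1, h2, h3, h4, h5, h6⟩
    exact ⟨i, j, k, h1, h2, by simpa using h3,
      (h.letter_lt_iff (by omega) (by omega)).2 h4, (h.letter_lt_iff (by omega) (by omega)).2 h5,
      (h.letter_lt_iff (by omega) (by omega)).2 h6⟩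

theorem IncOn.lmaxPos_map {g : ℕ → ℕ} {w : List ℕ} (h : IncOn g w) :
    lmaxPos (w.map g) = lmaxPos w := by
  unfold lmaxPos
  rw [List.length_map]
  refine List.filter_congr fun p hp => ?_
  rw [List.mem_range] at hp
  refine decide_eq_decide.2 (forall₂_congr fun q hq => ?_)
  rw [h.letter_lt_iff (by omega) hp]

theorem IncOn.lmax_map {g : ℕ → ℕ} {w : List ℕ} (h : IncOn g w) :
    lmax (w.map g) = lmax w := by
  rw [lmax, h.lmaxPos_map, lmax]

theorem IncOn.reverse {g : ℕ → ℕ} {w : List ℕ} (h : IncOn g w) : IncOn g w.reverse := by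
  intro a ha b hb
  exact h a (by simpa using ha) b (by simpa using hb)

theorem IncOn.rmax_map {g : ℕ → ℕ} {w : List ℕ} (h : IncOn g w) :
    rmax (w.map g) = rmax w := by
  rw [rmax, ← List.map_reverse, h.reverse.lmax_map, rmax]

theorem IncOn.lmin_map {g : ℕ → ℕ} {w : List ℕ} (h : IncOn g w) :
    lmin (w.map g) = lmin w := by
  unfold lmin
  rw [List.length_map]
  congr 1
  refine List.filter_congr fun p hp => ?_
  rw [List.mem_range] at hp
  refine decide_eq_decide.2 (forall₂_congr fun q hq => ?_)
  rw [h.letter_lt_iff hp (by omega)]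

theorem IncOn.asc_map {g : ℕ → ℕ} {w : List ℕ} (h : IncOn g w) :
    asc (w.map g) = asc w := by
  unfold asc
  rw [List.length_map]
  congr 1
  refine List.filter_congr fun p hp => ?_
  rw [List.mem_range] at hp
  refine decide_eq_decide.2 ?_
  rw [h.letter_lt_iff (by omega) (by omega)]

theorem IncOn.pairwise_lt_map {g : ℕ → ℕ} {w : List ℕ} (h : IncOn g w) :
    (w.map g).Pairwise (fun a b => a < b) ↔ w.Pairwise (fun a b => a < b) := by
  rw [List.pairwise_map]
  exact List.Pairwise.iff_of_mem fun ha hb => h.lt_iff ha hb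

theorem IncOn.pairwise_gt_map {g : ℕ → ℕ} {w : List ℕ} (h : IncOn g w) :
    (w.map g).Pairwise (fun a b => a > b) ↔ w.Pairwise (fun a b => a > b) := by
  rw [List.pairwise_map]
  exact List.Pairwise.iff_of_mem fun ha hb => h.lt_iff hb ha

theorem IncOn.take {g : ℕ → ℕ} {w : List ℕ} (h : IncOn g w) (k : ℕ) : IncOn g (w.take k) :=
  fun a ha b hb => h a (List.mem_of_mem_take ha) b (List.mem_of_mem_take hb)

/-! ### Initial runs -/

theorem le_lir_iff {w : List ℕ} {k : ℕ} :
    k ≤ lir w ↔ k ≤ w.length ∧ (w.take k).Pairwise (fun a b => a < b) := by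
  constructor
  · intro h
    refine ⟨h.trans (Nat.findGreatest_le _), ?_⟩
    have h1 : (w.take (lir w)).Pairwise (fun a b => a < b) :=
      Nat.findGreatest_spec (P := fun i => (w.take i).Pairwise (fun a b => a < b))
        (Nat.zero_le _) (by simp)
    exact h1.sublist (List.take_sublist_take_left h)
  · rintro ⟨h1, h2⟩
    exact Nat.le_findGreatest h1 h2

theorem le_ldr_iff {w : List ℕ} {k : ℕ} :
    k ≤ ldr w ↔ k ≤ w.length ∧ (w.take k).Pairwise (fun a b => a > b) := by
  constructor
  · intro h
    refine ⟨h.trans (Nat.findGreatest_le _), ?_⟩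
    have h1 : (w.take (ldr w)).Pairwise (fun a b => a > b) :=
      Nat.findGreatest_spec (P := fun i => (w.take i).Pairwise (fun a b => a > b))
        (Nat.zero_le _) (by simp)
    exact h1.sublist (List.take_sublist_take_left h)
  · rintro ⟨h1, h2⟩
    exact Nat.le_findGreatest h1 h2

theorem IncOn.lir_map {g : ℕ → ℕ} {w : List ℕ} (h : IncOn g w) : lir (w.map g) = lir w := by
  refine eq_of_forall_le_iff fun k => ?_
  rw [le_lir_iff, le_lir_iff, ← List.map_take, (h.take k).pairwise_lt_map, List.length_map]

theorem IncOn.ldr_map {g : ℕ → ℕ} {w : List ℕ} (h : IncOn g w) : ldr (w.map g) = ldr w := by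
  refine eq_of_forall_le_iff fun k => ?_
  rw [le_ldr_iff, le_ldr_iff, ← List.map_take, (h.take k).pairwise_gt_map, List.length_map]

/-! ### Statistics of concatenations -/

theorem length_filter_range_add (m n : ℕ) (P : ℕ → Bool) :
    ((List.range (m + n)).filter P).length =
      ((List.range m).filter P).length + ((List.range n).filter (fun q => P (m + q))).length := by
  rw [List.range_add, List.filter_append, List.length_append, List.filter_map, List.length_map]
  rfl

theorem forall_lt_add_iff {m q : ℕ} {P : ℕ → Prop} :
    (∀ r < m + q, P r) ↔ (∀ r < m, P r) ∧ ∀ r < q, P (m + r) := by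
  constructor
  · intro h
    exact ⟨fun r hr => h r (by omega), fun r hr => h _ (by omega)⟩
  · rintro ⟨h1, h2⟩ r hr
    by_cases h : r < m
    · exact h1 r h
    · have := h2 (r - m) (by omega)
      rwa [Nat.add_sub_cancel' (by omega)] at this

theorem forall_letter_append {u v : List ℕ} {q : ℕ} {P : ℕ → Prop} :
    (∀ r < u.length + q, P (letter (u ++ v) r)) ↔
      (∀ x ∈ u, P x) ∧ ∀ r < q, P (letter v r) := by
  rw [forall_lt_add_iff]
  refine and_congr ⟨fun h x hx => ?_, fun h r hr => ?_⟩
    (forall₂_congr fun r _ => by rw [letter_append_right])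
  · obtain ⟨i, hi, rfl⟩ := exists_letter_of_mem hx
    rw [← letter_append_left v hi]
    exact h i hi
  · rw [letter_append_left v hr]
    exact h _ (letter_mem hr)

theorem lmax_append (u v : List ℕ) :
    lmax (u ++ v) = lmax u + ((List.range v.length).filter (fun p =>
      (∀ x ∈ u, x < letter v p) ∧ ∀ q < p, letter v q < letter v p)).length := by
  unfold lmax lmaxPos
  rw [List.length_append, length_filter_range_add]
  congr 2
  · refine List.filter_congr fun p hp => ?_
    rw [List.mem_range] at hp
    refine decide_eq_decide.2 (forall₂_congr fun q hq => ?_)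
    rw [letter_append_left v hp, letter_append_left v (by omega)]
  · refine List.filter_congr fun p hp => ?_
    refine decide_eq_decide.2 ?_
    rw [letter_append_right, forall_letter_append (P := fun x => x < letter v p)]

theorem lmin_append (u v : List ℕ) :
    lmin (u ++ v) = lmin u + ((List.range v.length).filter (fun p =>
      (∀ x ∈ u, letter v p < x) ∧ ∀ q < p, letter v p < letter v q)).length := by
  unfold lmin
  rw [List.length_append, length_filter_range_add]
  congr 2
  · refine List.filter_congr fun p hp => ?_
    rw [List.mem_range] at hp
    refine decide_eq_decide.2 (forall₂_congr fun q hq => ?_)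
    rw [letter_append_left v hp, letter_append_left v (by omega)]
  · refine List.filter_congr fun p hp => ?_
    refine decide_eq_decide.2 ?_
    rw [letter_append_right, forall_letter_append (P := fun x => letter v p < x)]

theorem lmax_append_of_prec {u v : List ℕ} (h : Prec u v) : lmax (u ++ v) = lmax u + lmax v := by
  rw [lmax_append]
  congr 1
  unfold lmax lmaxPos
  congr 1
  refine List.filter_congr fun p hp => decide_eq_decide.2 (and_iff_right fun x hx => ?_)
  exact h x hx _ (letter_mem (List.mem_range.1 hp))

theorem lmax_append_of_dominated {u v : List ℕ} {x : ℕ} (hx : x ∈ u) (h : ∀ y ∈ v, y ≤ x) :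
    lmax (u ++ v) = lmax u := by
  rw [lmax_append, Nat.add_eq_left, List.length_eq_zero_iff, List.filter_eq_nil_iff]
  intro p hp h1
  have h2 := (of_decide_eq_true h1).1 x hx
  have h3 := h _ (letter_mem (List.mem_range.1 hp))
  omega

theorem lmin_append_of_prec {u v : List ℕ} (hu : u ≠ []) (h : Prec u v) :
    lmin (u ++ v) = lmin u := by
  rw [lmin_append, Nat.add_eq_left, List.length_eq_zero_iff, List.filter_eq_nil_iff]
  intro p hp h1
  obtain ⟨x, hx⟩ := List.exists_mem_of_ne_nil u hu
  have h2 := (of_decide_eq_true h1).1 x hx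
  have h3 := h _ hx _ (letter_mem (List.mem_range.1 hp))
  omega

theorem lmin_append_of_prec_left {u v : List ℕ} (h : Prec v u) :
    lmin (u ++ v) = lmin u + lmin v := by
  rw [lmin_append]
  congr 1
  unfold lmin
  congr 1
  refine List.filter_congr fun p hp => decide_eq_decide.2 (and_iff_right fun x hx => ?_)
  exact h _ (letter_mem (List.mem_range.1 hp)) _ hx

@[simp] theorem lmax_singleton (n : ℕ) : lmax [n] = 1 := by
  simp [lmax, lmaxPos, List.range_succ]

@[simp] theorem lmin_singleton (n : ℕ) : lmin [n] = 1 := by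
  simp [lmin, List.range_succ]

@[simp] theorem lmax_nil : lmax [] = 0 := rfl
@[simp] theorem lmin_nil : lmin [] = 0 := rfl
@[simp] theorem rmax_nil : rmax [] = 0 := rfl
@[simp] theorem asc_nil : asc [] = 0 := rfl
@[simp] theorem ldr_nil : ldr [] = 0 := rfl
@[simp] theorem asc_singleton (n : ℕ) : asc [n] = 0 := rfl

theorem lmax_le_length (w : List ℕ) : lmax w ≤ w.length := by
  unfold lmax lmaxPos
  exact (List.length_filter_le _ _).trans (by simp)

theorem lmax_take_le (w : List ℕ) (k : ℕ) : lmax (w.take k) ≤ lmax w := by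
  conv_rhs => rw [← List.take_append_drop k w, lmax_append]
  omega

theorem lmax_pos {w : List ℕ} (hw : w ≠ []) : 0 < lmax w := by
  obtain ⟨a, l, rfl⟩ := List.exists_cons_of_ne_nil hw
  have := lmax_append [a] l
  simp at this ⊢
  omega

theorem lmax_of_pairwise {w : List ℕ} (h : w.Pairwise (fun a b => a < b)) :
    lmax w = w.length := by
  induction w with
  | nil => rfl
  | cons a l ih =>
    rw [List.pairwise_cons] at h
    rw [← List.singleton_append, lmax_append_of_prec, ih h.2]
    · simp [add_comm]
    · intro x hx y hy
      rw [List.mem_singleton] at hx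
      exact hx ▸ h.1 y hy

theorem asc_append {u v : List ℕ} (hu : u ≠ []) (hv : v ≠ []) :
    asc (u ++ v) = asc u + asc v +
      if letter u (u.length - 1) < letter v 0 then 1 else 0 := by
  have h1 := List.length_pos_of_ne_nil hu
  have h2 := List.length_pos_of_ne_nil hv
  unfold asc
  have h3 : (u ++ v).length - 1 = (u.length - 1) + (1 + (v.length - 1)) := by
    rw [List.length_append]; omega
  rw [h3, length_filter_range_add, length_filter_range_add]
  have e1 : (List.range (u.length - 1)).filter
        (fun p => decide (letter (u ++ v) p < letter (u ++ v) (p + 1))) =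
      (List.range (u.length - 1)).filter (fun p => decide (letter u p < letter u (p + 1))) := by
    refine List.filter_congr fun p hp => ?_
    rw [List.mem_range] at hp
    rw [letter_append_left v (by omega), letter_append_left v (by omega)]
  have e2 : (List.range (v.length - 1)).filter
        (fun q => decide (letter (u ++ v) (u.length - 1 + (1 + q)) <
          letter (u ++ v) (u.length - 1 + (1 + q) + 1))) =
      (List.range (v.length - 1)).filter (fun p => decide (letter v p < letter v (p + 1))) := by
    refine List.filter_congr fun p hp => ?_
    rw [show u.length - 1 + (1 + p) = u.length + p by omega, add_assoc, letter_append_right,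
      letter_append_right]
  have e3 : letter (u ++ v) (u.length - 1) = letter u (u.length - 1) :=
    letter_append_left v (by omega)
  have e4 : letter (u ++ v) (u.length - 1 + 0 + 1) = letter v 0 := by
    rw [show u.length - 1 + 0 + 1 = u.length + 0 by omega, letter_append_right]
  rw [e1, e2]
  simp only [List.range_one, List.filter_cons, List.filter_nil]
  rw [e4, add_zero, e3]
  split_ifs <;> simp_all
  omega

theorem ldr_append {u v : List ℕ} (hu : u ≠ []) (hv : v ≠ [])
    (h : letter u (u.length - 1) < letter v 0) : ldr (u ++ v) = ldr u := by
  have h1 := List.length_pos_of_ne_nil hu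
  have h2 := List.length_pos_of_ne_nil hv
  refine eq_of_forall_le_iff fun k => ?_
  rw [le_ldr_iff, le_ldr_iff]
  by_cases hk : k ≤ u.length
  · rw [List.take_append_of_le_length hk, List.length_append]
    simp only [hk, true_and, and_iff_right_iff_imp]
    omega
  · simp only [hk, false_and, iff_false, not_and]
    intro h3 h4
    rw [List.pairwise_iff_getElem] at h4
    rw [List.length_append] at h3
    have h5 := h4 (u.length - 1) u.length (by simp; omega) (by simp; omega) (by omega)
    rw [List.getElem_take, List.getElem_take, ← letter_eq_getElem, ← letter_eq_getElem,
      letter_append_left v (by omega), letter_append_right' v le_rfl] at h5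
    simp at h5
    omega

theorem ldr_cons {n : ℕ} {w : List ℕ} (h : ∀ x ∈ w, x < n) : ldr (n :: w) = ldr w + 1 := by
  refine eq_of_forall_le_iff fun k => ?_
  cases k with
  | zero => simp
  | succ k =>
    rw [le_ldr_iff, Nat.succ_le_succ_iff, le_ldr_iff, List.take_succ_cons, List.pairwise_cons,
      List.length_cons, Nat.succ_le_succ_iff]
    refine and_congr_right fun _ => and_iff_right fun x hx => h x (List.mem_of_mem_take hx)

theorem lir_cons {n : ℕ} {w : List ℕ} (h : ∀ x ∈ w, x < n) : lir (n :: w) = 1 := by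
  refine eq_of_forall_le_iff fun k => ?_
  rcases k with _ | _ | k
  · simp
  · simp [le_lir_iff]
  · rw [le_lir_iff]
    refine iff_of_false ?_ (by omega)
    rintro ⟨h1, h2⟩
    obtain ⟨a, l, rfl⟩ := List.exists_cons_of_ne_nil (l := w) (by rintro rfl; simp at h1)
    rw [List.take_succ_cons, List.take_succ_cons, List.pairwise_cons] at h2
    have h3 := h2.1 a (by simp)
    have h4 := h a (by simp)
    omega

theorem lir_append_of_prec {u v : List ℕ} (h : Prec u v) :
    lir (u ++ v) = if lir u = u.length then u.length + lir v else lir u := by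
  split_ifs with hu
  · refine eq_of_forall_le_iff fun k => ?_
    have h1 := (le_lir_iff.1 hu.ge).2
    rw [List.take_length] at h1
    rw [le_lir_iff]
    by_cases hk : k ≤ u.length
    · rw [List.take_append_of_le_length hk]
      refine iff_of_true ⟨by simp; omega, h1.sublist (List.take_sublist _ _)⟩ (by omega)
    · obtain ⟨j, rfl⟩ := Nat.exists_eq_add_of_le (not_le.1 hk).le
      rw [List.take_length_add_append, List.length_append, Nat.add_le_add_iff_left,
        Nat.add_le_add_iff_left, le_lir_iff, List.pairwise_append]
      refine and_congr_right fun _ => ⟨fun h2 => h2.2.1, fun h2 => ⟨h1, h2, ?_⟩⟩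
      exact fun x hx y hy => h x hx y (List.mem_of_mem_take hy)
  · refine eq_of_forall_le_iff fun k => ?_
    rw [le_lir_iff, le_lir_iff]
    by_cases hk : k ≤ u.length
    · rw [List.take_append_of_le_length hk, List.length_append]
      simp only [hk, true_and, and_iff_right_iff_imp]
      omega
    · simp only [hk, false_and, iff_false, not_and]
      intro h3 h4
      refine hu (le_antisymm (le_lir_iff.1 le_rfl).1 (le_lir_iff.2 ⟨le_rfl, ?_⟩))
      rw [List.take_length]
      refine h4.sublist ?_
      have h5 : u = (u ++ v).take u.length := by simp
      conv_lhs => rw [h5]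
      exact List.take_sublist_take_left (by omega)

/-! ### Pattern avoidance of concatenations -/

/-- In `3142` the first letter exceeds the last one, so an occurrence cannot begin in `u` and end in
`v`. -/
theorem avoids3142_append {u v : List ℕ} (h : Prec u v) :
    Avoids3142 (u ++ v) ↔ Avoids3142 u ∧ Avoids3142 v := by
  unfold Avoids3142
  rw [← not_or, not_iff_not]
  constructor
  · rintro ⟨i, j, k, l, h1, h2, h3, h4, h5, h6, h7⟩
    rw [List.length_append] at h4
    by_cases hi : i < u.length
    · by_cases hl : l < u.length
      · left
        refine ⟨i, j, k, l, h1, h2, h3, hl, ?_⟩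
        simp only [letter_append_left v hl, letter_append_left v hi,
          letter_append_left v (h3.trans hl), letter_append_left v (h2.trans (h3.trans hl))] at *
        exact ⟨h5, h6, h7⟩
      · rw [letter_append_left v hi, letter_append_right' v (not_lt.1 hl)] at h6
        have := h _ (letter_mem hi) _ (letter_mem (w := v) (i := l - u.length) (by omega))
        omega
    · right
      rw [not_lt] at hi
      refine ⟨i - u.length, j - u.length, k - u.length, l - u.length, by omega, by omega,
        by omega, by omega, ?_⟩
      rw [letter_append_right' v (by omega), letter_append_right' v (by omega)] at h5 h6 h7
      exact ⟨h5, h6, h7⟩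
  · rintro (⟨i, j, k, l, h1, h2, h3, h4, h5, h6, h7⟩ | ⟨i, j, k, l, h1, h2, h3, h4, h5, h6, h7⟩)
    · refine ⟨i, j, k, l, h1, h2, h3, by simp; omega, ?_⟩
      rw [letter_append_left v (by omega), letter_append_left v (by omega),
        letter_append_left v (by omega), letter_append_left v (by omega)]
      exact ⟨h5, h6, h7⟩
    · refine ⟨u.length + i, u.length + j, u.length + k, u.length + l, by omega, by omega,
        by omega, by simp; omega, ?_⟩
      simp only [letter_append_right]
      exact ⟨h5, h6, h7⟩

/-- If the `2` lies in `u`, then so does the smaller `1`, hence also the `4` preceding it, hence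
also the `3`, which is smaller than the `4`. -/
theorem avoids2413_append {u v : List ℕ} (h : Prec u v) :
    Avoids2413 (u ++ v) ↔ Avoids2413 u ∧ Avoids2413 v := by
  unfold Avoids2413
  rw [← not_or, not_iff_not]
  constructor
  · rintro ⟨i, j, k, h1, h2, h3, h4, h5, h6⟩
    rw [List.length_append] at h3
    by_cases hi : i < u.length
    · by_cases hj : j + 1 < u.length
      · by_cases hk : k < u.length
        · left
          refine ⟨i, j, k, h1, h2, hk, ?_⟩
          simp only [letter_append_left v hj, letter_append_left v hi,
            letter_append_left v hk, letter_append_left v (show j < u.length by omega)] at *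
          exact ⟨h4, h5, h6⟩
        · rw [letter_append_left (i := j) v (by omega),
            letter_append_right' (i := k) v (by omega)] at h6
          have := h _ (letter_mem (w := u) (i := j) (by omega)) _
            (letter_mem (w := v) (i := k - u.length) (by omega))
          omega
      · rw [letter_append_left v hi, letter_append_right' v (not_lt.1 hj)] at h4
        have := h _ (letter_mem hi) _ (letter_mem (w := v) (i := j + 1 - u.length) (by omega))
        omega
    · right
      rw [not_lt] at hi
      rw [letter_append_right' v (by omega), letter_append_right' v (by omega)] at h4 h5 h6
      rw [Nat.sub_add_comm (by omega)] at h4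
      exact ⟨i - u.length, j - u.length, k - u.length, by omega, by omega, by omega, h4, h5, h6⟩
  · rintro (⟨i, j, k, h1, h2, h3, h4, h5, h6⟩ | ⟨i, j, k, h1, h2, h3, h4, h5, h6⟩)
    · refine ⟨i, j, k, h1, h2, by simp; omega, ?_⟩
      rw [letter_append_left v (by omega), letter_append_left v (by omega),
        letter_append_left v (by omega), letter_append_left v (by omega)]
      exact ⟨h4, h5, h6⟩
    · refine ⟨u.length + i, u.length + j, u.length + k, by omega, by omega, by simp; omega, ?_⟩
      simp only [letter_append_right, add_assoc]
      exact ⟨h4, h5, h6⟩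

/-- Inserting a new largest letter in front of a letter which exceeds everything to its left. -/
theorem avoids_insert_iff {u v : List ℕ} {m n : ℕ} (hm : ∀ x ∈ u, x < m)
    (hn : ∀ x ∈ u ++ m :: v, x < n) :
    (Avoids3142 (u ++ n :: m :: v) ∧ Avoids2413 (u ++ n :: m :: v)) ↔
      (Avoids3142 (u ++ m :: v) ∧ Avoids2413 (u ++ m :: v)) := by
  set π := u ++ m :: v with hπ
  set π' := u ++ n :: m :: v with hπ'
  have hlen : π'.length = π.length + 1 := by simp [hπ, hπ']; omega
  have hlu : u.length < π.length := by simp [hπ]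
  have low : ∀ q < u.length, letter π' q = letter π q := fun q hq => by
    rw [letter_append_left _ hq, letter_append_left _ hq]
  have mid : letter π' u.length = n := by
    rw [letter_append_right' _ le_rfl]; simp [letter]
  have midm : letter π u.length = m := by
    rw [letter_append_right' _ le_rfl]; simp [letter]
  have high : ∀ q, u.length ≤ q → letter π' (q + 1) = letter π q := fun q hq => by
    rw [letter_append_right' _ hq, letter_append_right' _ (by omega),
      show q + 1 - u.length = q - u.length + 1 by omega]
    simp [letter]
  have lown : ∀ q < π.length, letter π q < n := fun q hq => hn _ (letter_mem hq)
  have lowm : ∀ q < u.length, letter π q < m := fun q hq => by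
    rw [letter_append_left _ hq]; exact hm _ (letter_mem hq)
  have down : ∀ q < π'.length, q ≠ u.length →
      letter π' q = letter π (if q < u.length then q else q - 1) := fun q hq hne => by
    split_ifs with h
    · exact low q h
    · rw [← high (q - 1) (by omega), Nat.sub_add_cancel (by omega)]
  have up : ∀ q, letter π q = letter π' (if q < u.length then q else q + 1) := fun q => by
    split_ifs with h
    · exact (low q h).symm
    · rw [high q (by omega)]
  have le_n : ∀ q < π'.length, letter π' q ≤ n := fun q hq => by
    by_cases h : q = u.length
    · rw [h, mid]
    · rw [down q hq h]
      refine (lown _ ?_).le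
      split_ifs <;> omega
  constructor
  · rintro ⟨h1, h2⟩
    constructor
    · rintro ⟨i, j, k, l, h3, h4, h5, h6, h7, h8, h9⟩
      rw [up i, up j, up k, up l] at *
      refine h1 ⟨_, _, _, _, ?_, ?_, ?_, ?_, h7, h8, h9⟩ <;> split_ifs <;> omega
    · rintro ⟨i, j, k, h3, h4, h5, h6, h7, h8⟩
      -- The new letter separates an adjacent pair only if the second member is `m`. As the `1` of
      -- the pattern, `m` would be smaller than an earlier letter, which lies in `u`.
      by_cases hj : j + 1 = u.length
      · rw [hj, midm] at h6
        have := lowm i (by omega)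
        omega
      · have hj1 : (if j + 1 < u.length then j + 1 else j + 1 + 1) =
            (if j < u.length then j else j + 1) + 1 := by split_ifs <;> omega
        rw [up i, up (j + 1), up k, up j] at *
        rw [hj1] at h6
        refine h2 ⟨_, _, _, ?_, ?_, ?_, h6, h7, h8⟩ <;> split_ifs <;> omega
  · rintro ⟨h1, h2⟩
    constructor
    · rintro ⟨i, j, k, l, h3, h4, h5, h6, h7, h8, h9⟩
      have b1 := le_n k (by omega)
      have hi : i ≠ u.length := by rintro rfl; omega
      have hj : j ≠ u.length := by rintro rfl; omega
      have hl : l ≠ u.length := by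
        rintro rfl
        have := le_n i (by omega)
        omega
      -- The new letter can only play the `4`. Then `m` replaces it: the `3` lies in `u`, so it is
      -- below `m`, and therefore `m` is not the `2` either.
      by_cases hk : k = u.length
      · have e1 := down i (by omega) hi
        have e2 := down j (by omega) hj
        have e3 := down l (by omega) hl
        rw [if_pos (by omega)] at e1 e2
        rw [if_neg (by omega)] at e3
        have hl2 : l ≠ u.length + 1 := by
          rintro rfl
          have := lowm i (by omega)
          rw [Nat.add_sub_cancel, midm] at e3
          omega
        have := lowm i (by omega)
        exact h1 ⟨i, j, u.length, l - 1, by omega, by omega, by omega, by omega, by omega,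
          by omega, by omega⟩
      · rw [down i (by omega) hi, down j (by omega) hj, down k (by omega) hk,
          down l (by omega) hl] at *
        refine h1 ⟨_, _, _, _, ?_, ?_, ?_, ?_, h7, h8, h9⟩ <;> split_ifs <;> omega
    · rintro ⟨i, j, k, h3, h4, h5, h6, h7, h8⟩
      have b1 := le_n j (by omega)
      have hi : i ≠ u.length := by rintro rfl; omega
      have hk : k ≠ u.length := by rintro rfl; omega
      have hj1 : j + 1 ≠ u.length := by
        intro h
        rw [h, mid] at h6
        have := le_n i (by omega)
        omega
      -- If the new letter is the `4`, the adjacent `1` is `m`, which exceeds the `2` in `u`.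
      by_cases hj : j = u.length
      · have e1 := high u.length le_rfl
        rw [midm, ← hj] at e1
        have := lowm i (by omega)
        rw [low i (by omega)] at h6
        omega
      · have hj2 : (if j + 1 < u.length then j + 1 else j + 1 - 1) =
            (if j < u.length then j else j - 1) + 1 := by split_ifs <;> omega
        rw [down i (by omega) hi, down (j + 1) (by omega) hj1, down k (by omega) hk,
          down j (by omega) hj] at *
        rw [hj2] at h6
        refine h2 ⟨_, _, _, ?_, ?_, ?_, h6, h7, h8⟩ <;> split_ifs <;> omega

/-! ### Words with a distinguished largest letter

A permutation `π = σ n τ` is encoded by the patterns of `σ` and `τ` and by the cut function `c`: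
the `i`th smallest letter of `σ` exceeds exactly `c i` letters of `τ`. -/

/-- The letter of rank `i` on the left. -/
def lowLetter (c : ℕ → ℕ) (i : ℕ) : ℕ := i + c i

/-- The number of letters on the left lying below the letter of rank `y` on the right. -/
def countBelow (p : ℕ) (c : ℕ → ℕ) (y : ℕ) : ℕ := ((Finset.Icc 1 p).filter (fun i => c i < y)).card

/-- The letter of rank `y` on the right. -/
def highLetter (p : ℕ) (c : ℕ → ℕ) (y : ℕ) : ℕ := y + countBelow p c y

/-- The word with patterns `σ`, `τ` on the two sides of the largest letter and cut function `c`. -/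
def build (σ τ : List ℕ) (c : ℕ → ℕ) : List ℕ :=
  σ.map (lowLetter c) ++ (σ.length + τ.length + 1) :: τ.map (highLetter σ.length c)

/-- `c` is weakly increasing on `[p]` with values at most `N`. -/
structure IsCut (p N : ℕ) (c : ℕ → ℕ) : Prop where
  mono : ∀ i j, 1 ≤ i → i ≤ j → j ≤ p → c i ≤ c j
  le : ∀ i, 1 ≤ i → i ≤ p → c i ≤ N

section Cut

variable {p N : ℕ} {c : ℕ → ℕ}

/-- By monotonicity the indices with `c i < y` form an initial segment of `[p]`, whose length is
`countBelow p c y`. This bound and the next one locate `i` relative to that segment. -/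
theorem IsCut.le_countBelow (h : IsCut p N c) {i y : ℕ} (h2 : i ≤ p) (hy : c i < y) :
    i ≤ countBelow p c y := by
  have : Finset.Icc 1 i ⊆ (Finset.Icc 1 p).filter (fun i => c i < y) := by
    intro j hj
    rw [Finset.mem_Icc] at hj
    rw [Finset.mem_filter, Finset.mem_Icc]
    exact ⟨⟨hj.1, hj.2.trans h2⟩, (h.mono j i hj.1 hj.2 h2).trans_lt hy⟩
  simpa [countBelow] using Finset.card_le_card this

theorem IsCut.countBelow_lt (h : IsCut p N c) {i y : ℕ} (h1 : 1 ≤ i) (hy : y ≤ c i) :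
    countBelow p c y < i := by
  have : (Finset.Icc 1 p).filter (fun i => c i < y) ⊆ Finset.Ico 1 i := by
    intro j hj
    rw [Finset.mem_filter, Finset.mem_Icc] at hj
    rw [Finset.mem_Ico]
    refine ⟨hj.1.1, ?_⟩
    by_contra h3
    have := h.mono i j h1 (not_lt.1 h3) hj.1.2
    omega
  have := Finset.card_le_card this
  rw [Nat.card_Ico] at this
  unfold countBelow
  omega

theorem countBelow_le (p : ℕ) (c : ℕ → ℕ) (y : ℕ) : countBelow p c y ≤ p := by
  have := Finset.card_filter_le (Finset.Icc 1 p) (fun i => c i < y)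
  simpa [countBelow] using this

theorem highLetter_strictMono (p : ℕ) (c : ℕ → ℕ) : StrictMono (highLetter p c) := by
  intro a b hab
  have : countBelow p c a ≤ countBelow p c b := by
    refine Finset.card_le_card fun i hi => ?_
    rw [Finset.mem_filter] at hi ⊢
    exact ⟨hi.1, hi.2.trans hab⟩
  unfold highLetter
  omega

theorem IsCut.lowLetter_lt_iff (h : IsCut p N c) {i j : ℕ} (hi : 1 ≤ i ∧ i ≤ p)
    (hj : 1 ≤ j ∧ j ≤ p) : lowLetter c i < lowLetter c j ↔ i < j := by
  unfold lowLetter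
  constructor
  · intro h1
    by_contra h2
    have := h.mono j i hj.1 (by omega) hi.2
    omega
  · intro h1
    have := h.mono i j hi.1 h1.le hj.2
    omega

/-- Both summands of the letters compare in the same direction: `c i < y` forces `i ≤ countBelow p c
y`, and otherwise `countBelow p c y < i`. -/
theorem IsCut.low_lt_high_iff (h : IsCut p N c) {i y : ℕ} (hi : 1 ≤ i ∧ i ≤ p) :
    lowLetter c i < highLetter p c y ↔ c i < y := by
  unfold lowLetter highLetter
  constructor
  · intro h1
    by_contra h2
    have := h.countBelow_lt hi.1 (not_lt.1 h2)
    omega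
  · intro h1
    have := h.le_countBelow hi.2 h1
    omega

theorem IsCut.high_lt_low_iff (h : IsCut p N c) {i y : ℕ} (hi : 1 ≤ i ∧ i ≤ p) :
    highLetter p c y < lowLetter c i ↔ y ≤ c i := by
  unfold lowLetter highLetter
  constructor
  · intro h1
    by_contra h2
    have := h.le_countBelow hi.2 (not_le.1 h2)
    omega
  · intro h1
    have := h.countBelow_lt hi.1 h1
    omega

theorem IsCut.lowLetter_bounds (h : IsCut p N c) {i : ℕ} (hi : 1 ≤ i ∧ i ≤ p) :
    1 ≤ lowLetter c i ∧ lowLetter c i ≤ p + N := by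
  have := h.le i hi.1 hi.2
  unfold lowLetter
  omega

theorem highLetter_bounds (p : ℕ) (c : ℕ → ℕ) {y : ℕ} (hy : 1 ≤ y ∧ y ≤ N) :
    1 ≤ highLetter p c y ∧ highLetter p c y ≤ p + N := by
  have := countBelow_le p c y
  unfold highLetter
  omega

end Cut

/-- The positions at which a letter on the left may be inserted into the order of the letters of
`τ`. -/
structure Adm (τ : List ℕ) (s : ℕ) : Prop where
  le : s ≤ τ.length
  no132 : ∀ i j k, i < j → j < k → k < τ.length → letter τ i < letter τ k → letter τ k ≤ s →
    s < letter τ j → False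
  no312 : ∀ j k, j + 1 < k → k < τ.length → letter τ (j + 1) ≤ s → s < letter τ k →
    letter τ k < letter τ j → False
  first : s < τ.length → s < letter τ 0

-- Pattern avoidance in terms of patterns and cuts

section Build

variable {σ τ : List ℕ} {c : ℕ → ℕ}

theorem letter_build_low {q : ℕ} (hq : q < σ.length) :
    letter (build σ τ c) q = lowLetter c (letter σ q) := by
  rw [build, letter_append_left _ (by simpa), letter_map _ hq]

theorem letter_build_mid : letter (build σ τ c) σ.length = σ.length + τ.length + 1 := by
  rw [build, letter_append_right' _ (by simp)]
  simp [letter]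

theorem letter_build_high {q : ℕ} (hq : q < τ.length) :
    letter (build σ τ c) (σ.length + 1 + q) = highLetter σ.length c (letter τ q) := by
  rw [build, letter_append_right' _ (by simp; omega), ← letter_map (highLetter σ.length c) hq]
  rw [List.length_map, show σ.length + 1 + q - σ.length = q + 1 by omega]
  simp [letter]

theorem length_build : (build σ τ c).length = σ.length + τ.length + 1 := by
  simp [build]; omega

theorem incOn_low (hσ : IsPerm σ.length σ) (hc : IsCut σ.length τ.length c) :
    IncOn (lowLetter c) σ := fun _ ha _ hb h =>
  (hc.lowLetter_lt_iff (hσ.mem_iff.1 ha) (hσ.mem_iff.1 hb)).2 h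

theorem incOn_high (p : ℕ) (c : ℕ → ℕ) (τ : List ℕ) : IncOn (highLetter p c) τ :=
  fun _ _ _ _ h => highLetter_strictMono p c h

theorem isPerm_build (hσ : IsPerm σ.length σ) (hτ : IsPerm τ.length τ)
    (hc : IsCut σ.length τ.length c) :
    IsPerm (σ.length + τ.length + 1) (build σ τ c) := by
  rw [isPerm_iff]
  refine ⟨?_, length_build, ?_⟩
  · rw [build, List.nodup_append, List.nodup_cons]
    refine ⟨?_, ⟨?_, ?_⟩, ?_⟩
    · refine List.Nodup.map_on (fun a ha b hb h => ?_) hσ.nodup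
      have h1 := hc.lowLetter_lt_iff (hσ.mem_iff.1 ha) (hσ.mem_iff.1 hb)
      have h2 := hc.lowLetter_lt_iff (hσ.mem_iff.1 hb) (hσ.mem_iff.1 ha)
      omega
    · rw [List.mem_map]
      rintro ⟨y, hy, h⟩
      have := highLetter_bounds σ.length c (hτ.mem_iff.1 hy)
      omega
    · exact hτ.nodup.map (highLetter_strictMono _ _).injective
    · intro a ha b hb h
      rw [List.mem_map] at ha
      obtain ⟨x, hx, rfl⟩ := ha
      rw [List.mem_cons, List.mem_map] at hb
      have h1 := hc.lowLetter_bounds (hσ.mem_iff.1 hx)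
      rcases hb with rfl | ⟨y, hy, rfl⟩
      · omega
      · have h2 := hc.low_lt_high_iff (y := y) (hσ.mem_iff.1 hx)
        have h3 := hc.high_lt_low_iff (y := y) (hσ.mem_iff.1 hx)
        omega
  · intro x hx
    rw [build, List.mem_append, List.mem_cons, List.mem_map, List.mem_map] at hx
    rcases hx with ⟨x, hx, rfl⟩ | rfl | ⟨y, hy, rfl⟩
    · have h1 := hc.lowLetter_bounds (hσ.mem_iff.1 hx)
      omega
    · omega
    · have := highLetter_bounds σ.length c (hτ.mem_iff.1 hy)
      omega

/-- The patterns and the cut function of an avoider. -/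
structure IsConfig (σ τ : List ℕ) (c : ℕ → ℕ) : Prop where
  left : IsAvoider σ.length σ
  right : IsAvoider τ.length τ
  cut : IsCut σ.length τ.length c
  block : σ.Pairwise (fun a b => b < a → c a = c b)
  adm : ∀ i, 1 ≤ i → i ≤ σ.length → Adm τ (c i)

/-- An occurrence whose last letter is on the left lies in `σ`. Otherwise, if its `1` is on the
left, a letter of `τ` has its value inside an inversion of `σ`, against `block`. If only the first
letter is on the left, that letter together with its cut violates `no132` or `no312`, or `first`
when the largest letter plays the `4` of `2-41-3`. What remains lies in `τ`. -/
theorem isAvoider_of_isConfig (h : IsConfig σ τ c) :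
    IsAvoider (σ.length + τ.length + 1) (build σ τ c) := by
  obtain ⟨⟨hσ, hσ1, hσ2⟩, ⟨hτ, hτ1, hτ2⟩, hc, hb, ha⟩ := h
  refine ⟨isPerm_build hσ hτ hc, ?_, ?_⟩
  all_goals
    have bl : ∀ q < σ.length, 1 ≤ letter σ q ∧ letter σ q ≤ σ.length :=
      fun q hq => hσ.letter_bounds hq
    have bh : ∀ q < τ.length, 1 ≤ letter τ q ∧ letter τ q ≤ τ.length :=
      fun q hq => hτ.letter_bounds hq
    have le_mid : ∀ q < σ.length + τ.length + 1,
        letter (build σ τ c) q ≤ σ.length + τ.length + 1 := fun q hq =>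
      ((isPerm_build hσ hτ hc).letter_bounds hq).2
    -- No letter on the right has its value between the two letters of an inversion on the left.
    have hb' : ∀ i j, i < j → j < σ.length → ∀ q < τ.length,
        lowLetter c (letter σ j) < highLetter σ.length c (letter τ q) →
        highLetter σ.length c (letter τ q) < lowLetter c (letter σ i) → False := by
      intro i j hij hj q hq h1 h2
      have h3 := (hc.lowLetter_lt_iff (bl j hj) (bl i (hij.trans hj))).1 (h1.trans h2)
      rw [hc.low_lt_high_iff (bl j hj)] at h1
      rw [hc.high_lt_low_iff (bl i (hij.trans hj))] at h2
      rw [List.pairwise_iff_getElem] at hb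
      have h4 := hb i j (hij.trans hj) hj hij
      rw [← letter_eq_getElem hj, ← letter_eq_getElem (hij.trans hj)] at h4
      have := h4 h3
      omega
  · rintro ⟨i, j, k, l, h1, h2, h3, h4, h5, h6, h7⟩
    rw [length_build] at h4
    have bk := le_mid k (by omega)
    by_cases hl : l < σ.length
    · rw [letter_build_low (by omega), letter_build_low (by omega),
        hc.lowLetter_lt_iff (bl _ (by omega)) (bl _ (by omega))] at h5 h6 h7
      exact hσ1 ⟨i, j, k, l, h1, h2, h3, hl, h5, h6, h7⟩
    have hl2 : l ≠ σ.length := by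
      rintro rfl
      rw [letter_build_mid] at h6
      omega
    obtain ⟨l, rfl⟩ : ∃ l', l = σ.length + 1 + l' := Nat.exists_eq_add_of_le (by omega)
    have hl3 : l < τ.length := by omega
    rw [letter_build_high hl3] at h5 h6
    by_cases hj : j < σ.length
    · rw [letter_build_low (by omega)] at h5 h6
      exact hb' i j h1 hj l hl3 h5 h6
    have hj2 : j ≠ σ.length := by
      rintro rfl
      rw [letter_build_mid] at h5
      omega
    obtain ⟨j, rfl⟩ : ∃ l', j = σ.length + 1 + l' := Nat.exists_eq_add_of_le (by omega)
    obtain ⟨k, rfl⟩ : ∃ l', k = σ.length + 1 + l' := Nat.exists_eq_add_of_le (by omega)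
    rw [letter_build_high (by omega)] at h5 h7
    rw [(highLetter_strictMono _ _).lt_iff_lt] at h5
    by_cases hi : i < σ.length
    · rw [letter_build_low hi] at h6 h7
      rw [hc.low_lt_high_iff (bl i hi)] at h7
      rw [hc.high_lt_low_iff (bl i hi)] at h6
      exact (ha _ (bl i hi).1 (bl i hi).2).no132 j k l (by omega) (by omega) hl3 h5 h6 h7
    have hi2 : i ≠ σ.length := by
      rintro rfl
      rw [letter_build_mid, ← letter_build_high (by omega)] at h7
      omega
    obtain ⟨i, rfl⟩ : ∃ l', i = σ.length + 1 + l' := Nat.exists_eq_add_of_le (by omega)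
    rw [letter_build_high (by omega), (highLetter_strictMono _ _).lt_iff_lt] at h6 h7
    exact hτ1 ⟨i, j, k, l, by omega, by omega, by omega, hl3, h5, h6, h7⟩
  · rintro ⟨i, j, k, h1, h2, h3, h4, h5, h6⟩
    rw [length_build] at h3
    have bj := le_mid j (by omega)
    by_cases hk : k < σ.length
    · rw [letter_build_low (by omega), letter_build_low (by omega),
        hc.lowLetter_lt_iff (bl _ (by omega)) (bl _ (by omega))] at h4 h5 h6
      exact hσ2 ⟨i, j, k, h1, h2, hk, h4, h5, h6⟩
    have hk2 : k ≠ σ.length := by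
      rintro rfl
      rw [letter_build_mid] at h6
      omega
    obtain ⟨k, rfl⟩ : ∃ l', k = σ.length + 1 + l' := Nat.exists_eq_add_of_le (by omega)
    have hk3 : k < τ.length := by omega
    have h7 := h4.trans h5
    rw [letter_build_high hk3] at h5 h6 h7
    by_cases hj : j + 1 < σ.length
    · rw [letter_build_low (by omega)] at h6 h7
      exact hb' j (j + 1) (by omega) hj k hk3 h7 h6
    have hj2 : j + 1 ≠ σ.length := by
      intro h
      have := le_mid i (by omega)
      rw [h, letter_build_mid] at h4
      omega
    -- Here the largest letter plays the `4`, and the first letter of `τ` plays the adjacent `1`.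
    by_cases hj3 : j = σ.length
    · rw [letter_build_low (by omega), hc.low_lt_high_iff (bl i (by omega))] at h5
      rw [hj3, show σ.length + 1 = σ.length + 1 + 0 by omega, letter_build_high (by omega),
        letter_build_low (by omega), hc.high_lt_low_iff (bl i (by omega))] at h4
      have h8 := (ha _ (bl i (by omega)).1 (bl i (by omega)).2).first
      have := (bh k hk3).2
      omega
    obtain ⟨j, rfl⟩ : ∃ l', j = σ.length + 1 + l' := Nat.exists_eq_add_of_le (by omega)
    rw [add_assoc, letter_build_high (by omega)] at h4
    rw [letter_build_high (by omega), (highLetter_strictMono _ _).lt_iff_lt] at h6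
    by_cases hi : i < σ.length
    · rw [letter_build_low hi] at h4 h5
      rw [hc.low_lt_high_iff (bl i hi)] at h5
      rw [hc.high_lt_low_iff (bl i hi)] at h4
      exact (ha _ (bl i hi).1 (bl i hi).2).no312 j k (by omega) hk3 h4 h5 h6
    have hi2 : i ≠ σ.length := by
      rintro rfl
      have := le_mid (σ.length + 1 + k) (by omega)
      rw [letter_build_high hk3] at this
      rw [letter_build_mid] at h5
      omega
    obtain ⟨i, rfl⟩ : ∃ l', i = σ.length + 1 + l' := Nat.exists_eq_add_of_le (by omega)
    rw [letter_build_high (by omega), (highLetter_strictMono _ _).lt_iff_lt] at h4 h5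
    exact hτ2 ⟨i, j, k, by omega, by omega, hk3, h4, h5, h6⟩

/-- Each failing condition is completed to a forbidden pattern. For `no132` and `no312` a letter on
the left with that cut is put in front as the `3` or the `2`; for `block` and `first` the largest
letter serves as the `4`. -/
theorem isConfig_of_avoids (hσ : IsPerm σ.length σ) (hτ : IsPerm τ.length τ)
    (hc : IsCut σ.length τ.length c) (h3142 : Avoids3142 (build σ τ c))
    (h2413 : Avoids2413 (build σ τ c)) : IsConfig σ τ c := by
  have bl : ∀ q < σ.length, 1 ≤ letter σ q ∧ letter σ q ≤ σ.length :=
    fun q hq => hσ.letter_bounds hq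
  have bh : ∀ q < τ.length, 1 ≤ letter τ q ∧ letter τ q ≤ τ.length :=
    fun q hq => hτ.letter_bounds hq
  have lt_mid_low : ∀ q < σ.length, lowLetter c (letter σ q) < σ.length + τ.length + 1 :=
    fun q hq => Nat.lt_succ_of_le (hc.lowLetter_bounds (bl q hq)).2
  have lt_mid_high : ∀ q < τ.length,
      highLetter σ.length c (letter τ q) < σ.length + τ.length + 1 :=
    fun q hq => Nat.lt_succ_of_le (highLetter_bounds σ.length c (bh q hq)).2
  refine ⟨⟨hσ, ?_, ?_⟩, ⟨hτ, ?_, ?_⟩, hc, ?_, ?_⟩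
  · rintro ⟨i, j, k, l, h1, h2, h3, h4, h5, h6, h7⟩
    refine h3142 ⟨i, j, k, l, h1, h2, h3, by rw [length_build]; omega, ?_⟩
    rw [letter_build_low (by omega), letter_build_low (by omega), letter_build_low (by omega),
      letter_build_low (by omega), hc.lowLetter_lt_iff (bl _ (by omega)) (bl _ (by omega)),
      hc.lowLetter_lt_iff (bl _ (by omega)) (bl _ (by omega)),
      hc.lowLetter_lt_iff (bl _ (by omega)) (bl _ (by omega))]
    exact ⟨h5, h6, h7⟩
  · rintro ⟨i, j, k, h1, h2, h3, h4, h5, h6⟩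
    refine h2413 ⟨i, j, k, h1, h2, by rw [length_build]; omega, ?_⟩
    rw [letter_build_low (by omega), letter_build_low (by omega), letter_build_low (by omega),
      letter_build_low (by omega), hc.lowLetter_lt_iff (bl _ (by omega)) (bl _ (by omega)),
      hc.lowLetter_lt_iff (bl _ (by omega)) (bl _ (by omega)),
      hc.lowLetter_lt_iff (bl _ (by omega)) (bl _ (by omega))]
    exact ⟨h4, h5, h6⟩
  · rintro ⟨i, j, k, l, h1, h2, h3, h4, h5, h6, h7⟩
    refine h3142 ⟨σ.length + 1 + i, σ.length + 1 + j, σ.length + 1 + k, σ.length + 1 + l,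
      by omega, by omega, by omega, by rw [length_build]; omega, ?_⟩
    rw [letter_build_high (by omega), letter_build_high (by omega), letter_build_high (by omega),
      letter_build_high (by omega)]
    simp only [(highLetter_strictMono _ _).lt_iff_lt]
    exact ⟨h5, h6, h7⟩
  · rintro ⟨i, j, k, h1, h2, h3, h4, h5, h6⟩
    refine h2413 ⟨σ.length + 1 + i, σ.length + 1 + j, σ.length + 1 + k,
      by omega, by omega, by rw [length_build]; omega, ?_⟩
    rw [add_assoc (σ.length + 1) j 1, letter_build_high (by omega), letter_build_high (by omega),
      letter_build_high (by omega), letter_build_high (by omega)]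
    simp only [(highLetter_strictMono _ _).lt_iff_lt]
    exact ⟨h4, h5, h6⟩
  · rw [List.pairwise_iff_getElem]
    intro i j hi hj hij
    rw [← letter_eq_getElem hi, ← letter_eq_getElem hj]
    intro h1
    by_contra h2
    have h3 := hc.mono _ _ (bl j hj).1 h1.le (bl i hi).2
    have h4 := hc.le _ (bl i hi).1 (bl i hi).2
    -- The letter of `τ` of rank `c (letter σ i)` lies below the larger and above the smaller letter
    -- of the inversion, hence is the `2` of `3142`.
    obtain ⟨l, hl, hl2⟩ := hτ.exists_letter (x := c (letter σ i)) (by omega) h4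
    refine h3142 ⟨i, j, σ.length, σ.length + 1 + l, hij, hj, by omega,
      by rw [length_build]; omega, ?_⟩
    rw [letter_build_low hi, letter_build_low hj, letter_build_mid, letter_build_high hl,
      hc.low_lt_high_iff (bl j hj), hc.high_lt_low_iff (bl i hi)]
    exact ⟨by omega, by omega, lt_mid_low i hi⟩
  · intro x hx1 hx2
    obtain ⟨q, hq, rfl⟩ := hσ.exists_letter hx1 hx2
    refine ⟨hc.le _ hx1 hx2, ?_, ?_, ?_⟩
    · intro i j k h1 h2 h3 h4 h5 h6
      refine h3142 ⟨q, σ.length + 1 + i, σ.length + 1 + j, σ.length + 1 + k, by omega, by omega,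
        by omega, by rw [length_build]; omega, ?_⟩
      rw [letter_build_high (by omega), letter_build_high (by omega), letter_build_high (by omega),
        letter_build_low hq, hc.low_lt_high_iff (bl q hq), hc.high_lt_low_iff (bl q hq),
        (highLetter_strictMono _ _).lt_iff_lt]
      exact ⟨h4, h5, h6⟩
    · intro j k h1 h2 h3 h4 h5
      refine h2413 ⟨q, σ.length + 1 + j, σ.length + 1 + k, by omega, by omega,
        by rw [length_build]; omega, ?_⟩
      rw [add_assoc (σ.length + 1) j 1, letter_build_high (by omega), letter_build_high (by omega),
        letter_build_high (by omega),
        letter_build_low hq, hc.low_lt_high_iff (bl q hq), hc.high_lt_low_iff (bl q hq),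
        (highLetter_strictMono _ _).lt_iff_lt]
      exact ⟨h3, h4, h5⟩
    · intro h1
      by_contra h2
      -- The largest letter of `τ` exceeds the cut, hence is the `3` of `2-41-3`. It is not the
      -- first letter, which is assumed to be at most the cut.
      obtain ⟨k, hk, hk2⟩ := hτ.exists_letter (x := τ.length) (by omega) le_rfl
      have hk0 : k ≠ 0 := by rintro rfl; omega
      refine h2413 ⟨q, σ.length, σ.length + 1 + k, hq, by omega, by rw [length_build]; omega, ?_⟩
      rw [letter_build_low hq, letter_build_mid, letter_build_high hk,
        show letter (build σ τ c) (σ.length + 1) = _ from letter_build_high (q := 0) (by omega),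
        hc.low_lt_high_iff (bl q hq), hc.high_lt_low_iff (bl q hq)]
      exact ⟨by omega, by omega, lt_mid_high k hk⟩

end Build

/-! ### The next admissible cut -/

theorem IsPerm.adm_length {τ : List ℕ} (h : IsPerm τ.length τ) : Adm τ τ.length := by
  refine ⟨le_rfl, fun i j k _ h2 h3 _ _ h6 => ?_, fun j k h1 h2 _ h4 _ => ?_,
    fun h => absurd h (lt_irrefl _)⟩
  · have := (h.letter_bounds (i := j) (by omega)).2
    omega
  · have := (h.letter_bounds (i := k) (by omega)).2
    omega

theorem IsPerm.adm_zero {τ : List ℕ} (h : IsPerm τ.length τ) : Adm τ 0 := by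
  refine ⟨Nat.zero_le _, fun i j k h1 h2 h3 h4 h5 _ => by omega, fun j k h1 h2 h3 _ _ => ?_,
    fun h1 => (h.letter_bounds h1).1⟩
  have := (h.letter_bounds (i := j + 1) (by omega)).1
  omega

/-- The least admissible cut above `s`. -/
noncomputable def nextCut (τ : List ℕ) (s : ℕ) : ℕ := sInf {t | s < t ∧ Adm τ t}

/-- The greatest admissible cut below `t`. -/
noncomputable def prevCut (τ : List ℕ) (t : ℕ) : ℕ := sSup {s | s < t ∧ Adm τ s}

section NextCut

variable {τ : List ℕ} {s t : ℕ}

theorem nextCut_mem (hτ : IsPerm τ.length τ) (hs : s < τ.length) :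
    s < nextCut τ s ∧ Adm τ (nextCut τ s) :=
  Nat.sInf_mem (s := {t | s < t ∧ Adm τ t}) ⟨_, hs, hτ.adm_length⟩

theorem nextCut_le (hst : s < t) (ht : Adm τ t) : nextCut τ s ≤ t := Nat.sInf_le ⟨hst, ht⟩

theorem prevCut_mem (hτ : IsPerm τ.length τ) (ht : 0 < t) :
    prevCut τ t < t ∧ Adm τ (prevCut τ t) :=
  Nat.sSup_mem (s := {s | s < t ∧ Adm τ s}) ⟨0, ht, hτ.adm_zero⟩ ⟨t, fun _ h => h.1.le⟩

theorem le_prevCut (hst : s < t) (hs : Adm τ s) : s ≤ prevCut τ t :=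
  le_csSup (s := {s | s < t ∧ Adm τ s}) ⟨t, fun _ h => h.1.le⟩ ⟨hst, hs⟩

/-- Together with `nextCut_injOn`: taking successors is a bijection from the admissible cuts below
`|τ|` to the positive ones. -/
theorem nextCut_prevCut (hτ : IsPerm τ.length τ) (ht : Adm τ t) (h0 : 0 < t) :
    nextCut τ (prevCut τ t) = t := by
  obtain ⟨h1, h2⟩ := prevCut_mem hτ h0
  obtain ⟨h3, h4⟩ := nextCut_mem hτ (h1.trans_le ht.le)
  refine le_antisymm (nextCut_le h1 ht) ?_
  by_contra h5
  have := le_prevCut (not_le.1 h5) h4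
  omega

theorem nextCut_mono (hτ : IsPerm τ.length τ) (hst : s ≤ t) (ht : Adm τ t)
    (htl : t < τ.length) : nextCut τ s ≤ nextCut τ t := by
  rcases hst.eq_or_lt with rfl | h
  · exact le_rfl
  · exact (nextCut_le h ht).trans (nextCut_mem hτ htl).1.le

theorem nextCut_injOn (hτ : IsPerm τ.length τ) (hs : Adm τ s) (ht : Adm τ t)
    (hsl : s < τ.length) (htl : t < τ.length) (h : nextCut τ s = nextCut τ t) : s = t := by
  have h1 := (nextCut_mem hτ hsl).1
  have h2 := (nextCut_mem hτ htl).1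
  by_contra hne
  rcases Nat.lt_or_gt_of_ne hne with h3 | h3
  · have := nextCut_le h3 ht
    omega
  · have := nextCut_le h3 hs
    omega

/-- A discrete intermediate value argument. It supplies the adjacent positions that the pattern
`2-41-3`, and hence `no312`, requires. -/
theorem exists_descent_through {f : ℕ → ℕ} {s a b : ℕ} (hab : a ≤ b) (ha : s < f a)
    (hb : f b ≤ s) : ∃ j, a ≤ j ∧ j < b ∧ s < f j ∧ f (j + 1) ≤ s := by
  induction b, hab using Nat.le_induction with
  | base => omega
  | succ b hab ih =>
    by_cases h : f b ≤ s
    · obtain ⟨j, h1, h2, h3⟩ := ih h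
      exact ⟨j, h1, by omega, h3⟩
    · exact ⟨b, hab, by omega, by omega, hb⟩

/-- By `first`, an admissible cut above `s` and below `|τ|` would be below the first letter `s + 1`.
-/
theorem nextCut_of_first (hτ : IsPerm τ.length τ) (hs : s < τ.length)
    (h0 : letter τ 0 = s + 1) : nextCut τ s = τ.length := by
  obtain ⟨h1, h2⟩ := nextCut_mem hτ hs
  have h3 := h2.le
  by_contra h4
  have := h2.first (by omega)
  omega

/-- If `s + 1` is not the first letter, then the next cut is determined by the smallest letter
preceding `s + 1`. -/
theorem nextCut_of_pos (hτ : IsAvoider τ.length τ) (hs : Adm τ s) {z : ℕ} (hz : z < τ.length)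
    (hz1 : letter τ z = s + 1) (hz0 : 0 < z) :
    (∃ i < z, letter τ i = nextCut τ s + 1) ∧ ∀ i < z, nextCut τ s < letter τ i := by
  obtain ⟨hp, h3142, h2413⟩ := hτ
  have hsl : s < τ.length := by
    have := (hp.letter_bounds hz).2
    omega
  have inj : ∀ i < τ.length, ∀ j < τ.length, letter τ i = letter τ j → i = j :=
    fun i hi j hj h => letter_inj hp.nodup hi hj h
  -- The first letter exceeds `s`. A smaller letter before position `z` would force an adjacent
  -- descent through `s`, which with `s + 1` at position `z` contradicts `no312`.
  have above_s : ∀ i < z, s < letter τ i := by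
    intro i hi
    by_contra h
    obtain ⟨j, -, h2, h3, h4⟩ := exists_descent_through (f := letter τ) (Nat.zero_le i)
      (hs.first hsl) (not_lt.1 h)
    have h5 : letter τ j ≠ s + 1 := fun h => by
      have := inj j (by omega) z hz (by omega)
      omega
    exact hs.no312 j z (by omega) hz h4 (by omega) (by omega)
  obtain ⟨q, hq, hmin⟩ := Finset.exists_min_image (Finset.range z) (letter τ) ⟨0, by simpa⟩
  rw [Finset.mem_range] at hq
  have hmin' : ∀ i < z, letter τ q ≤ letter τ i := fun i hi => hmin i (Finset.mem_range.2 hi)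
  have hq1 : s + 1 < letter τ q := by
    have h1 := above_s q hq
    have h2 : letter τ q ≠ s + 1 := fun h => by
      have := inj q (by omega) z hz (by omega)
      omega
    omega
  have hlow : ∀ k < τ.length, letter τ k < letter τ q → z ≤ k := fun k _ h => by
    by_contra h1
    have := hmin' k (by omega)
    omega
  -- A violation at `letter τ q - 1` which is not already one at `s` has its low letters below
  -- `letter τ q`, hence at or after position `z`. Putting the letter at position `q` in front
  -- completes it to a forbidden pattern inside `τ`.
  have hadm : Adm τ (letter τ q - 1) := by
    refine ⟨by have := (hp.letter_bounds (hq.trans hz)).2; omega, ?_, ?_, fun _ => ?_⟩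
    · intro i j k h1 h2 h3 h4 h5 h6
      by_cases hk : letter τ k ≤ s
      · exact hs.no132 i j k h1 h2 h3 h4 hk (by omega)
      have h7 := hlow i (by omega) (by omega)
      have h9 : letter τ j ≠ letter τ q := fun h => by
        have := inj j (by omega) q (by omega) h
        omega
      exact h3142 ⟨q, i, j, k, by omega, h1, h2, h3, h4, by omega, by omega⟩
    · intro j k h1 h2 h3 h4 h5
      by_cases hj : letter τ (j + 1) ≤ s
      · exact hs.no312 j k h1 h2 hj (by omega) h5
      have h7 := hlow (j + 1) (by omega) (by omega)
      have h9 : letter τ k ≠ letter τ q := fun h => by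
        have := inj k (by omega) q (by omega) h
        omega
      have h10 : j ≠ q := by rintro rfl; omega
      exact h2413 ⟨q, j, k, by omega, h1, h2, by omega, by omega, h5⟩
    · have := hmin' 0 hz0
      omega
  have hnext : nextCut τ s = letter τ q - 1 := by
    obtain ⟨h1, h2⟩ := nextCut_mem hp hsl
    refine le_antisymm (nextCut_le (by omega) hadm) ?_
    -- Suppose the next cut `t` were smaller than `letter τ q - 1`. The letter `t + 1` comes after
    -- position `z`, and between positions `q` and `z` there is an adjacent descent through `t`
    -- whose top is at least `letter τ q`. This contradicts `no312` at `t`.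
    by_contra h3
    have hqb := (hp.letter_bounds (hq.trans hz)).2
    obtain ⟨k, hk, hk1⟩ := hp.exists_letter (x := nextCut τ s + 1) (by omega) (by omega)
    have h4 := hlow k hk (by omega)
    have h5 : k ≠ z := by rintro rfl; omega
    obtain ⟨j, h6, h7, h8, h9⟩ := exists_descent_through (f := letter τ) (s := nextCut τ s) hq.le
      (by omega) (by omega)
    have := hmin' j h7
    exact h2.no312 j k (by omega) hk h9 (by omega) (by omega)
  rw [hnext]
  refine ⟨⟨q, hq, by omega⟩, fun i hi => ?_⟩
  have := hmin' i hi
  omega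

theorem nextCut_lt_letter (hτ : IsAvoider τ.length τ) (hs : Adm τ s) {z : ℕ}
    (hz : z < τ.length) (hz1 : letter τ z = s + 1) : ∀ i < z, nextCut τ s < letter τ i := by
  intro i hi
  exact (nextCut_of_pos hτ hs hz hz1 (by omega)).2 i hi

end NextCut

/-! ### Computing `shift` -/

theorem takeWhile_ne_append {u v : List ℕ} {z : ℕ} (h : z ∉ u) :
    (u ++ z :: v).takeWhile (fun y => decide (y ≠ z)) = u := by
  rw [List.takeWhile_append_of_pos]
  · simp
  · intro a ha
    simp
    rintro rfl
    exact h ha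

theorem dropWhile_ne_append {u v : List ℕ} {z : ℕ} (h : z ∉ u) :
    (u ++ z :: v).dropWhile (fun y => decide (y ≠ z)) = z :: v := by
  rw [List.dropWhile_append_of_pos]
  · simp
  · intro a ha
    simp
    rintro rfl
    exact h ha

theorem shift_append {u v : List ℕ} {z : ℕ} (hu : ∀ x ∈ u, z < x) (hv : ∀ x ∈ v, z < x) :
    shift (u ++ z :: v) = (v.filter (fun y => ∀ a ∈ u, y < a)).length := by
  have h1 : (u ++ z :: v).min? = some z := by
    rw [List.min?_eq_some_iff]
    refine ⟨by simp, fun b hb => ?_⟩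
    rw [List.mem_append, List.mem_cons] at hb
    rcases hb with hb | rfl | hb
    · exact (hu b hb).le
    · exact le_rfl
    · exact (hv b hb).le
  have h2 : z ∉ u := fun h => lt_irrefl _ (hu z h)
  unfold shift
  rw [h1]
  simp only [Option.getD_some, takeWhile_ne_append h2, dropWhile_ne_append h2, List.tail_cons]

theorem shift_map {g : ℕ → ℕ} (hg : StrictMono g) {u v : List ℕ} {z : ℕ}
    (hu : ∀ x ∈ u, z < x) (hv : ∀ x ∈ v, z < x) :
    shift ((u ++ z :: v).map g) = shift (u ++ z :: v) := by
  rw [List.map_append, List.map_cons, shift_append, shift_append hu hv, List.filter_map,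
    List.length_map]
  · congr 1
    refine List.filter_congr fun y _ => ?_
    simp [hg.lt_iff_lt]
  · simpa [hg.lt_iff_lt] using hu
  · simpa [hg.lt_iff_lt] using hv

/-- The minimum of the filtered word is `s + 1`. Every letter of `τ` in front of it exceeds the next
cut, and if there is such a letter the smallest is the next cut plus one. So the letters counted by
`shift` are exactly those above `s + 1` and up to the next cut. The condition `Q` cuts `τ` off at
the next larger cut in use, and `g` turns ranks into actual letters. -/
theorem shift_filter {τ : List ℕ} {s : ℕ} (hτ : IsAvoider τ.length τ) (hs : Adm τ s)
    (hsl : s < τ.length) {Q : ℕ → Prop} [DecidablePred Q] (hQ : ∀ a b, a ≤ b → Q b → Q a)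
    (hQn : Q (nextCut τ s)) {g : ℕ → ℕ} (hg : StrictMono g) :
    s + shift ((τ.filter (fun y => s < y ∧ Q y)).map g) + 1 = nextCut τ s := by
  obtain ⟨hn1, hn2⟩ := nextCut_mem hτ.1 hsl
  obtain ⟨z, hz, hz1⟩ := hτ.1.exists_letter (x := s + 1) (by omega) hsl
  have hdec : τ = τ.take z ++ (s + 1) :: τ.drop (z + 1) := by
    rw [← hz1, letter_eq_getElem hz, List.getElem_cons_drop, List.take_append_drop]
  have hpre : ∀ x ∈ τ.take z, nextCut τ s < x := by
    intro x hx
    obtain ⟨i, hi, rfl⟩ := List.getElem_of_mem hx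
    rw [List.getElem_take, ← letter_eq_getElem]
    exact nextCut_lt_letter hτ hs hz hz1 i (by simp at hi; omega)
  have hnd := hτ.1.nodup
  rw [hdec, List.nodup_append, List.nodup_cons] at hnd
  have hfil : τ.filter (fun y => decide (s < y ∧ Q y)) =
      (τ.take z).filter (fun y => decide (s < y ∧ Q y)) ++
        (s + 1) :: (τ.drop (z + 1)).filter (fun y => decide (s < y ∧ Q y)) := by
    conv_lhs => rw [hdec]
    rw [List.filter_append, List.filter_cons_of_pos]
    have : Q (s + 1) := hQ _ _ hn1 hQn
    simp [this]
  have hu : ∀ x ∈ (τ.take z).filter (fun y => decide (s < y ∧ Q y)), s + 1 < x := by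
    intro x hx
    have := hpre x (List.mem_of_mem_filter hx)
    omega
  have hv : ∀ x ∈ (τ.drop (z + 1)).filter (fun y => decide (s < y ∧ Q y)), s + 1 < x := by
    intro x hx
    rw [List.mem_filter] at hx
    have h1 := (of_decide_eq_true hx.2).1
    have h2 : x ≠ s + 1 := by
      rintro rfl
      exact hnd.2.1.1 hx.1
    omega
  rw [hfil, shift_map hg hu hv, shift_append hu hv, ← List.toFinset_card_of_nodup
    ((hnd.2.1.2.filter _).filter _)]
  have hset : (((τ.drop (z + 1)).filter (fun y => decide (s < y ∧ Q y))).filter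
      (fun y => decide (∀ a ∈ (τ.take z).filter (fun y => decide (s < y ∧ Q y)), y < a))).toFinset
      = Finset.Ioc (s + 1) (nextCut τ s) := by
    ext y
    rw [List.mem_toFinset, Finset.mem_Ioc, List.mem_filter]
    constructor
    · rintro ⟨h1, h2⟩
      refine ⟨hv y h1, ?_⟩
      rw [List.mem_filter] at h1
      have h3 := of_decide_eq_true h2
      have h4 := (of_decide_eq_true h1.2).2
      rcases Nat.eq_zero_or_pos z with rfl | hz0
      · rw [nextCut_of_first hτ.1 hsl hz1]
        exact (hτ.1.mem_iff.1 (List.mem_of_mem_drop h1.1)).2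
      · obtain ⟨⟨i, hi, hi1⟩, -⟩ := nextCut_of_pos hτ hs hz hz1 hz0
        -- If a counted letter exceeded the next cut, `Q` would hold at the next cut plus one; that
        -- letter would survive in the part before the minimum and bound the counted letter.
        by_contra h5
        have h6 : Q (nextCut τ s + 1) := hQ _ _ (by omega) h4
        have h7 := h3 (nextCut τ s + 1) (by
          rw [List.mem_filter, decide_eq_true_eq]
          refine ⟨?_, by omega, h6⟩
          rw [← hi1, letter_eq_getElem (hi.trans hz)]
          exact List.mem_take_iff_getElem.2 ⟨i, by omega, rfl⟩)
        omega
    · rintro ⟨h1, h2⟩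
      have h3 : y ∈ τ := hτ.1.mem_iff.2 ⟨by omega, h2.trans hn2.le⟩
      rw [hdec, List.mem_append, List.mem_cons] at h3
      rw [List.mem_filter, decide_eq_true_eq, decide_eq_true_eq]
      refine ⟨⟨?_, by omega, hQ _ _ h2 hQn⟩, fun a ha => ?_⟩
      · rcases h3 with h3 | h3 | h3
        · have := hpre y h3
          omega
        · omega
        · exact h3
      · have := hpre a (List.mem_of_mem_filter ha)
        omega
  rw [hset, Nat.card_Ioc]
  omega

/-! ### Standardization -/

/-- The rank of `x` relative to the letters of `w`. -/
def rank (w : List ℕ) (x : ℕ) : ℕ := w.countP (fun y => y ≤ x)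

theorem st_eq_map_rank (w : List ℕ) : st w = w.map (rank w) := rfl

theorem rank_mono (w : List ℕ) {x y : ℕ} (h : x ≤ y) : rank w x ≤ rank w y :=
  List.countP_mono_left fun a _ ha => by simp at ha ⊢; omega

theorem rank_lt {w : List ℕ} {x y : ℕ} (hy : y ∈ w) (h : x < y) : rank w x < rank w y := by
  unfold rank
  obtain ⟨u, v, rfl⟩ := List.append_of_mem hy
  rw [List.countP_append, List.countP_append, List.countP_cons_of_neg (by simpa using h),
    List.countP_cons_of_pos (by simp)]
  have h1 := rank_mono u h.le
  have h2 := rank_mono v h.le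
  unfold rank at h1 h2
  omega

theorem rank_lt_iff {w : List ℕ} {x y : ℕ} (hy : y ∈ w) : rank w x < rank w y ↔ x < y := by
  refine ⟨fun h => ?_, rank_lt hy⟩
  by_contra h1
  have := rank_mono w (not_lt.1 h1)
  omega

theorem isPerm_st {w : List ℕ} (hw : w.Nodup) : IsPerm w.length (st w) := by
  rw [isPerm_iff, st_eq_map_rank]
  refine ⟨hw.map_on fun a ha b hb h => ?_, by simp, fun x hx => ?_⟩
  · have h1 := rank_lt_iff (x := a) hb
    have h2 := rank_lt_iff (x := b) ha
    omega
  · obtain ⟨y, hy, rfl⟩ := List.mem_map.1 hx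
    exact ⟨List.countP_pos_iff.2 ⟨y, hy, by simp⟩, List.countP_le_length⟩

theorem st_map {g : ℕ → ℕ} {w : List ℕ} (h : IncOn g w) : st (w.map g) = st w := by
  unfold st
  rw [List.map_map]
  refine List.map_congr_left fun x hx => ?_
  rw [Function.comp, List.countP_map]
  refine List.countP_congr fun y hy => ?_
  have := h.lt_iff hx hy
  simp only [Function.comp, decide_eq_true_eq]
  omega

theorem IsPerm.rank {n : ℕ} {w : List ℕ} (h : IsPerm n w) {x : ℕ} (hx : x ≤ n) :
    rank w x = x := by
  unfold Word.rank
  rw [List.Perm.countP_eq _ h, List.countP_eq_length_filter, ← List.toFinset_card_of_nodup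
    (List.Nodup.filter _ List.nodup_range')]
  have : ((List.range' 1 n).filter (fun y => decide (y ≤ x))).toFinset = Finset.Icc 1 x := by
    ext y
    simp
    omega
  rw [this]
  simp

theorem IsPerm.st {n : ℕ} {w : List ℕ} (h : IsPerm n w) : st w = w := by
  rw [st_eq_map_rank]
  conv_rhs => rw [← List.map_id w]
  exact List.map_congr_left fun x hx => h.rank (h.mem_iff.1 hx).2

theorem sort_image_Icc {g : ℕ → ℕ} {p : ℕ}
    (hg : ∀ a b, 1 ≤ a → a < b → b ≤ p → g a < g b) :
    ((Finset.Icc 1 p).image g).sort (fun a b => a ≤ b) = (List.range' 1 p).map g := by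
  have hp : ((List.range' 1 p).map g).Pairwise (fun a b => a < b) := by
    rw [List.pairwise_map]
    refine (List.pairwise_lt_range' (s := 1) (n := p)).imp_of_mem fun ha hb h => ?_
    rw [List.mem_range'_1] at ha hb
    exact hg _ _ ha.1 h (by omega)
  have h1 : (Finset.Icc 1 p).image g = ((List.range' 1 p).map g).toFinset := by
    ext y
    simp only [Finset.mem_image, Finset.mem_Icc, List.mem_toFinset, List.mem_map,
      List.mem_range'_1]
    refine exists_congr fun a => and_congr_left fun _ => ?_
    omega
  rw [h1]
  exact (List.toFinset_sort (· ≤ ·) (hp.imp fun h => h.ne)).2 (hp.imp fun h => h.le)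

theorem unst_image_Icc {g : ℕ → ℕ} {p : ℕ}
    (hg : ∀ a b, 1 ≤ a → a < b → b ≤ p → g a < g b) {w : List ℕ}
    (hw : ∀ x ∈ w, 1 ≤ x ∧ x ≤ p) : unst ((Finset.Icc 1 p).image g) w = w.map g := by
  unfold unst
  rw [sort_image_Icc hg]
  refine List.map_congr_left fun x hx => ?_
  have := hw x hx
  rw [List.getD_eq_getElem _ _ (by simp; omega), List.getElem_map, List.getElem_range']
  congr 1
  omega

/-! ### Every permutation is of the form `build σ τ c` -/

theorem IsPerm.rank_add_rank {n : ℕ} {s t : List ℕ} (h : IsPerm n (s ++ n :: t)) {x : ℕ}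
    (hx : x < n) : Word.rank s x + Word.rank t x = x := by
  have h1 := h.rank hx.le
  unfold Word.rank at h1 ⊢
  rwa [List.countP_append, List.countP_cons_of_neg (by simpa using hx)] at h1

theorem exists_build_of_append {n : ℕ} {s t : List ℕ} (h : IsPerm n (s ++ n :: t)) :
    ∃ σ τ c, IsPerm σ.length σ ∧ IsPerm τ.length τ ∧ IsCut σ.length τ.length c ∧
      σ.length + τ.length + 1 = n ∧ s = σ.map (lowLetter c) ∧
      t = τ.map (highLetter σ.length c) ∧ s ++ n :: t = build σ τ c := by
  have hnd := h.nodup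
  rw [List.nodup_append, List.nodup_cons] at hnd
  obtain ⟨hs, ⟨hnt, ht⟩, hdis⟩ := hnd
  have hlen := h.length
  rw [List.length_append, List.length_cons] at hlen
  have hlt : ∀ x, x ∈ s ∨ x ∈ t → x < n := by
    intro x hx
    have h1 := (h.mem_iff (x := x)).1 (by simp; tauto)
    have h2 : x ≠ n := by
      rintro rfl
      rcases hx with hx | hx
      · exact hdis x hx x (by simp) rfl
      · exact hnt hx
    omega
  have hls : (st s).length = s.length := by simp [st]
  have hlt' : (st t).length = t.length := by simp [st]
  -- Counts the letters of `t` with fewer than `i` letters of `s` below them, that is, the letters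
  -- of `t` below the `i`th letter of `s`. This form is defined for all `i` and visibly monotone.
  set c : ℕ → ℕ := fun i => t.countP (fun y => rank s y < i) with hc
  have hcx : ∀ x ∈ s, c (rank s x) = rank t x := by
    intro x hx
    refine List.countP_congr fun y hy => ?_
    have h1 : x ≠ y := fun h => hdis x hx y (by simp [hy]) h
    have := rank_lt_iff (x := y) hx
    simp only [decide_eq_true_eq]
    omega
  -- This identifies the indices counted by `countBelow` at the rank of `y` with an initial segment
  -- of length `rank s y`.
  have hcy : ∀ y ∈ t, ∀ i, c i < rank t y ↔ i ≤ rank s y := by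
    intro y hy i
    constructor
    · intro h1
      by_contra h2
      refine absurd h1 (not_lt.2 (List.countP_mono_left fun z _ hz => ?_))
      have := rank_mono s (of_decide_eq_true hz)
      simp only [decide_eq_true_eq]
      omega
    · intro h1
      have h2 : ∀ z ∈ t, rank s z < i → z < y := by
        intro z _ hz
        by_contra h3
        have := rank_mono s (not_lt.1 h3)
        omega
      obtain ⟨u, v, rfl⟩ := List.append_of_mem hy
      change (u ++ y :: v).countP (fun z => decide (rank s z < i)) <
        (u ++ y :: v).countP (fun z => decide (z ≤ y))
      rw [List.countP_append, List.countP_append, List.countP_cons_of_neg (by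
          have := h2 y hy
          simp only [decide_eq_true_eq]
          intro h
          exact lt_irrefl _ (this h)), List.countP_cons_of_pos (by simp)]
      have e1 : u.countP (fun y => decide (rank s y < i)) ≤ u.countP (fun z => decide (z ≤ y)) :=
        List.countP_mono_left fun z hz hz2 => by
          have := h2 z (by simp [hz]) (of_decide_eq_true hz2)
          simp only [decide_eq_true_eq]; omega
      have e2 : v.countP (fun y => decide (rank s y < i)) ≤ v.countP (fun z => decide (z ≤ y)) :=
        List.countP_mono_left fun z hz hz2 => by
          have := h2 z (by simp [hz]) (of_decide_eq_true hz2)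
          simp only [decide_eq_true_eq]; omega
      omega
  have e1 : s = (st s).map (lowLetter c) := by
    rw [st_eq_map_rank, List.map_map]
    conv_lhs => rw [← List.map_id s]
    refine List.map_congr_left fun x hx => ?_
    rw [Function.comp, lowLetter, hcx x hx, h.rank_add_rank (hlt x (Or.inl hx)), id]
  have e2 : t = (st t).map (highLetter s.length c) := by
    rw [st_eq_map_rank, List.map_map]
    conv_lhs => rw [← List.map_id t]
    refine List.map_congr_left fun y hy => ?_
    have h1 : countBelow s.length c (rank t y) = rank s y := by
      unfold countBelow
      have : (Finset.Icc 1 s.length).filter (fun i => c i < rank t y) =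
          Finset.Icc 1 (rank s y) := by
        ext i
        have h2 : rank s y ≤ s.length := List.countP_le_length
        rw [Finset.mem_filter, Finset.mem_Icc, Finset.mem_Icc, hcy y hy]
        omega
      rw [this]
      simp
    have := h.rank_add_rank (hlt y (Or.inr hy))
    rw [Function.comp, highLetter, h1, id]
    omega
  refine ⟨st s, st t, c, ?_, ?_, ?_, by rw [hls, hlt']; omega, e1, by rwa [hls], ?_⟩
  · rw [hls]; exact isPerm_st hs
  · rw [hlt']; exact isPerm_st ht
  · rw [hls, hlt']
    refine ⟨fun i j _ hij _ => List.countP_mono_left fun z _ hz => ?_,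
      fun i _ _ => List.countP_le_length⟩
    have := of_decide_eq_true hz
    simp only [decide_eq_true_eq]
    omega
  · rw [build, hls, hlt', ← e1, ← e2]
    congr 2
    omega

theorem IsPerm.exists_eq_append {n : ℕ} {w : List ℕ} (h : IsPerm n w) (hn : 1 ≤ n) :
    ∃ s t, w = s ++ n :: t :=
  List.append_of_mem (h.mem_iff.2 ⟨hn, le_rfl⟩)

-- Uniqueness of the encoding

section Build

variable {σ τ : List ℕ} {c : ℕ → ℕ}

theorem top_notMem_low (hσ : IsPerm σ.length σ) (hc : IsCut σ.length τ.length c) :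
    σ.length + τ.length + 1 ∉ σ.map (lowLetter c) := by
  rw [List.mem_map]
  rintro ⟨x, hx, h⟩
  have := hc.lowLetter_bounds (hσ.mem_iff.1 hx)
  omega

theorem build_congr {c' : ℕ → ℕ} (hσ : IsPerm σ.length σ)
    (h : ∀ i, 1 ≤ i → i ≤ σ.length → c i = c' i) : build σ τ c = build σ τ c' := by
  have e1 : σ.map (lowLetter c) = σ.map (lowLetter c') := by
    refine List.map_congr_left fun x hx => ?_
    have := hσ.mem_iff.1 hx
    rw [lowLetter, lowLetter, h x this.1 this.2]
  have e2 : highLetter σ.length c = highLetter σ.length c' := by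
    funext y
    rw [highLetter, highLetter, countBelow, countBelow]
    congr 2
    refine Finset.filter_congr fun i hi => ?_
    rw [Finset.mem_Icc] at hi
    rw [h i hi.1 hi.2]
  rw [build, build, e1, e2]

/-- The largest letter shows where to split, standardizing the two sides returns the patterns, and
the letters on the left then return the cuts. -/
theorem build_injective {σ' τ' : List ℕ} {c' : ℕ → ℕ} (hσ : IsPerm σ.length σ)
    (hτ : IsPerm τ.length τ) (hc : IsCut σ.length τ.length c) (hσ' : IsPerm σ'.length σ')
    (hτ' : IsPerm τ'.length τ') (hc' : IsCut σ'.length τ'.length c')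
    (h : build σ τ c = build σ' τ' c') :
    σ = σ' ∧ τ = τ' ∧ ∀ i, 1 ≤ i → i ≤ σ.length → c i = c' i := by
  have hlen := congrArg List.length h
  rw [length_build, length_build] at hlen
  have h1 := takeWhile_ne_append (v := τ.map (highLetter σ.length c)) (top_notMem_low hσ hc)
  have h2 := takeWhile_ne_append (v := τ'.map (highLetter σ'.length c')) (top_notMem_low hσ' hc')
  have h3 := dropWhile_ne_append (v := τ.map (highLetter σ.length c)) (top_notMem_low hσ hc)
  have h4 := dropWhile_ne_append (v := τ'.map (highLetter σ'.length c')) (top_notMem_low hσ' hc')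
  rw [← build] at h1 h2 h3 h4
  rw [← hlen, ← h] at h2 h4
  have e1 := h1.symm.trans h2
  have e2 := List.tail_eq_of_cons_eq (h3.symm.trans h4)
  have hs : σ = σ' := by
    rw [← hσ.st, ← hσ'.st, ← st_map (incOn_low hσ hc), ← st_map (incOn_low hσ' hc'), e1]
  have ht : τ = τ' := by
    rw [← hτ.st, ← hτ'.st, ← st_map (incOn_high σ.length c τ), ← st_map (incOn_high σ'.length c' τ'),
      e2]
  refine ⟨hs, ht, fun i hi1 hi2 => ?_⟩
  subst hs
  have := List.map_inj_left.1 e1 i (hσ.mem_iff.2 ⟨hi1, hi2⟩)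
  unfold lowLetter at this
  omega

/-! ### The effect of `ψ` -/

/-- If the cuts differ, the letter on the right of rank equal to the larger cut lies between the two
letters. If they agree, monotonicity makes the cut constant in between, so the letters on the left
run through all values. -/
theorem sameInterval_low_iff (hσ : IsPerm σ.length σ)
    (hc : IsCut σ.length τ.length c) {i j : ℕ} (hi : 1 ≤ i ∧ i ≤ σ.length)
    (hj : 1 ≤ j ∧ j ≤ σ.length) :
    SameInterval (σ.map (lowLetter c)) (lowLetter c i) (lowLetter c j) ↔ c i = c j := by
  wlog hij : i ≤ j generalizing i j
  · rw [eq_comm, ← this hj hi (by omega), SameInterval, SameInterval, min_comm, max_comm]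
  have hle : lowLetter c i ≤ lowLetter c j := by
    have := hc.mono i j hi.1 hij hj.2
    unfold lowLetter
    omega
  rw [SameInterval, min_eq_left hle, max_eq_right hle]
  constructor
  · intro h
    by_contra h1
    have h2 := hc.mono i j hi.1 hij hj.2
    have h3 : highLetter σ.length c (c j) ∈ σ.map (lowLetter c) := by
      refine h _ (Finset.mem_Icc.2 ⟨?_, ?_⟩)
      · exact ((hc.low_lt_high_iff hi).2 (by omega)).le
      · exact ((hc.high_lt_low_iff hj).2 le_rfl).le
    obtain ⟨x, hx, h4⟩ := List.mem_map.1 h3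
    have h5 := hc.low_lt_high_iff (y := c j) (hσ.mem_iff.1 hx)
    have h6 := hc.high_lt_low_iff (y := c j) (hσ.mem_iff.1 hx)
    omega
  · intro h y hy
    rw [Finset.mem_Icc] at hy
    unfold lowLetter at hy
    have h1 := hc.mono i (y - c i) hi.1 (by omega) (by omega)
    have h2 := hc.mono (y - c i) j (by omega) (by omega) hj.2
    refine List.mem_map.2 ⟨y - c i, hσ.mem_iff.2 ⟨by omega, by omega⟩, ?_⟩
    unfold lowLetter
    omega

/-- In terms of ranks, `wᵢ` consists of the letters of `τ` above the cut `c i` and not above any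
larger cut in use. -/
theorem above_build (hσ : IsPerm σ.length σ)
    (hc : IsCut σ.length τ.length c) {i : ℕ} (hi : 1 ≤ i ∧ i ≤ σ.length) :
    above (σ.map (lowLetter c)) (τ.map (highLetter σ.length c)) (lowLetter c i) =
      (τ.filter (fun y => c i < y ∧ ∀ j ∈ σ, c i < c j → y ≤ c j)).map
        (highLetter σ.length c) := by
  unfold above
  rw [List.filter_map]
  congr 1
  refine List.filter_congr fun y hy => ?_
  rw [Function.comp, decide_eq_decide]
  simp only [List.forall_mem_map]
  refine and_congr ⟨fun h => ?_, fun h j hj hs => ?_⟩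
    (forall₂_congr fun j hj => ?_)
  · rw [← hc.low_lt_high_iff hi]
    exact h i (hσ.mem_iff.2 hi) ((sameInterval_low_iff hσ hc hi hi).2 rfl)
  · rw [sameInterval_low_iff hσ hc hi (hσ.mem_iff.1 hj)] at hs
    rw [hc.low_lt_high_iff (hσ.mem_iff.1 hj), ← hs]
    exact h
  · have hj' := hσ.mem_iff.1 hj
    rw [sameInterval_low_iff hσ hc hi hj', hc.lowLetter_lt_iff hi hj', hc.high_lt_low_iff hj']
    constructor
    · intro h h1
      refine h ?_ h1.ne
      by_contra h2
      have := hc.mono j i hj'.1 (by omega) hi.2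
      omega
    · intro h h1 h2
      have := hc.mono i j hi.1 h1.le hj'.2
      exact h (by omega)

theorem isCut_next (h : IsConfig σ τ c) (hlt : ∀ i, 1 ≤ i → i ≤ σ.length → c i < τ.length) :
    IsCut σ.length τ.length (fun i => nextCut τ (c i)) where
  mono i j hi hij hj := nextCut_mono h.right.1 (h.cut.mono i j hi hij hj)
    (h.adm j (hi.trans hij) hj) (hlt j (hi.trans hij) hj)
  le i hi hi2 := (nextCut_mem h.right.1 (hlt i hi hi2)).2.le

/-- Replacing a cut by its successor respects `block`, because the new cut depends only on the value
of the old one. -/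
theorem isConfig_next (h : IsConfig σ τ c) (hlt : ∀ i, 1 ≤ i → i ≤ σ.length → c i < τ.length) :
    IsConfig σ τ (fun i => nextCut τ (c i)) where
  left := h.left
  right := h.right
  cut := isCut_next h hlt
  block := h.block.imp fun h1 h2 => congrArg _ (h1 h2)
  adm i hi hi2 := (nextCut_mem h.right.1 (hlt i hi hi2)).2

theorem isConfig_prev (h : IsConfig σ τ c) (hpos : ∀ i, 1 ≤ i → i ≤ σ.length → 0 < c i) :
    IsConfig σ τ (fun i => prevCut τ (c i)) where
  left := h.left
  right := h.right
  cut := by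
    refine ⟨fun i j hi hij hj => ?_, fun i hi hi2 => ?_⟩
    · obtain ⟨h1, h2⟩ := prevCut_mem h.right.1 (hpos i hi (hij.trans hj))
      exact le_prevCut (h1.trans_le (h.cut.mono i j hi hij hj)) h2
    · exact (prevCut_mem h.right.1 (hpos i hi hi2)).2.le
  block := h.block.imp fun h1 h2 => congrArg _ (h1 h2)
  adm i hi hi2 := (prevCut_mem h.right.1 (hpos i hi hi2)).2

/-- By `shift_filter`, adding `mᵢ + 1` to a letter on the left replaces its cut by the next
admissible one. The set `L` is thus the set of left letters of the new word, its complement `R` is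
the set of right letters, and refilling with the same patterns gives the new word. -/
theorem psi_build (h : IsConfig σ τ c) (hlt : ∀ i, 1 ≤ i → i ≤ σ.length → c i < τ.length) :
    psi (build σ τ c) = build σ τ (fun i => nextCut τ (c i)) := by
  have hc' := isCut_next h hlt
  obtain ⟨⟨hσ, -⟩, hτa, hc, -, hadm⟩ := h
  have hτ := hτa.1
  set c' := fun i => nextCut τ (c i) with hc'def
  have hperm := isPerm_build hσ hτ hc'
  have hL : ((σ.map (lowLetter c)).map (fun x => x + shift (above (σ.map (lowLetter c))
      (τ.map (highLetter σ.length c)) x) + 1)).toFinset =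
      (Finset.Icc 1 σ.length).image (lowLetter c') := by
    have e : (σ.map (lowLetter c)).map (fun x => x + shift (above (σ.map (lowLetter c))
      (τ.map (highLetter σ.length c)) x) + 1) = σ.map (lowLetter c') := by
      rw [List.map_map]
      refine List.map_congr_left fun i hi => ?_
      have hi' := hσ.mem_iff.1 hi
      rw [Function.comp, above_build hσ hc hi']
      have hli := hlt i hi'.1 hi'.2
      -- The truncation at the larger cuts in use is harmless: those are admissible, so the next
      -- admissible cut does not exceed them.
      have := shift_filter hτa (hadm i hi'.1 hi'.2) hli
        (Q := fun y => ∀ j ∈ σ, c i < c j → y ≤ c j)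
        (fun a b hab hb j hj hij => hab.trans (hb j hj hij))
        (fun j hj hij => nextCut_le hij (hadm j (hσ.mem_iff.1 hj).1 (hσ.mem_iff.1 hj).2))
        (highLetter_strictMono σ.length c)
      rw [lowLetter, lowLetter, hc'def]
      simp only
      omega
    rw [e]
    ext y
    simp only [List.mem_toFinset, List.mem_map, Finset.mem_image, Finset.mem_Icc, hσ.mem_iff]
  have hR : Finset.Icc 1 (σ.length + τ.length + 1 - 1) \
      (Finset.Icc 1 σ.length).image (lowLetter c') =
      (Finset.Icc 1 τ.length).image (highLetter σ.length c') := by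
    ext y
    rw [Finset.mem_sdiff, Finset.mem_Icc, Finset.mem_image, Finset.mem_image]
    constructor
    · rintro ⟨h1, h2⟩
      have h3 := hperm.mem_iff.2 ⟨h1.1, h1.2.trans (by omega)⟩
      rw [build, List.mem_append, List.mem_cons, List.mem_map, List.mem_map] at h3
      rcases h3 with ⟨i, hi, h3⟩ | h3 | ⟨i, hi, h3⟩
      · exact absurd ⟨i, Finset.mem_Icc.2 (hσ.mem_iff.1 hi), h3⟩ h2
      · omega
      · exact ⟨i, Finset.mem_Icc.2 (hτ.mem_iff.1 hi), h3⟩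
    · rintro ⟨x, hx, rfl⟩
      rw [Finset.mem_Icc] at hx
      have h1 := highLetter_bounds σ.length c' hx
      refine ⟨by omega, ?_⟩
      rintro ⟨i, hi, h2⟩
      rw [Finset.mem_Icc] at hi
      have h3 := hc'.low_lt_high_iff (y := x) hi
      have h4 := hc'.high_lt_low_iff (y := x) hi
      omega
  have htop := top_notMem_low hσ hc
  have etake := takeWhile_ne_append (v := τ.map (highLetter σ.length c)) htop
  have edrop := dropWhile_ne_append (v := τ.map (highLetter σ.length c)) htop
  rw [← build] at etake edrop
  unfold psi
  simp only [length_build, etake, edrop, List.tail_cons]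
  rw [hL, hR, st_map (incOn_low hσ hc), st_map (incOn_high _ _ _), hσ.st, hτ.st,
    unst_image_Icc, unst_image_Icc]
  · rfl
  · intro a b _ hab _
    exact highLetter_strictMono _ _ hab
  · exact fun x hx => hτ.mem_iff.1 hx
  · intro a b h1 h2 h3
    exact (hc'.lowLetter_lt_iff ⟨h1, by omega⟩ ⟨by omega, h3⟩).2 h2
  · exact fun x hx => hσ.mem_iff.1 hx

end Build

/-! ### Inserting a new largest letter -/

theorem insertIdx_length_append (u v : List ℕ) (x : ℕ) :
    (u ++ v).insertIdx u.length x = u ++ x :: v := by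
  induction u with
  | nil => simp
  | cons a u ih => simp [ih]

theorem lmaxPos_append_cons {u v : List ℕ} {m : ℕ} (hm : ∀ x ∈ u, x < m) :
    ∃ l, lmaxPos (u ++ m :: v) = lmaxPos u ++ u.length :: l := by
  have h1 : (u ++ m :: v).length = u.length + (v.length + 1) := by simp
  unfold lmaxPos
  rw [h1, List.range_add, List.filter_append, List.range_succ_eq_map, List.map_cons, add_zero,
    List.filter_cons_of_pos]
  · refine ⟨_, congrArg (· ++ _) ?_⟩
    refine List.filter_congr fun p hp => ?_
    rw [List.mem_range] at hp
    refine decide_eq_decide.2 (forall₂_congr fun q hq => ?_)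
    rw [letter_append_left _ hp, letter_append_left _ (by omega)]
  · rw [decide_eq_true_eq]
    intro q hq
    rw [letter_append_left _ hq, letter_append_right' _ le_rfl]
    simpa [letter] using hm _ (letter_mem hq)

/-- The left-to-right maxima before `m` are those of `u`, so `m` has index `lmax u + 1`. -/
theorem hat_append {u v : List ℕ} {m : ℕ} (hm : ∀ x ∈ u, x < m) :
    hat (lmax u + 1) (u ++ m :: v) = u ++ ((u ++ m :: v).length + 1) :: m :: v := by
  obtain ⟨l, hl⟩ := lmaxPos_append_cons (v := v) hm
  have : (lmaxPos (u ++ m :: v)).getD (lmax u + 1 - 1) (u ++ m :: v).length = u.length := by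
    rw [hl, Nat.add_sub_cancel, lmax]
    simp
  rw [hat, this, insertIdx_length_append]

theorem hat_one (w : List ℕ) : hat 1 w = (w.length + 1) :: w := by
  cases w with
  | nil => rfl
  | cons m v => exact hat_append (u := []) (by simp)

theorem exists_split_of_le_lmax {w : List ℕ} {i : ℕ} (h1 : 1 ≤ i) (h2 : i ≤ lmax w) :
    ∃ u m v, w = u ++ m :: v ∧ (∀ x ∈ u, x < m) ∧ lmax u + 1 = i := by
  induction w using List.reverseRecOn with
  | nil => simp at h2; omega
  | append_singleton w a ih =>
    by_cases h : i ≤ lmax w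
    · obtain ⟨u, m, v, rfl, h3, h4⟩ := ih h
      exact ⟨u, m, v ++ [a], by simp, h3, h4⟩
    · rw [lmax_append] at h2
      simp only [List.length_singleton, List.range_one] at h2
      by_cases h3 : ∀ x ∈ w, x < a
      · refine ⟨w, a, [], rfl, h3, ?_⟩
        have := List.length_filter_le (fun p => decide ((∀ x ∈ w, x < letter [a] p) ∧
          ∀ q < p, letter [a] q < letter [a] p)) [0]
        rw [List.length_singleton] at this
        omega
      · rw [List.filter_cons_of_neg (by simpa [letter] using h3)] at h2
        simp at h2
        omega

theorem isPerm_insert_iff {n : ℕ} {u v : List ℕ} :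
    IsPerm (n + 1) (u ++ (n + 1) :: v) ↔ IsPerm n (u ++ v) := by
  unfold IsPerm
  have h1 : List.range' 1 (n + 1) = List.range' 1 n ++ [n + 1] := by
    rw [List.range'_1_concat, add_comm 1 n]
  have h2 : (List.range' 1 n ++ [n + 1]).Perm ((n + 1) :: List.range' 1 n) := by
    simp
  rw [h1, List.perm_middle.congr_left, h2.congr_right, List.perm_cons]

theorem isAvoider_insert_iff {n : ℕ} {u v : List ℕ} {m : ℕ} (hm : ∀ x ∈ u, x < m) :
    IsAvoider (n + 1) (u ++ (n + 1) :: m :: v) ↔ IsAvoider n (u ++ m :: v) := by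
  unfold IsAvoider
  rw [isPerm_insert_iff]
  refine and_congr_right fun h => avoids_insert_iff hm fun x hx => ?_
  have := (h.mem_iff.1 hx).2
  omega

/-! ### Parametrization of `φ` -/

section Phi

variable {σ τ : List ℕ} {c : ℕ → ℕ}

/-- The word `build σ τ c` without its largest letter. -/
def base (σ τ : List ℕ) (c : ℕ → ℕ) : List ℕ :=
  σ.map (lowLetter c) ++ τ.map (highLetter σ.length c)

theorem length_base : (base σ τ c).length = σ.length + τ.length := by simp [base]

theorem highLetter_zero (c : ℕ → ℕ) (y : ℕ) : highLetter 0 c y = y := by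
  simp [highLetter, countBelow]

theorem build_nil (τ : List ℕ) (c : ℕ → ℕ) : build [] τ c = (τ.length + 1) :: τ := by
  simp [build, funext (highLetter_zero c)]

theorem base_nil (τ : List ℕ) (c : ℕ → ℕ) : base [] τ c = τ := by
  simp [base, funext (highLetter_zero c)]

theorem isConfig_nil (h : IsAvoider τ.length τ) (c : ℕ → ℕ) : IsConfig [] τ c where
  left := ⟨isPerm_zero.2 rfl, fun ⟨_, _, _, _, _, _, _, h, _⟩ => by simp at h,
    fun ⟨_, _, _, _, _, h, _⟩ => by simp at h⟩
  right := h
  cut := ⟨fun i j h1 h2 h3 => by simp at h3; omega, fun i h1 h2 => by simp at h2; omega⟩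
  block := List.Pairwise.nil
  adm i h1 h2 := by simp at h2; omega

/-- All letters on the left are smaller than the first letter on the right. -/
theorem low_lt_head (h : IsConfig σ τ c) (hlt : ∀ i, 1 ≤ i → i ≤ σ.length → c i < τ.length)
    {m : ℕ} {v : List ℕ} (hτ : τ.map (highLetter σ.length c) = m :: v) :
    ∀ x ∈ σ.map (lowLetter c), x < m := by
  intro x hx
  obtain ⟨i, hi, rfl⟩ := List.mem_map.1 hx
  have hi' := h.left.1.mem_iff.1 hi
  obtain ⟨t, τ', rfl⟩ := List.exists_cons_of_ne_nil (l := τ) (by rintro rfl; simp at hτ)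
  rw [List.map_cons, List.cons.injEq] at hτ
  rw [← hτ.1, h.cut.low_lt_high_iff hi']
  exact (h.adm i hi'.1 hi'.2).first (hlt i hi'.1 hi'.2)

theorem map_high_ne_nil (hlt : ∀ i, 1 ≤ i → i ≤ σ.length → c i < τ.length) (hσ : σ ≠ []) :
    ∃ m v, τ.map (highLetter σ.length c) = m :: v := by
  refine List.exists_cons_of_ne_nil ?_
  rw [Ne, List.map_eq_nil_iff]
  rintro rfl
  have := hlt 1 le_rfl (List.length_pos_of_ne_nil hσ)
  simp at this

theorem isAvoider_base (h : IsConfig σ τ c)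
    (hlt : ∀ i, 1 ≤ i → i ≤ σ.length → c i < τ.length) :
    IsAvoider (σ.length + τ.length) (base σ τ c) := by
  by_cases hσ : σ = []
  · subst hσ
    rw [base_nil]
    simpa using h.right
  · obtain ⟨m, v, hm⟩ := map_high_ne_nil hlt hσ
    have h1 := isAvoider_of_isConfig h
    rw [build, hm] at h1
    rw [base, hm]
    exact (isAvoider_insert_iff (low_lt_head h hlt hm)).1 h1

/-- The head of the right part exceeds all letters on the left, so it is the left-to-right maximum
with index `lmax σ + 1`. Inserting the largest letter there gives `build σ τ c`, and `ψ` advances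
the cuts. For empty `σ` there are no cuts, in accordance with `φ₁` not involving `ψ`. -/
theorem phi_base (h : IsConfig σ τ c) (hlt : ∀ i, 1 ≤ i → i ≤ σ.length → c i < τ.length) :
    phi (lmax σ + 1) (base σ τ c) = build σ τ (fun i => nextCut τ (c i)) := by
  by_cases hσ : σ = []
  · subst hσ
    rw [base_nil, lmax_nil, zero_add, phi, if_pos rfl, hat_one, build_nil]
  · have h0 := lmax_pos hσ
    obtain ⟨m, v, hm⟩ := map_high_ne_nil hlt hσ
    have h1 := hat_append (v := v) (low_lt_head h hlt hm)
    rw [← hm, (incOn_low h.left.1 h.cut).lmax_map, ← base, length_base, ← build] at h1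
    rw [phi, if_neg (by omega), h1, psi_build h hlt]

/-- The alternative `lmax σ + 1 = 1` accounts for the empty word, which admits `φ₁` although it has
no left-to-right maximum. -/
theorem lmax_lt_lmax_base (h : IsConfig σ τ c)
    (hlt : ∀ i, 1 ≤ i → i ≤ σ.length → c i < τ.length) :
    lmax σ + 1 = 1 ∨ lmax σ + 1 ≤ lmax (base σ τ c) := by
  by_cases hσ : σ = []
  · subst hσ
    exact Or.inl rfl
  · right
    obtain ⟨m, v, hm⟩ := map_high_ne_nil hlt hσ
    have h1 := low_lt_head h hlt hm
    rw [base, hm, ← List.singleton_append, ← List.append_assoc]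
    rw [lmax_append, lmax_append_of_prec, (incOn_low h.left.1 h.cut).lmax_map, lmax_singleton]
    · omega
    · intro a ha b hb
      rw [List.mem_singleton] at hb
      exact hb ▸ h1 a ha

/-- For `i > 1` the word is split at its `i`th left-to-right maximum `m`. Since `m` is on the right
and exceeds every letter on the left, no cut reaches `|τ|`. -/
theorem exists_base {n i : ℕ} {w : List ℕ} (hw : IsAvoider n w) (h1 : 1 ≤ i)
    (h2 : i = 1 ∨ i ≤ lmax w) :
    ∃ σ τ c, IsConfig σ τ c ∧ (∀ i, 1 ≤ i → i ≤ σ.length → c i < τ.length) ∧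
      w = base σ τ c ∧ i = lmax σ + 1 := by
  by_cases hi : i = 1
  · refine ⟨[], w, 0, isConfig_nil (by rwa [hw.1.length]) _, fun i h1 h2 => ?_,
      (base_nil _ _).symm, hi⟩
    simp at h2
    omega
  · obtain ⟨u, m, v, rfl, h3, rfl⟩ := exists_split_of_le_lmax h1 (h2.resolve_left hi)
    have h4 := (isAvoider_insert_iff h3).2 hw
    obtain ⟨σ, τ, c, hσ, hτ, hc, hlen, e1, e2, e3⟩ := exists_build_of_append h4.1
    rw [e3] at h4
    have h5 := isConfig_of_avoids hσ hτ hc h4.2.1 h4.2.2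
    refine ⟨σ, τ, c, h5, fun i hi1 hi2 => ?_, by rw [base, ← e1, ← e2], ?_⟩
    · have h6 : m ∈ τ.map (highLetter σ.length c) := by rw [← e2]; simp
      obtain ⟨y, hy, rfl⟩ := List.mem_map.1 h6
      have h7 := h3 (lowLetter c i) (by
        rw [e1]
        exact List.mem_map.2 ⟨i, hσ.mem_iff.2 ⟨hi1, hi2⟩, rfl⟩)
      rw [hc.low_lt_high_iff ⟨hi1, hi2⟩] at h7
      exact h7.trans_le (hτ.mem_iff.1 hy).2
    · rw [e1, (incOn_low hσ hc).lmax_map]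

/-! ### Indecomposable words -/

/-- `w` is nonempty and not the sum of two nonempty words. -/
def Indec (w : List ℕ) : Prop :=
  w ≠ [] ∧ ∀ α β : List ℕ, w = α ++ β → Prec α β → α = [] ∨ β = []

/-- In a splitting `α ≺ β` into nonempty parts the largest letter is not in `α`, so `α` consists of
letters on the left, and it contains `1`. But a letter on the left with positive cut is at least
`2`. -/
theorem indec_build (h : IsConfig σ τ c) (hpos : ∀ i, 1 ≤ i → i ≤ σ.length → 0 < c i) :
    Indec (build σ τ c) := by
  refine ⟨by simp [build], fun α β hαβ hprec => ?_⟩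
  by_contra hne
  rw [not_or] at hne
  have hperm := isPerm_build h.left.1 h.right.1 h.cut
  rw [hαβ] at hperm
  have htop : σ.length + τ.length + 1 ∉ α := by
    intro h1
    obtain ⟨b, hb⟩ := List.exists_mem_of_ne_nil β hne.2
    have h2 := hprec _ h1 _ hb
    have h3 := hperm.mem_iff.1 (List.mem_append_right α hb)
    omega
  have hsub : ∀ a ∈ α, a ∈ σ.map (lowLetter c) := by
    intro a ha
    rw [build, List.append_eq_append_iff] at hαβ
    rcases hαβ with ⟨δ, h1, h2⟩ | ⟨δ, h1, -⟩
    · rw [List.cons_eq_append_iff] at h2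
      rcases h2 with ⟨h2, -⟩ | ⟨δ', h2, -⟩
      · rwa [h1, h2, List.append_nil] at ha
      · exact absurd (by rw [h1, h2]; simp) htop
    · rw [h1]
      exact List.mem_append_left _ ha
  have h1 : 1 ∈ α ++ β := hperm.mem_iff.2 ⟨le_rfl, by omega⟩
  rcases List.mem_append.1 h1 with h1 | h1
  · obtain ⟨i, hi, h2⟩ := List.mem_map.1 (hsub 1 h1)
    have hi' := h.left.1.mem_iff.1 hi
    have := hpos i hi'.1 hi'.2
    unfold lowLetter at h2
    omega
  · obtain ⟨a, ha⟩ := List.exists_mem_of_ne_nil α hne.1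
    have h2 := hprec a ha 1 h1
    have h3 := hperm.mem_iff.1 (List.mem_append_left β ha)
    omega

theorem exists_split_zero {w : List ℕ} (h : w.Pairwise (fun a b => c a ≤ c b)) :
    ∃ u v, w = u ++ v ∧ (∀ x ∈ u, c x = 0) ∧ ∀ x ∈ v, 0 < c x := by
  induction w with
  | nil => exact ⟨[], [], rfl, by simp, by simp⟩
  | cons a w ih =>
    rw [List.pairwise_cons] at h
    by_cases ha : c a = 0
    · obtain ⟨u, v, rfl, h1, h2⟩ := ih h.2
      exact ⟨a :: u, v, rfl, by simpa using ⟨ha, h1⟩, h2⟩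
    · refine ⟨[], a :: w, rfl, by simp, fun x hx => ?_⟩
      rcases List.mem_cons.1 hx with rfl | hx
      · omega
      · have := h.1 x hx
        omega

/-- By `block` and monotonicity the cuts weakly increase along the positions of `σ`. The letters
with cut `0` therefore form a prefix that precedes everything else in value, and a nonempty such
prefix splits the word. -/
theorem pos_of_indec (h : IsConfig σ τ c) (hI : Indec (build σ τ c)) {i : ℕ} (hi1 : 1 ≤ i)
    (hi2 : i ≤ σ.length) : 0 < c i := by
  have hσ := h.left.1
  have hpw : σ.Pairwise (fun a b => c a ≤ c b) := by
    refine h.block.imp_of_mem fun {a b} ha hb hab => ?_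
    by_cases hlt : b < a
    · exact (hab hlt).le
    · exact h.cut.mono a b (hσ.mem_iff.1 ha).1 (by omega) (hσ.mem_iff.1 hb).2
  obtain ⟨u, v, huv, hu, hv⟩ := exists_split_zero hpw
  by_contra h0
  have hiσ : i ∈ u ++ v := huv ▸ hσ.mem_iff.2 ⟨hi1, hi2⟩
  have hiu : i ∈ u := by
    rcases List.mem_append.1 hiσ with h1 | h1
    · exact h1
    · exact absurd (hv i h1) h0
  have hmem : ∀ x, x ∈ u ∨ x ∈ v → 1 ≤ x ∧ x ≤ σ.length := fun x hx =>
    hσ.mem_iff.1 (huv ▸ List.mem_append.2 hx)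
  have h1 := hI.2 (u.map (lowLetter c)) (v.map (lowLetter c) ++
    (σ.length + τ.length + 1) :: τ.map (highLetter σ.length c)) (by
      rw [build, ← List.append_assoc, ← List.map_append, ← huv]) (by
      intro a ha b hb
      obtain ⟨x, hx, rfl⟩ := List.mem_map.1 ha
      have hx' := hmem x (Or.inl hx)
      rw [List.mem_append, List.mem_cons, List.mem_map, List.mem_map] at hb
      rcases hb with ⟨y, hy, rfl⟩ | rfl | ⟨y, hy, rfl⟩
      · have hy' := hmem y (Or.inr hy)
        rw [h.cut.lowLetter_lt_iff hx' hy']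
        have h2 := hu x hx
        have h3 := hv y hy
        by_contra h4
        have := h.cut.mono y x hy'.1 (by omega) hx'.2
        omega
      · have := h.cut.lowLetter_bounds hx'
        omega
      · rw [h.cut.low_lt_high_iff hx', hu x hx]
        exact (h.right.1.mem_iff.1 hy).1)
  rcases h1 with h1 | h1
  · rw [List.map_eq_nil_iff] at h1
    rw [h1] at hiu
    simp at hiu
  · simp at h1

/-! ### Properties of `φ` -/

theorem isAvoider_phi {n i : ℕ} {w : List ℕ} (hw : IsAvoider n w) (h1 : 1 ≤ i)
    (h2 : i = 1 ∨ i ≤ lmax w) : IsAvoider (n + 1) (phi i w) := by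
  obtain ⟨σ, τ, c, h, hlt, rfl, rfl⟩ := exists_base hw h1 h2
  rw [phi_base h hlt, ← hw.1.length, length_base]
  exact isAvoider_of_isConfig (isConfig_next h hlt)

theorem indec_phi {n i : ℕ} {w : List ℕ} (hw : IsAvoider n w) (h1 : 1 ≤ i)
    (h2 : i = 1 ∨ i ≤ lmax w) : Indec (phi i w) := by
  obtain ⟨σ, τ, c, h, hlt, rfl, rfl⟩ := exists_base hw h1 h2
  rw [phi_base h hlt]
  refine indec_build (isConfig_next h hlt) fun i hi1 hi2 => ?_
  exact (Nat.zero_le _).trans_lt (nextCut_mem h.right.1 (hlt i hi1 hi2)).1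

/-- Indecomposability makes all cuts positive, so each can be moved back to the previous admissible
one. The resulting cuts are below `|τ|`, and `φ` advances them again. -/
theorem exists_phi_of_indec {n : ℕ} {w : List ℕ} (hw : IsAvoider (n + 1) w) (hI : Indec w) :
    ∃ i v, IsAvoider n v ∧ 1 ≤ i ∧ (i = 1 ∨ i ≤ lmax v) ∧ phi i v = w := by
  obtain ⟨s, t, rfl⟩ := hw.1.exists_eq_append (by omega)
  obtain ⟨σ, τ, c, hσ, hτ, hc, hlen, -, -, e⟩ := exists_build_of_append hw.1
  rw [e] at hw hI ⊢
  have h := isConfig_of_avoids hσ hτ hc hw.2.1 hw.2.2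
  have hpos : ∀ i, 1 ≤ i → i ≤ σ.length → 0 < c i := fun i hi1 hi2 => pos_of_indec h hI hi1 hi2
  have h' := isConfig_prev h hpos
  have hlt : ∀ i, 1 ≤ i → i ≤ σ.length → prevCut τ (c i) < τ.length := fun i hi1 hi2 =>
    (prevCut_mem hτ (hpos i hi1 hi2)).1.trans_le (hc.le i hi1 hi2)
  refine ⟨lmax σ + 1, base σ τ (fun i => prevCut τ (c i)), ?_, by omega,
    lmax_lt_lmax_base h' hlt, ?_⟩
  · rw [show n = σ.length + τ.length by omega]
    exact isAvoider_base h' hlt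
  · rw [phi_base h' hlt]
    exact build_congr hσ fun i hi1 hi2 => nextCut_prevCut hτ (h.adm i hi1 hi2) (hpos i hi1 hi2)

theorem base_congr {c' : ℕ → ℕ} (hσ : IsPerm σ.length σ)
    (h : ∀ i, 1 ≤ i → i ≤ σ.length → c i = c' i) : base σ τ c = base σ τ c' := by
  have := build_congr (τ := τ) hσ h
  rw [build, build, List.append_eq_append_iff_of_size_eq_left (by simp)] at this
  rw [base, base, this.1, List.tail_eq_of_cons_eq this.2]

theorem lmax_build (hσ : IsPerm σ.length σ) (hτ : IsPerm τ.length τ)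
    (hc : IsCut σ.length τ.length c) : lmax (build σ τ c) = lmax σ + 1 := by
  rw [build, ← List.singleton_append, ← List.append_assoc,
    lmax_append_of_dominated (x := σ.length + τ.length + 1) (by simp), lmax_append_of_prec,
    (incOn_low hσ hc).lmax_map, lmax_singleton]
  · intro a ha b hb
    obtain ⟨x, hx, rfl⟩ := List.mem_map.1 ha
    have := hc.lowLetter_bounds (hσ.mem_iff.1 hx)
    rw [List.mem_singleton] at hb
    omega
  · intro y hy
    obtain ⟨x, hx, rfl⟩ := List.mem_map.1 hy
    have := highLetter_bounds σ.length c (hτ.mem_iff.1 hx)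
    omega

theorem lmax_phi {n i : ℕ} {w : List ℕ} (hw : IsAvoider n w) (h1 : 1 ≤ i)
    (h2 : i = 1 ∨ i ≤ lmax w) : lmax (phi i w) = i := by
  obtain ⟨σ, τ, c, h, hlt, rfl, rfl⟩ := exists_base hw h1 h2
  rw [phi_base h hlt, lmax_build h.left.1 h.right.1 (isCut_next h hlt)]

/-- The index is the number of left-to-right maxima of the image; the patterns and advanced cuts are
determined by the image, and advancing is injective on admissible cuts. -/
theorem phi_injective {n n' i i' : ℕ} {w w' : List ℕ} (hw : IsAvoider n w) (h1 : 1 ≤ i)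
    (h2 : i = 1 ∨ i ≤ lmax w) (hw' : IsAvoider n' w') (h1' : 1 ≤ i')
    (h2' : i' = 1 ∨ i' ≤ lmax w') (heq : phi i w = phi i' w') : i = i' ∧ w = w' := by
  refine ⟨by rw [← lmax_phi hw h1 h2, heq, lmax_phi hw' h1' h2'], ?_⟩
  obtain ⟨σ, τ, c, h, hlt, rfl, rfl⟩ := exists_base hw h1 h2
  obtain ⟨σ', τ', c', h', hlt', rfl, rfl⟩ := exists_base hw' h1' h2'
  rw [phi_base h hlt, phi_base h' hlt'] at heq
  obtain ⟨rfl, rfl, hcc⟩ := build_injective h.left.1 h.right.1 (isCut_next h hlt) h'.left.1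
    h'.right.1 (isCut_next h' hlt') heq
  refine base_congr h.left.1 fun i hi1 hi2 => ?_
  exact nextCut_injOn h.right.1 (h.adm i hi1 hi2) (h'.adm i hi1 hi2) (hlt i hi1 hi2)
    (hlt' i hi1 hi2) (hcc i hi1 hi2)

end Phi

/-! ### Statistics of `φ` -/

/-- The letters of the initial increasing run are left-to-right maxima. -/
theorem lir_le_lmax (w : List ℕ) : lir w ≤ lmax w := by
  have h := le_lir_iff.1 (le_refl (lir w))
  have h1 := lmax_of_pairwise h.2
  rw [List.length_take, min_eq_left h.1] at h1
  rw [← h1]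
  exact lmax_take_le w _

theorem le_lir_append_iff {u v : List ℕ} {k : ℕ} (hk : k ≤ u.length) :
    k ≤ lir (u ++ v) ↔ k ≤ lir u := by
  rw [le_lir_iff, le_lir_iff, List.take_append_of_le_length hk, List.length_append]
  refine and_congr_left fun _ => ?_
  omega

theorem length_succ_le_lir_iff {u v : List ℕ} {m : ℕ} (hm : ∀ x ∈ u, x < m) :
    u.length + 1 ≤ lir (u ++ m :: v) ↔ u.length ≤ lir u := by
  rw [le_lir_iff, le_lir_iff, List.take_length, List.take_length_add_append,
    List.pairwise_append]
  simp
  intro _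
  exact hm

theorem lir_append_top_le {u v : List ℕ} {n : ℕ} (hn : ∀ x ∈ v, x < n) :
    lir (u ++ n :: v) ≤ u.length + 1 := by
  by_contra h
  have h1 := (le_lir_iff.1 (not_le.1 h))
  obtain ⟨h2, h3⟩ := h1
  obtain ⟨a, v, rfl⟩ := List.exists_cons_of_ne_nil (l := v) (by rintro rfl; simp at h2)
  rw [show (u.length + 1).succ = u.length + 2 by omega, List.take_length_add_append,
    List.pairwise_append] at h3
  have h4 := h3.2.1
  simp at h4
  have := hn a (by simp)
  omega

/-- The number of left-to-right minima of `τ` among the letters up to `s`. -/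
def lminUpTo (τ : List ℕ) (s : ℕ) : ℕ :=
  ((List.range τ.length).filter (fun p => letter τ p ≤ s ∧
    ∀ q < p, letter τ p < letter τ q)).length

/-- All letters in front of `s + 1` exceed the next cut. Hence `s + 1` is a left-to-right minimum,
and every other letter above `s` and up to the next cut comes after it. -/
theorem lminUpTo_nextCut {τ : List ℕ} {s : ℕ} (hτ : IsAvoider τ.length τ) (hs : Adm τ s)
    (hsl : s < τ.length) : lminUpTo τ (nextCut τ s) = lminUpTo τ s + 1 := by
  obtain ⟨hn1, hn2⟩ := nextCut_mem hτ.1 hsl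
  obtain ⟨z, hz, hz1⟩ := hτ.1.exists_letter (x := s + 1) (by omega) hsl
  have hpre := nextCut_lt_letter hτ hs hz hz1
  have hcard : ∀ t, lminUpTo τ t = ((Finset.range τ.length).filter (fun p => letter τ p ≤ t ∧
      ∀ q < p, letter τ p < letter τ q)).card := fun t => by
    rw [lminUpTo, ← List.toFinset_card_of_nodup (List.nodup_range.filter _)]
    congr 1
    ext p
    simp
  rw [hcard, hcard, ← Finset.card_insert_of_notMem (a := z)]
  · congr 1
    ext p
    rw [Finset.mem_insert, Finset.mem_filter, Finset.mem_filter, Finset.mem_range]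
    constructor
    · rintro ⟨h1, h2, h3⟩
      by_cases hp : p = z
      · exact Or.inl hp
      refine Or.inr ⟨h1, ?_, h3⟩
      rcases Nat.lt_or_gt_of_ne hp with h4 | h4
      · have := hpre p h4
        omega
      · have := h3 z h4
        omega
    · rintro (rfl | ⟨h1, h2, h3⟩)
      · refine ⟨hz, by omega, fun q hq => ?_⟩
        have := hpre q hq
        omega
      · exact ⟨h1, by omega, h3⟩
  · rw [Finset.mem_filter]
    omega

section Phi

variable {σ τ : List ℕ} {c : ℕ → ℕ}

/-- Being below all letters on the left means being below the least of them, which is a comparison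
of rank with `c 1`. The word `u` is empty or the largest letter, so that `base` and `build` are
covered at once. -/
theorem lmin_append_high (hσ : IsPerm σ.length σ) (hc : IsCut σ.length τ.length c) (h0 : σ ≠ [])
    {u : List ℕ} (hu : ∀ x ∈ u, ∀ y ∈ τ, highLetter σ.length c y < x) :
    ((List.range (τ.map (highLetter σ.length c)).length).filter (fun p =>
      (∀ x ∈ σ.map (lowLetter c) ++ u, letter (τ.map (highLetter σ.length c)) p < x) ∧
      ∀ q < p, letter (τ.map (highLetter σ.length c)) p <
        letter (τ.map (highLetter σ.length c)) q)).length = lminUpTo τ (c 1) := by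
  rw [lminUpTo, List.length_map]
  congr 1
  refine List.filter_congr fun p hp => decide_eq_decide.2 ?_
  rw [List.mem_range] at hp
  refine and_congr ⟨fun h => ?_, fun h x hx => ?_⟩ (forall₂_congr fun q hq => ?_)
  · have h1 : 1 ≤ 1 ∧ 1 ≤ σ.length := ⟨le_rfl, List.length_pos_of_ne_nil h0⟩
    have h2 := h (lowLetter c 1) (List.mem_append_left _
      (List.mem_map.2 ⟨1, hσ.mem_iff.2 h1, rfl⟩))
    rwa [letter_map _ hp, hc.high_lt_low_iff h1] at h2
  · rw [letter_map _ hp]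
    rcases List.mem_append.1 hx with hx | hx
    · obtain ⟨i, hi, rfl⟩ := List.mem_map.1 hx
      have hi' := hσ.mem_iff.1 hi
      rw [hc.high_lt_low_iff hi']
      exact h.trans (hc.mono 1 i le_rfl hi'.1 hi'.2)
    · exact hu x hx _ (letter_mem hp)
  · rw [(incOn_high _ _ _).letter_lt_iff hp (by omega)]

theorem lmin_base (hσ : IsPerm σ.length σ) (hc : IsCut σ.length τ.length c) (h0 : σ ≠ []) :
    lmin (base σ τ c) = lmin σ + lminUpTo τ (c 1) := by
  rw [base, lmin_append, (incOn_low hσ hc).lmin_map]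
  have := lmin_append_high hσ hc h0 (u := []) (by simp)
  rw [List.append_nil] at this
  rw [this]

theorem lmin_build (hσ : IsPerm σ.length σ) (hτ : IsPerm τ.length τ)
    (hc : IsCut σ.length τ.length c) (h0 : σ ≠ []) :
    lmin (build σ τ c) = lmin σ + lminUpTo τ (c 1) := by
  rw [build, ← List.singleton_append, ← List.append_assoc, lmin_append,
    lmin_append_of_prec (by simpa using h0), (incOn_low hσ hc).lmin_map,
    lmin_append_high hσ hc h0]
  · intro x hx y hy
    have := highLetter_bounds σ.length c (hτ.mem_iff.1 hy)
    rw [List.mem_singleton] at hx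
    omega
  · intro a ha b hb
    obtain ⟨x, hx, rfl⟩ := List.mem_map.1 ha
    have := hc.lowLetter_bounds (hσ.mem_iff.1 hx)
    rw [List.mem_singleton] at hb
    omega

theorem rmax_build (hσ : IsPerm σ.length σ) (hτ : IsPerm τ.length τ)
    (hc : IsCut σ.length τ.length c) : rmax (build σ τ c) = rmax τ + 1 := by
  rw [build, rmax, List.reverse_append, List.reverse_cons,
    lmax_append_of_dominated (x := σ.length + τ.length + 1) (by simp), lmax_append_of_prec,
    lmax_singleton, ← rmax, (incOn_high _ _ _).rmax_map]
  · intro a ha b hb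
    rw [List.mem_reverse] at ha
    obtain ⟨x, hx, rfl⟩ := List.mem_map.1 ha
    have := highLetter_bounds σ.length c (hτ.mem_iff.1 hx)
    rw [List.mem_singleton] at hb
    omega
  · intro y hy
    rw [List.mem_reverse] at hy
    obtain ⟨x, hx, rfl⟩ := List.mem_map.1 hy
    have := hc.lowLetter_bounds (hσ.mem_iff.1 hx)
    omega

/-- As all cuts are below `|τ|`, the largest letter on the right exceeds every letter on the left.
-/
theorem rmax_base (h : IsConfig σ τ c) (hlt : ∀ i, 1 ≤ i → i ≤ σ.length → c i < τ.length) :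
    rmax (base σ τ c) = rmax τ := by
  by_cases h0 : σ = []
  · rw [h0, base_nil]
  have h1 := hlt 1 le_rfl (List.length_pos_of_ne_nil h0)
  rw [base, rmax, List.reverse_append,
    lmax_append_of_dominated (x := highLetter σ.length c τ.length), ← rmax,
    (incOn_high _ _ _).rmax_map]
  · rw [List.mem_reverse, List.mem_map]
    exact ⟨_, h.right.1.mem_iff.2 ⟨by omega, le_rfl⟩, rfl⟩
  · intro y hy
    rw [List.mem_reverse] at hy
    obtain ⟨i, hi, rfl⟩ := List.mem_map.1 hy
    have hi' := h.left.1.mem_iff.1 hi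
    exact ((h.cut.low_lt_high_iff hi').2 (hlt i hi'.1 hi'.2)).le

theorem last_low_lt (hσ : σ ≠ []) {m : ℕ} {v : List ℕ}
    (h : ∀ x ∈ σ.map (lowLetter c), x < m) :
    letter (σ.map (lowLetter c)) ((σ.map (lowLetter c)).length - 1) < letter (m :: v) 0 := by
  have := List.length_pos_of_ne_nil hσ
  exact h _ (letter_mem (by simp; omega))

theorem low_lt_top (hσ : IsPerm σ.length σ) (hc : IsCut σ.length τ.length c) :
    ∀ x ∈ σ.map (lowLetter c), x < σ.length + τ.length + 1 := by
  intro a ha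
  obtain ⟨x, hx, rfl⟩ := List.mem_map.1 ha
  have := hc.lowLetter_bounds (hσ.mem_iff.1 hx)
  omega

theorem high_lt_top (hτ : IsPerm τ.length τ) :
    ∀ x ∈ τ.map (highLetter σ.length c), x < σ.length + τ.length + 1 := by
  intro a ha
  obtain ⟨x, hx, rfl⟩ := List.mem_map.1 ha
  have := highLetter_bounds σ.length c (hτ.mem_iff.1 hx)
  omega

theorem asc_cons_of_top {n : ℕ} {w : List ℕ} (h : ∀ x ∈ w, x < n) : asc (n :: w) = asc w := by
  cases w with
  | nil => rfl
  | cons a w =>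
    rw [← List.singleton_append, asc_append (by simp) (by simp), if_neg]
    · simp
    · have := h a (by simp)
      simp [letter]
      omega

theorem asc_build (hσ : IsPerm σ.length σ) (hτ : IsPerm τ.length τ)
    (hc : IsCut σ.length τ.length c) (h0 : σ ≠ []) :
    asc (build σ τ c) = asc σ + asc τ + 1 := by
  rw [build, asc_append (by simpa using h0) (by simp),
    if_pos (last_low_lt h0 (low_lt_top hσ hc)), asc_cons_of_top (high_lt_top hτ),
    (incOn_low hσ hc).asc_map, (incOn_high _ _ _).asc_map]

theorem ldr_build (hσ : IsPerm σ.length σ) (hc : IsCut σ.length τ.length c) (h0 : σ ≠ []) :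
    ldr (build σ τ c) = ldr σ := by
  rw [build, ldr_append (by simpa using h0) (by simp) (last_low_lt h0 (low_lt_top hσ hc)),
    (incOn_low hσ hc).ldr_map]

theorem asc_base (h : IsConfig σ τ c) (hlt : ∀ i, 1 ≤ i → i ≤ σ.length → c i < τ.length)
    (h0 : σ ≠ []) : asc (base σ τ c) = asc σ + asc τ + 1 := by
  obtain ⟨m, v, hm⟩ := map_high_ne_nil hlt h0
  have h1 := low_lt_head h hlt hm
  rw [base, asc_append (by simpa using h0) (by simp [hm]), hm, if_pos (last_low_lt h0 h1), ← hm,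
    (incOn_low h.left.1 h.cut).asc_map, (incOn_high _ _ _).asc_map]

theorem ldr_base (h : IsConfig σ τ c) (hlt : ∀ i, 1 ≤ i → i ≤ σ.length → c i < τ.length)
    (h0 : σ ≠ []) : ldr (base σ τ c) = ldr σ := by
  obtain ⟨m, v, hm⟩ := map_high_ne_nil hlt h0
  have h1 := low_lt_head h hlt hm
  rw [base, hm, ldr_append (by simpa using h0) (by simp) (last_low_lt h0 h1),
    (incOn_low h.left.1 h.cut).ldr_map]

/-- Within the left part both words have the run of `σ`, whatever the cuts. If `σ` is increasing,
then `lmax σ = |σ|`, the run of `build` ends right at the largest letter, and that of `base` extends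
at least to the head of the right part. If not, both runs have length `lir σ ≤ lmax σ`. -/
theorem lir_build_next (h : IsConfig σ τ c)
    (hlt : ∀ i, 1 ≤ i → i ≤ σ.length → c i < τ.length) (h0 : σ ≠ []) {c' : ℕ → ℕ}
    (hc' : IsCut σ.length τ.length c') :
    lir (build σ τ c') = min (lmax σ + 1) (lir (base σ τ c)) := by
  obtain ⟨m, v, hm⟩ := map_high_ne_nil hlt h0
  have h1 := low_lt_head h hlt hm
  have hσ := h.left.1
  have e1 := (incOn_low hσ h.cut).lir_map
  have e2 := (incOn_low hσ hc').lir_map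
  have hl := lir_le_lmax σ
  have hle := lmax_le_length σ
  refine eq_of_forall_le_iff fun k => ?_
  rw [le_min_iff]
  rcases lt_trichotomy k (σ.length + 1) with hk | rfl | hk
  · rw [base, build, le_lir_append_iff (by simp; omega), le_lir_append_iff (by simp; omega), e1,
      e2]
    omega
  · have h3 := length_succ_le_lir_iff (v := v) h1
    have h4 := length_succ_le_lir_iff (v := τ.map (highLetter σ.length c'))
      (low_lt_top hσ hc')
    rw [List.length_map, e1, ← hm, ← base] at h3
    rw [List.length_map, e2, ← build] at h4
    rw [h3, h4]
    omega
  · have := lir_append_top_le (u := σ.map (lowLetter c')) (high_lt_top (σ := σ) (c := c')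
      h.right.1)
    rw [← build, List.length_map] at this
    omega

variable {n i : ℕ} {w : List ℕ}

theorem phi_one (w : List ℕ) : phi 1 w = (w.length + 1) :: w := by
  rw [phi, if_pos rfl, hat_one]

theorem IsAvoider.lt_top (hw : IsAvoider n w) : ∀ x ∈ w, x < w.length + 1 := fun x hx => by
  have := (hw.1.mem_iff.1 hx).2
  have := hw.1.length
  omega

theorem asc_phi (hw : IsAvoider n w) (h1 : 1 ≤ i) (h2 : i = 1 ∨ i ≤ lmax w) :
    asc (phi i w) = asc w := by
  by_cases hi : i = 1
  · rw [hi, phi_one, asc_cons_of_top hw.lt_top]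
  obtain ⟨σ, τ, c, h, hlt, rfl, rfl⟩ := exists_base hw h1 h2
  have h0 : σ ≠ [] := by rintro rfl; simp at hi
  rw [phi_base h hlt, asc_base h hlt h0, asc_build h.left.1 h.right.1 (isCut_next h hlt) h0]

theorem rmax_phi (hw : IsAvoider n w) (h1 : 1 ≤ i) (h2 : i = 1 ∨ i ≤ lmax w) :
    rmax (phi i w) = rmax w + 1 := by
  obtain ⟨σ, τ, c, h, hlt, rfl, rfl⟩ := exists_base hw h1 h2
  rw [phi_base h hlt, rmax_base h hlt, rmax_build h.left.1 h.right.1 (isCut_next h hlt)]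

theorem lmin_phi (hw : IsAvoider n w) (h1 : 1 ≤ i) (h2 : i = 1 ∨ i ≤ lmax w) :
    lmin (phi i w) = lmin w + 1 := by
  by_cases hi : i = 1
  · rw [hi, phi_one, ← List.singleton_append, lmin_append_of_prec_left, lmin_singleton, add_comm]
    intro x hx y hy
    rw [List.mem_singleton] at hy
    exact hy ▸ hw.lt_top x hx
  obtain ⟨σ, τ, c, h, hlt, rfl, rfl⟩ := exists_base hw h1 h2
  have h0 : σ ≠ [] := by rintro rfl; simp at hi
  have h3 := List.length_pos_of_ne_nil h0
  rw [phi_base h hlt, lmin_base h.left.1 h.cut h0,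
    lmin_build h.left.1 h.right.1 (isCut_next h hlt) h0,
    lminUpTo_nextCut h.right (h.adm 1 le_rfl h3) (hlt 1 le_rfl h3), add_assoc]

theorem ldr_phi (hw : IsAvoider n w) (h1 : 1 ≤ i) (h2 : i = 1 ∨ i ≤ lmax w) :
    ldr (phi i w) = ldr w + if i = 1 then 1 else 0 := by
  by_cases hi : i = 1
  · rw [hi, phi_one, ldr_cons hw.lt_top, if_pos rfl]
  rw [if_neg hi]
  obtain ⟨σ, τ, c, h, hlt, rfl, rfl⟩ := exists_base hw h1 h2
  have h0 : σ ≠ [] := by rintro rfl; simp at hi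
  rw [phi_base h hlt, ldr_base h hlt h0, ldr_build h.left.1 (isCut_next h hlt) h0, add_zero]

theorem lir_phi (hw : IsAvoider n w) (h1 : 1 ≤ i) (h2 : i = 1 ∨ i ≤ lmax w) :
    lir (phi i w) = if w = [] then 1 else min i (lir w) := by
  by_cases hi : i = 1
  · rw [hi, phi_one, lir_cons hw.lt_top]
    split_ifs with h
    · rfl
    · have : 1 ≤ lir w := by
        obtain ⟨a, l, rfl⟩ := List.exists_cons_of_ne_nil h
        rw [le_lir_iff]
        simp
      omega
  obtain ⟨σ, τ, c, h, hlt, rfl, rfl⟩ := exists_base hw h1 h2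
  have h0 : σ ≠ [] := by rintro rfl; simp at hi
  rw [if_neg (by simp [base, h0]), phi_base h hlt, lir_build_next h hlt h0 (isCut_next h hlt)]

end Phi

/-! ### Direct sums -/

theorem oplus_nil (u : List ℕ) : oplus u [] = u := by simp [oplus]

theorem nil_oplus (u : List ℕ) : oplus [] u = u := by simp [oplus]

theorem oplus_assoc (u v w : List ℕ) : oplus (oplus u v) w = oplus u (oplus v w) := by
  simp [oplus, add_comm]

theorem length_oplus (u v : List ℕ) : (oplus u v).length = u.length + v.length := by simp [oplus]

theorem incOn_add (k : ℕ) (w : List ℕ) : IncOn (fun x => x + k) w :=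
  fun _ _ _ _ h => Nat.add_lt_add_right h k

section Oplus

variable {m n : ℕ} {u v : List ℕ}

theorem prec_oplus (hu : IsPerm m u) (hv : IsPerm n v) :
    Prec u (v.map (fun x => x + u.length)) := by
  intro a ha b hb
  obtain ⟨x, hx, rfl⟩ := List.mem_map.1 hb
  have h1 := hu.mem_iff.1 ha
  have h2 := hv.mem_iff.1 hx
  rw [hu.length]
  omega

theorem IsPerm.oplus (hu : IsPerm m u) (hv : IsPerm n v) : IsPerm (m + n) (oplus u v) := by
  unfold IsPerm at *
  have h1 : List.range' 1 (m + n) = List.range' 1 m ++ (List.range' 1 n).map (fun x => x + m) := by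
    have : (List.range' 1 n).map (fun x => x + m) = List.range' (1 + m) n := by
      have := List.map_add_range' (a := m) 1 n 1
      simpa only [add_comm m] using this
    rw [this, List.range'_append_1]
  rw [h1, Word.oplus, IsPerm.length hu]
  exact hu.append (hv.map _)

theorem IsAvoider.oplus (hu : IsAvoider m u) (hv : IsAvoider n v) :
    IsAvoider (m + n) (oplus u v) := by
  refine ⟨hu.1.oplus hv.1, ?_, ?_⟩
  · rw [Word.oplus, avoids3142_append (prec_oplus hu.1 hv.1), (incOn_add _ _).avoids3142_map]
    exact ⟨hu.2.1, hv.2.1⟩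
  · rw [Word.oplus, avoids2413_append (prec_oplus hu.1 hv.1), (incOn_add _ _).avoids2413_map]
    exact ⟨hu.2.2, hv.2.2⟩

theorem lmax_oplus (hu : IsPerm m u) (hv : IsPerm n v) : lmax (oplus u v) = lmax u + lmax v := by
  rw [oplus, lmax_append_of_prec (prec_oplus hu hv), (incOn_add _ _).lmax_map]

theorem lmin_oplus (hu : IsPerm m u) (hv : IsPerm n v) (h0 : u ≠ []) :
    lmin (oplus u v) = lmin u := by
  rw [oplus, lmin_append_of_prec h0 (prec_oplus hu hv)]

theorem rmax_oplus (hu : IsPerm m u) (hv : IsPerm n v) (h0 : v ≠ []) :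
    rmax (oplus u v) = rmax v := by
  obtain ⟨a, ha⟩ := List.exists_mem_of_ne_nil v h0
  have ha' : a + u.length ∈ v.map (fun x => x + u.length) := List.mem_map.2 ⟨a, ha, rfl⟩
  rw [oplus, rmax, List.reverse_append,
    lmax_append_of_dominated (List.mem_reverse.2 ha') (fun y hy => ?_), ← rmax,
    (incOn_add _ _).rmax_map]
  exact (prec_oplus hu hv y (List.mem_reverse.1 hy) _ ha').le

theorem last_lt_head_oplus (hu : IsPerm m u) (hv : IsPerm n v) (h0 : u ≠ []) (h1 : v ≠ []) :
    letter u (u.length - 1) < letter (v.map (fun x => x + u.length)) 0 := by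
  have h2 := List.length_pos_of_ne_nil h0
  have h3 := List.length_pos_of_ne_nil h1
  exact prec_oplus hu hv _ (letter_mem (by omega)) _ (letter_mem (by simpa))

theorem asc_oplus (hu : IsPerm m u) (hv : IsPerm n v) (h0 : u ≠ []) (h1 : v ≠ []) :
    asc (oplus u v) = asc u + asc v + 1 := by
  rw [oplus, asc_append h0 (by simpa using h1), if_pos (last_lt_head_oplus hu hv h0 h1),
    (incOn_add _ _).asc_map]

theorem ldr_oplus (hu : IsPerm m u) (hv : IsPerm n v) (h0 : u ≠ []) (h1 : v ≠ []) :
    ldr (oplus u v) = ldr u := by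
  rw [oplus, ldr_append h0 (by simpa using h1) (last_lt_head_oplus hu hv h0 h1)]

theorem lir_oplus (hu : IsPerm m u) (hv : IsPerm n v) :
    lir (oplus u v) = if lir u = u.length then u.length + lir v else lir u := by
  rw [oplus, lir_append_of_prec (prec_oplus hu hv), (incOn_add _ _).lir_map]

/-- An increasing word splits after its first letter. -/
theorem Indec.length_eq_one_of_lir (h : Indec u) (hl : lir u = u.length) : u.length = 1 := by
  obtain ⟨a, l, rfl⟩ := List.exists_cons_of_ne_nil h.1
  have h1 := (le_lir_iff.1 hl.ge).2
  rw [List.take_length, List.pairwise_cons] at h1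
  have h2 := h.2 [a] l rfl (fun x hx y hy => by
    rw [List.mem_singleton] at hx
    exact hx ▸ h1.1 y hy)
  simp at h2
  simp [h2]

theorem not_indec_oplus (hu : IsPerm m u) (hv : IsPerm n v) (h0 : u ≠ []) (h1 : v ≠ []) :
    ¬ Indec (oplus u v) := fun h => by
  rcases h.2 _ _ rfl (prec_oplus hu hv) with h2 | h2
  · exact h0 h2
  · exact h1 (by simpa using h2)

/-- One of `u`, `u'` is a prefix of the other, and the splitting this gives of the longer one
contradicts indecomposability unless they are equal. -/
theorem oplus_left_cancel {m' n' : ℕ} {u' v' : List ℕ} (hu : IsPerm m u) (hv : IsPerm n v)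
    (hu' : IsPerm m' u') (hv' : IsPerm n' v') (hI : Indec u) (hI' : Indec u')
    (h : oplus u v = oplus u' v') : u = u' ∧ v = v' := by
  have h1 : u = u' := by
    have h2 := h
    rw [oplus, oplus, List.append_eq_append_iff] at h2
    rcases h2 with ⟨δ, h2, h3⟩ | ⟨δ, h2, h3⟩
    · have := hI'.2 u δ h2 fun a ha b hb => prec_oplus hu hv a ha b (by rw [h3]; simp [hb])
      rw [h2, this.resolve_left hI.1, List.append_nil]
    · have := hI.2 u' δ h2 fun a ha b hb => prec_oplus hu' hv' a ha b (by rw [h3]; simp [hb])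
      rw [h2, this.resolve_left hI'.1, List.append_nil]
  subst h1
  refine ⟨rfl, ?_⟩
  rw [oplus, oplus, List.append_right_inj] at h
  exact List.map_injective_iff.2 (add_left_injective u.length) h

theorem exists_oplus_of_not_indec (hw : IsAvoider n u) (h0 : u ≠ []) (hI : ¬ Indec u) :
    ∃ k l v w, IsAvoider k v ∧ IsAvoider l w ∧ 1 ≤ k ∧ 1 ≤ l ∧ k + l = n ∧ oplus v w = u := by
  unfold Indec at hI
  push Not at hI
  obtain ⟨α, β, rfl, hp, hα, hβ⟩ := hI h0
  have hnd := hw.1.nodup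
  rw [List.nodup_append] at hnd
  have hlen := hw.1.length
  rw [List.length_append] at hlen
  have hmem : ∀ x, x ∈ α ∨ x ∈ β → 1 ≤ x ∧ x ≤ n := fun x hx =>
    hw.1.mem_iff.1 (List.mem_append.2 hx)
  -- The letters of `α` are exactly `1, …, |α|`. Every value up to a letter `a` of `α` again lies in
  -- `α`, so `a ≤ |α|`; and all of `α` lies below a letter `b` of `β`, so `|α| < b`.
  have key : ∀ a ∈ α, a ≤ α.length ∧ ∀ b ∈ β, α.length < b := by
    have hsub : ∀ a ∈ α, a ≤ α.length := by
      intro a ha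
      have h1 : Finset.Icc 1 a ⊆ α.toFinset := by
        intro x hx
        rw [Finset.mem_Icc] at hx
        have h2 := hw.1.mem_iff.2 ⟨hx.1, hx.2.trans (hmem a (Or.inl ha)).2⟩
        rw [List.mem_toFinset]
        refine (List.mem_append.1 h2).resolve_right fun h3 => ?_
        have := hp a ha x h3
        omega
      have := Finset.card_le_card h1
      rwa [List.toFinset_card_of_nodup hnd.1, Nat.card_Icc, Nat.add_sub_cancel] at this
    refine fun a ha => ⟨hsub a ha, fun b hb => ?_⟩
    have h1 : α.toFinset ⊆ Finset.Icc 1 (b - 1) := by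
      intro x hx
      rw [List.mem_toFinset] at hx
      have := hp x hx b hb
      have := hmem x (Or.inl hx)
      rw [Finset.mem_Icc]
      omega
    have := Finset.card_le_card h1
    rw [List.toFinset_card_of_nodup hnd.1, Nat.card_Icc] at this
    have := hmem b (Or.inr hb)
    omega
  obtain ⟨a0, ha0⟩ := List.exists_mem_of_ne_nil α hα
  have hβlt := (key a0 ha0).2
  have hβ' : (β.map (fun x => x - α.length)).map (fun x => x + α.length) = β := by
    rw [List.map_map]
    conv_rhs => rw [← List.map_id β]
    refine List.map_congr_left fun x hx => ?_
    have := hβlt x hx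
    simp only [Function.comp, id]
    omega
  have h1 := (avoids3142_append hp).1 hw.2.1
  have h2 := (avoids2413_append hp).1 hw.2.2
  refine ⟨α.length, β.length, α, β.map (fun x => x - α.length), ⟨?_, h1.1, h2.1⟩, ⟨?_, ?_, ?_⟩,
    List.length_pos_of_ne_nil hα, List.length_pos_of_ne_nil hβ, hlen, ?_⟩
  · exact isPerm_iff.2 ⟨hnd.1, rfl, fun x hx => ⟨(hmem x (Or.inl hx)).1, (key x hx).1⟩⟩
  · refine isPerm_iff.2 ⟨?_, by simp, fun x hx => ?_⟩
    · refine hnd.2.1.map_on fun x hx y hy h => ?_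
      have := hβlt x hx
      have := hβlt y hy
      omega
    · obtain ⟨y, hy, rfl⟩ := List.mem_map.1 hx
      have := hβlt y hy
      have := hmem y (Or.inr hy)
      omega
  · rw [← (incOn_add α.length _).avoids3142_map, hβ']
    exact h1.2
  · rw [← (incOn_add α.length _).avoids2413_map, hβ']
    exact h2.2
  · rw [oplus, hβ']

end Oplus

/-! ### Components -/

theorem comp_nil : comp [] = 0 := by
  have : {τ | IsComponent [] τ} = ∅ := by
    refine Set.eq_empty_iff_forall_notMem.2 ?_
    rintro τ ⟨h1, ⟨σ, ρ, h2, -⟩, -⟩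
    simp at h2
    exact h1 h2.2.1
  rw [comp, this, Set.ncard_empty]

theorem finite_isComponent (w : List ℕ) : {τ | IsComponent w τ}.Finite := by
  refine Set.Finite.subset (List.finite_toSet w.sublists) ?_
  rintro τ ⟨-, ⟨σ, ρ, rfl, -⟩, -⟩
  change τ ∈ (σ ++ τ ++ ρ).sublists
  rw [List.mem_sublists, List.append_assoc]
  exact (List.sublist_append_left τ ρ).trans (List.sublist_append_right σ _)

theorem isComponent_map_iff {k : ℕ} {w τ : List ℕ} :
    IsComponent (w.map (fun x => x + k)) (τ.map (fun x => x + k)) ↔ IsComponent w τ := by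
  have hinj : Function.Injective (List.map (fun x => x + k)) :=
    List.map_injective_iff.2 (add_left_injective k)
  have hprec : ∀ α β : List ℕ, Prec (α.map (fun x => x + k)) (β.map (fun x => x + k)) ↔
      Prec α β := fun α β => by simp [Prec]
  unfold IsComponent
  refine and_congr (by simp) (and_congr ⟨?_, ?_⟩ ⟨?_, ?_⟩)
  · rintro ⟨σ, ρ, h1, h2, h3⟩
    obtain ⟨σ', ρ', rfl, h4, rfl⟩ := List.map_eq_append_iff.1 h1
    obtain ⟨σ'', τ', rfl, rfl, h5⟩ := List.map_eq_append_iff.1 h4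
    have := hinj h5
    subst this
    exact ⟨σ'', ρ', rfl, (hprec _ _).1 h2, (hprec _ _).1 h3⟩
  · rintro ⟨σ, ρ, rfl, h2, h3⟩
    exact ⟨σ.map _, ρ.map _, by simp, (hprec _ _).2 h2, (hprec _ _).2 h3⟩
  · rintro h α β rfl h1
    simpa using h (α.map _) (β.map _) (by simp) ((hprec _ _).2 h1)
  · rintro h α β h1 h2
    obtain ⟨α', β', rfl, rfl, rfl⟩ := List.map_eq_append_iff.1 h1
    simpa using h α' β' rfl ((hprec _ _).1 h2)

theorem comp_map_add (k : ℕ) (w : List ℕ) : comp (w.map (fun x => x + k)) = comp w := by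
  have hinj : Function.Injective (List.map (fun x => x + k)) :=
    List.map_injective_iff.2 (add_left_injective k)
  unfold comp
  rw [← Set.ncard_image_of_injective {τ | IsComponent w τ} hinj]
  congr 1
  ext τ
  simp only [Set.mem_image, Set.mem_ofPred_eq]
  constructor
  · intro h
    obtain ⟨σ, ρ, h1, -⟩ := h.2.1
    obtain ⟨σ', ρ', rfl, h4, rfl⟩ := List.map_eq_append_iff.1 h1
    obtain ⟨σ'', τ', rfl, rfl, rfl⟩ := List.map_eq_append_iff.1 h4
    exact ⟨τ', isComponent_map_iff.1 h, rfl⟩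
  · rintro ⟨τ', h, rfl⟩
    exact isComponent_map_iff.2 h

/-- The part of `u` before a component `τ` is a prefix preceding the rest of `u` in value, so it is
empty or all of `u`. In the first case `u` and `τ` are prefixes of one word, and both being
indecomposable they coincide. -/
theorem isComponent_append_iff {u v τ : List ℕ} (hu : Indec u) (h : Prec u v) :
    IsComponent (u ++ v) τ ↔ τ = u ∨ IsComponent v τ := by
  constructor
  · rintro ⟨h1, ⟨σ, ρ, h2, h3, h4⟩, h5⟩
    obtain ⟨t, ht⟩ := List.exists_mem_of_ne_nil τ h1
    rw [List.append_assoc, List.append_eq_append_iff] at h2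
    rcases h2 with ⟨δ, rfl, h6⟩ | ⟨δ, h6, h7⟩
    · exact Or.inr ⟨h1, ⟨δ, ρ, by rw [h6, List.append_assoc],
        fun a ha => h3 a (List.mem_append_right _ ha), h4⟩, h5⟩
    · have h8 : Prec σ δ := by
        intro a ha b hb
        have h9 : b ∈ τ ++ ρ := by rw [h7]; simp [hb]
        rcases List.mem_append.1 h9 with h9 | h9
        · exact h3 a ha b h9
        · exact (h3 a ha t ht).trans (h4 t ht b h9)
      rcases hu.2 σ δ h6 h8 with rfl | rfl
      · left
        rw [List.nil_append] at h6
        subst h6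
        rw [List.append_eq_append_iff] at h7
        rcases h7 with ⟨δ', h7, h8⟩ | ⟨δ', h7, h8⟩
        · rcases hu.2 τ δ' h7 (fun a ha b hb => h4 a ha b (by rw [h8]; simp [hb])) with h9 | h9
          · exact absurd h9 h1
          · rw [h7, h9, List.append_nil]
        · rcases h5 u δ' h7 (fun a ha b hb => h a ha b (by rw [h8]; simp [hb])) with h9 | h9
          · exact absurd h9 hu.1
          · rw [h7, h9, List.append_nil]
      · exact Or.inr ⟨h1, ⟨[], ρ, by simpa using h7.symm, fun _ h => by simp at h, h4⟩, h5⟩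
  · rintro (rfl | ⟨h1, ⟨σ, ρ, rfl, h3, h4⟩, h5⟩)
    · exact ⟨hu.1, ⟨[], v, by simp, fun _ h => by simp at h, h⟩, hu.2⟩
    · refine ⟨h1, ⟨u ++ σ, ρ, by simp, fun a ha b hb => ?_, h4⟩, h5⟩
      rcases List.mem_append.1 ha with ha | ha
      · exact h a ha b (by simp [hb])
      · exact h3 a ha b hb

theorem comp_append {u v : List ℕ} (hu : Indec u) (h : Prec u v) :
    comp (u ++ v) = comp v + 1 := by
  unfold comp
  rw [← Set.ncard_insert_of_notMem (a := u) _ (finite_isComponent v)]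
  · congr 1
    ext τ
    exact isComponent_append_iff hu h
  · rintro ⟨-, ⟨σ, ρ, rfl, -⟩, -⟩
    obtain ⟨a, ha⟩ := List.exists_mem_of_ne_nil u hu.1
    exact lt_irrefl _ (h a ha a (by simp [ha]))

theorem comp_of_indec {u : List ℕ} (hu : Indec u) : comp u = 1 := by
  have := comp_append (v := []) hu (fun _ _ _ h => by simp at h)
  rwa [List.append_nil, comp_nil] at this

theorem comp_oplus {m n : ℕ} {u v : List ℕ} (hu : IsPerm m u) (hv : IsPerm n v) (hI : Indec u) :
    comp (oplus u v) = 1 + comp v := by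
  rw [oplus, comp_append hI (prec_oplus hu hv), comp_map_add, add_comm]

end Word

namespace LTree

/-! ### The statistic `stemhm` -/

mutual
/-- The number of leaves that are peeled off, the last one unsuccessfully, from a subtree that is
not a leaf. -/
def stemBelow : LTree → ℕ
  | node a cs => min a (stemForest cs)
/-- The number of leaves that are peeled off a sequence of subtrees, until a subtree other than a
leaf is blocked. -/
def stemForest : List LTree → ℕ
  | [] => 0
  | c :: cs => if c.children = [] then 1 + stemForest cs else stemBelow c
end

theorem stemBelow_node (a : ℕ) (cs : List LTree) :
    stemBelow (node a cs) = min a (stemForest cs) := by rw [stemBelow]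

theorem stemForest_cons (c : LTree) (cs : List LTree) : stemForest (c :: cs) =
    if c.children = [] then 1 + stemForest cs else stemBelow c := by rw [stemForest]

theorem stemForest_nil : stemForest [] = 0 := by rw [stemForest]

theorem IsBelow.one_le_label {t : LTree} (h : IsBelow t) : 1 ≤ t.label := by
  cases h with
  | leaf => exact le_rfl
  | node a cs hne hpos hle hcs => exact hpos

theorem IsBelow.eq_leaf {t : LTree} (h : IsBelow t) (h0 : t.children = []) : t = LTree.node 1 [] := by
  cases h with
  | leaf => rfl
  | node a cs hne hpos hle hcs => exact absurd h0 hne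

/-- Shows that the minimum with the root label is inactive at the root of a β(1,0)-tree, whose label
is the full sum. -/
theorem stemForest_le {cs : List LTree} (h : ∀ c ∈ cs, IsBelow c) :
    stemForest cs ≤ (cs.map label).sum := by
  induction cs with
  | nil => simp [stemForest_nil]
  | cons c cs ih =>
    have h1 := (h c (by simp)).one_le_label
    have h2 := ih fun d hd => h d (by simp [hd])
    rw [stemForest_cons, List.map_cons, List.sum_cons]
    split_ifs
    · omega
    · obtain ⟨a, ds⟩ := c
      rw [stemBelow_node, label]
      omega

theorem IsBelow.one_le_stemBelow {t : LTree} (h : IsBelow t) (h0 : t.children ≠ []) :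
    1 ≤ stemBelow t := by
  induction h with
  | leaf => exact absurd rfl h0
  | node a cs hne hpos hle hcs ih =>
    obtain ⟨c, cs, rfl⟩ := List.exists_cons_of_ne_nil hne
    rw [stemBelow_node, stemForest_cons]
    split_ifs with h1
    · omega
    · have := ih c (by simp) h1
      omega

/-- A label `1` at any level of the left path caps the minimum there, and the cap passes up the
path. -/
theorem stemBelow_eq_one {t : LTree} (h : IsBelow t) (h0 : t.children ≠ [])
    (h1 : 1 ∈ t.innerLeftLabels) : stemBelow t = 1 := by
  induction h with
  | leaf => exact absurd rfl h0
  | node a cs hne hpos hle hcs ih =>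
    have h2 := (IsBelow.node a cs hne hpos hle hcs).one_le_stemBelow h0
    obtain ⟨c, cs, rfl⟩ := List.exists_cons_of_ne_nil hne
    rw [innerLeftLabels, List.mem_cons] at h1
    rw [stemBelow_node] at h2 ⊢
    rcases h1 with rfl | h1
    · omega
    · rw [stemForest_cons] at h2 ⊢
      have h3 : c.children ≠ [] := by
        obtain ⟨b, ds⟩ := c
        rintro h3
        rw [children] at h3
        rw [h3, innerLeftLabels] at h1
        simp at h1
      rw [if_neg h3, ih c (by simp) h3 h1] at *
      omega

/-- A successful peeling lowers both arguments of each minimum on the left path by one. The bound by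
the children's labels is kept because the label of the first child, or the leaf of label `1` that
disappears, also accounts for one. A subtree other than a leaf never becomes one, so the process
cannot move on to its right siblings. -/
theorem IsBelow.peel {t : LTree} (h : IsBelow t) (h0 : t.children ≠ [])
    (h1 : 1 ∉ t.innerLeftLabels) : IsBelow t.peel ∧ t.peel.children ≠ [] ∧
      t.peel.label + 1 = t.label ∧ stemBelow t.peel + 1 = stemBelow t := by
  induction h with
  | leaf => exact absurd rfl h0
  | node a cs hne hpos hle hcs ih =>
    obtain ⟨c, cs, rfl⟩ := List.exists_cons_of_ne_nil hne
    rw [innerLeftLabels, List.mem_cons, not_or] at h1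
    rw [List.map_cons, List.sum_cons] at hle
    have hcs' : ∀ d ∈ cs, IsBelow d := fun d hd => hcs d (by simp [hd])
    have hc := hcs c (by simp)
    obtain ⟨b, ds⟩ := c
    rw [label] at hle
    cases ds with
    | nil =>
      have hb := hc.eq_leaf rfl
      rw [LTree.node.injEq] at hb
      rw [LTree.peel, stemBelow_node, stemBelow_node, stemForest_cons,
        if_pos (show (LTree.node b []).children = [] from rfl)]
      -- The label `a` is not `1`, so it is at least `2`, which a single leaf as child does not
      -- allow.
      have hne' : cs ≠ [] := by
        rintro rfl
        simp at hle
        omega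
      exact ⟨IsBelow.node _ _ hne' (by omega) (by omega) hcs', hne', by simp only [label]; omega,
        by omega⟩
    | cons d ds =>
      have h3 : (LTree.node b (d :: ds)).children ≠ [] := by simp [children]
      obtain ⟨i1, i2, i3, i4⟩ := ih _ (by simp) h3 h1.2
      rw [LTree.peel, stemBelow_node, stemBelow_node, stemForest_cons, if_neg i2, stemForest_cons,
        if_neg h3]
      refine ⟨IsBelow.node _ _ (by simp) (by omega) ?_ ?_, by simp [children],
        by simp only [label]; omega, by omega⟩
      · rw [List.map_cons, List.sum_cons]
        rw [label] at i3
        omega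
      · intro e he
        rcases List.mem_cons.1 he with rfl | he
        · exact i1
        · exact hcs' e he

theorem iterate_peel_spec {k : ℕ} : ∀ {t : LTree}, IsBelow t → t.children ≠ [] →
    stemBelow t = k + 1 → 1 ∈ (LTree.peel^[k] t).innerLeftLabels ∧
      ∀ j < k, 1 ∉ (LTree.peel^[j] t).innerLeftLabels := by
  induction k with
  | zero =>
    intro t h h0 h1
    refine ⟨?_, by simp⟩
    by_contra h2
    obtain ⟨i1, i2, -, i4⟩ := h.peel h0 h2
    have := i1.one_le_stemBelow i2
    omega
  | succ k ih =>
    intro t h h0 h1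
    have h2 : 1 ∉ t.innerLeftLabels := fun h2 => by
      have := stemBelow_eq_one h h0 h2
      omega
    obtain ⟨i1, i2, -, i4⟩ := h.peel h0 h2
    obtain ⟨h3, h4⟩ := ih i1 i2 (by omega)
    refine ⟨h3, fun j hj => ?_⟩
    cases j with
    | zero => exact h2
    | succ j => exact h4 j (by omega)

theorem IsBeta.isBelow {t : LTree} (h : t.IsBeta) : IsBelow t := by
  have h1 : 1 ≤ t.label := by
    rcases h with rfl | ⟨hne, hl, hc⟩
    · exact le_rfl
    · obtain ⟨c, cs, he⟩ := List.exists_cons_of_ne_nil hne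
      have := (hc c (by simp [he])).one_le_label
      rw [hl, childSum, he, List.map_cons, List.sum_cons]
      omega
  have := h.isBelow_lower h1 le_rfl
  obtain ⟨a, cs⟩ := t
  exact this

/-- By `iterate_peel_spec` the first blocked leaf has index `stemBelow t`; at the root the cap by
the label is vacuous. -/
theorem IsBeta.stemhm_eq {t : LTree} (h : t.IsBeta) : t.stemhm = stemForest t.children := by
  unfold stemhm
  split_ifs with h0
  · rw [h0, stemForest_nil]
  have h1 := h.isBelow.one_le_stemBelow h0
  obtain ⟨k, hk⟩ := Nat.exists_eq_add_of_le' h1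
  obtain ⟨h2, h3⟩ := iterate_peel_spec h.isBelow h0 hk
  have h4 : stemBelow t = stemForest t.children := by
    rcases h with rfl | ⟨hne, hl, hc⟩
    · exact absurd rfl h0
    · have h5 := stemForest_le hc
      obtain ⟨a, cs⟩ := t
      rw [stemBelow_node]
      rw [childSum] at hl
      change a = _ at hl
      change min a (stemForest cs) = stemForest cs
      rw [hl]
      exact min_eq_right h5
  rw [← h4, hk]
  apply le_antisymm
  · exact Nat.sInf_le ⟨by omega, by simpa using h2⟩
  · refine le_csInf ⟨k + 1, by omega, by simpa using h2⟩ ?_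
    rintro i ⟨h5, h6⟩
    by_contra h7
    exact h3 (i - 1) (by omega) h6

/-! ### Statistics of the two constructions -/

theorem nodes_pos (t : LTree) : 1 ≤ t.nodes := by
  obtain ⟨a, cs⟩ := t
  rw [nodes]
  omega

theorem nodes_eq_one_iff {t : LTree} : t.nodes = 1 ↔ t.children = [] := by
  obtain ⟨a, cs⟩ := t
  cases cs with
  | nil => simp [nodes, children]
  | cons c cs =>
    have := nodes_pos c
    simp [nodes, children]
    omega

theorem nodes_lam (i : ℕ) (t : LTree) : (lam i t).nodes = t.nodes + 1 := by
  obtain ⟨a, cs⟩ := t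
  simp [lam, nodes, children]
  omega

theorem nodes_oplus (u v : LTree) : (oplus u v).nodes + 1 = u.nodes + v.nodes := by
  obtain ⟨a, cs⟩ := u
  obtain ⟨b, ds⟩ := v
  simp [oplus, nodes, children]
  omega

theorem leaves_lam (i : ℕ) (t : LTree) : (lam i t).leaves = t.leaves := by
  obtain ⟨a, cs⟩ := t
  simp [lam, leaves, children]

theorem leaves_oplus {u v : LTree} (hu : u.children ≠ []) (hv : v.children ≠ []) :
    (oplus u v).leaves = u.leaves + v.leaves := by
  obtain ⟨a, cs⟩ := u
  obtain ⟨b, ds⟩ := v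
  rw [children] at hu hv
  simp [oplus, leaves, children, hu, hv]

theorem root_lam (i : ℕ) (t : LTree) : (lam i t).root = i := by
  simp [lam, root, children, label]

theorem root_oplus {u v : LTree} (hu : u.children ≠ []) :
    (oplus u v).root = u.root + v.root := by
  rw [root, if_neg (by simp [oplus, children]; tauto)]
  rfl

theorem leftLabels_lam (i : ℕ) (t : LTree) : (lam i t).leftLabels = i :: t.leftLabels := by
  obtain ⟨a, cs⟩ := t
  cases cs <;> simp [lam, leftLabels, children, label]

theorem leftLabels_oplus {u v : LTree} (hu : u.children ≠ []) :
    (oplus u v).leftLabels = u.leftLabels := by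
  obtain ⟨a, cs⟩ := u
  obtain ⟨c, cs, rfl⟩ := List.exists_cons_of_ne_nil hu
  simp [oplus, leftLabels, children]

theorem rpath_congr (a b : ℕ) (cs : List LTree) : rpath (node a cs) = rpath (node b cs) := by
  cases cs <;> simp [rpath]

theorem rpath_lam (i : ℕ) (t : LTree) : (lam i t).rpath = t.rpath + 1 := by
  obtain ⟨a, cs⟩ := t
  rw [lam, rpath, children, add_comm]
  simp [rpath_congr i a]

theorem rpath_of_ne_nil (a : ℕ) {cs : List LTree} (h : cs ≠ []) :
    rpath (node a cs) = 1 + rpath (cs.getLast h) := by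
  obtain ⟨c, cs, rfl⟩ := List.exists_cons_of_ne_nil h
  rw [rpath]

theorem rpath_oplus {u v : LTree} (hv : v.children ≠ []) : (oplus u v).rpath = v.rpath := by
  obtain ⟨a, cs⟩ := u
  obtain ⟨b, ds⟩ := v
  rw [children] at hv
  rw [oplus, rpath_of_ne_nil _ (by simp [children, hv]), rpath_of_ne_nil _ hv]
  simp [children, hv]

end LTree

-- Generation of trees by the two constructions

namespace BetaTree

theorem children_ne_nil {t : BetaTree} (h : t ≠ leaf) : t.1.children ≠ [] := by
  intro h0
  rcases t.2 with h1 | h1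
  · exact h (Subtype.ext h1)
  · exact h1.1 h0

/-- β(1,0)-trees are generated from the one-node tree by `λ` and `⊕`. -/
theorem induction {P : BetaTree → Prop} (hleaf : P leaf)
    (hlam : ∀ (i : ℕ) (t : BetaTree) (h1 : 1 ≤ i) (h2 : i ≤ t.1.label), P t → P (lam i t h1 h2))
    (hoplus : ∀ (u v : BetaTree) (hu : u ≠ leaf) (hv : v ≠ leaf), u.1.sub = 1 → P u → P v →
      P (oplus u v hu hv)) (t : BetaTree) : P t := by
  induction hn : t.1.nodes using Nat.strong_induction_on generalizing t with
  | _ n ih =>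
    obtain ⟨⟨a, cs⟩, ht⟩ := t
    have hne : ∀ (b : ℕ) (ds : List LTree) (h : (LTree.node b ds).IsBeta), ds ≠ [] →
        (⟨LTree.node b ds, h⟩ : BetaTree) ≠ leaf := by
      intro b ds h h0 h1
      have h2 := congrArg (fun t : BetaTree => t.1.children) h1
      exact h0 h2
    match cs, ht with
    | [], ht =>
      have : LTree.node a [] = LTree.leaf := ht.resolve_right fun h => h.1 rfl
      have h2 : (⟨LTree.node a [], ht⟩ : BetaTree) = leaf := Subtype.ext this
      rw [h2]
      exact hleaf
    | [c], ht =>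
      have ht' := ht.resolve_left (by simp [LTree.leaf])
      have hc := ht'.2.2 c (by simp [LTree.children])
      have ha : a = c.label := by
        have := ht'.2.1
        simpa [LTree.childSum, LTree.children, LTree.label] using this
      cases hc with
      | leaf =>
        have h2 : (⟨LTree.node a [LTree.node 1 []], ht⟩ : BetaTree) = lam 1 leaf le_rfl le_rfl := by
          apply Subtype.ext
          simp [lam, LTree.lam, ha, LTree.label, leaf, LTree.leaf, LTree.children]
        rw [h2]
        exact hlam _ _ _ _ hleaf
      | node b ds hds hpos hle hcs =>
        -- Undoing `λ`: the root is removed and the label of its child is raised to the full sum, so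
        -- that `b` is an allowed index.
        have hs : (LTree.node (ds.map LTree.label).sum ds).IsBeta := Or.inr ⟨hds, rfl, hcs⟩
        have h2 : (⟨LTree.node a [LTree.node b ds], ht⟩ : BetaTree) =
            lam b ⟨_, hs⟩ hpos hle := by
          apply Subtype.ext
          simp [lam, LTree.lam, ha, LTree.label, LTree.children]
        rw [h2]
        refine hlam _ _ _ _ (ih _ ?_ _ rfl)
        rw [← hn]
        simp [LTree.nodes]
    -- The first subtree is split off alone; its word will be indecomposable, which makes the
    -- decomposition on the side of words unique.
    | c :: d :: ds, ht =>
      have ht' := ht.resolve_left (by simp [LTree.leaf])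
      have hc : ∀ e ∈ c :: d :: ds, LTree.IsBelow e := ht'.2.2
      have hu : (LTree.node c.label [c]).IsBeta := Or.inr ⟨by simp [LTree.children],
        by simp [LTree.childSum, LTree.children, LTree.label], fun e he => hc e (by
          have : e = c := by simpa [LTree.children] using he
          simp [this])⟩
      have hv : (LTree.node ((d :: ds).map LTree.label).sum (d :: ds)).IsBeta :=
        Or.inr ⟨by simp [LTree.children], rfl, fun e he => hc e (List.mem_cons_of_mem _ he)⟩
      have h2 : (⟨LTree.node a (c :: d :: ds), ht⟩ : BetaTree) =
          oplus ⟨_, hu⟩ ⟨_, hv⟩ (hne _ _ _ (by simp)) (hne _ _ _ (by simp)) := by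
        apply Subtype.ext
        have := ht'.2.1
        simpa [oplus, LTree.oplus, LTree.root, LTree.label, LTree.children, LTree.childSum]
          using this
      rw [h2]
      have h3 := c.nodes_pos
      have h4 := d.nodes_pos
      refine hoplus _ _ _ _ rfl (ih _ ?_ _ rfl) (ih _ ?_ _ rfl)
      · rw [← hn]
        simp [LTree.nodes]
        omega
      · rw [← hn]
        simp [LTree.nodes]
        omega

end BetaTree

/-! ### The map `f` -/

namespace Word

/-- The sum of a sequence of words. -/
def osum (l : List (List ℕ)) : List ℕ := l.foldr oplus []

theorem osum_append (l l' : List (List ℕ)) : osum (l ++ l') = oplus (osum l) (osum l') := by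
  induction l with
  | nil => exact (nil_oplus _).symm
  | cons w l ih => rw [List.cons_append, osum, List.foldr_cons, ← osum, ih, ← oplus_assoc]; rfl

end Word

/-- The indecomposable word of the subtree hanging at a child of the root. -/
def LTree.branchWord : LTree → List ℕ
  | LTree.node a cs => Word.phi a (Word.osum (cs.map branchWord))

/-- The word of a β(1,0)-tree. -/
def BetaTree.word (t : BetaTree) : List ℕ := Word.osum (t.1.children.map LTree.branchWord)

theorem satisfiesRecursion_word : SatisfiesRecursion BetaTree.word := by
  refine ⟨rfl, fun i t h1 h2 => ?_, fun u v hu hv => ?_⟩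
  · simp only [BetaTree.word, BetaTree.lam, LTree.lam, LTree.children, List.map_cons, List.map_nil]
    rw [LTree.branchWord]
    exact Word.oplus_nil _
  · simp only [BetaTree.word, BetaTree.oplus, LTree.oplus]
    rw [← Word.osum_append, ← List.map_append]
    rfl

theorem SatisfiesRecursion.eq {f g : BetaTree → List ℕ} (hf : SatisfiesRecursion f)
    (hg : SatisfiesRecursion g) : f = g := by
  funext t
  induction t using BetaTree.induction with
  | hleaf => rw [hf.1, hg.1]
  | hlam i t h1 h2 ih => rw [hf.2.1, hg.2.1, ih]
  | hoplus u v hu hv _ ihu ihv => rw [hf.2.2, hg.2.2, ihu, ihv]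

/-! ### The statistics under the map `f` -/

/-- The properties of `f(t) = w` that are proved by induction along the construction of `t`. -/
structure Matches (t : LTree) (w : List ℕ) : Prop where
  avoider : Word.IsAvoider (t.nodes - 1) w
  indec : t.sub = 1 → Word.Indec w
  sub : t.sub = Word.comp w
  leaves : t.leaves = 1 + Word.asc w
  root : t.root = Word.lmax w
  lpath : t.lpath = Word.lmin w
  rpath : t.rpath = Word.rmax w
  lsub : t.lsub = Word.ldr w
  stem : LTree.stemForest t.children = Word.lir w

-- Compatibility with the two constructions

namespace Matches

variable {t u v : LTree} {w w' : List ℕ}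

theorem length (h : Matches t w) : w.length + 1 = t.nodes := by
  have := h.avoider.1.length
  have := t.nodes_pos
  omega

theorem eq_nil_iff (h : Matches t w) : w = [] ↔ t.children = [] := by
  rw [← List.length_eq_zero_iff, ← LTree.nodes_eq_one_iff, ← h.length]
  omega

theorem leaf : Matches LTree.leaf [] where
  avoider := ⟨by simp [Word.IsPerm, LTree.leaf, LTree.nodes], fun ⟨_, _, _, _, _, _, _, h, _⟩ => by simp at h,
    fun ⟨_, _, _, _, _, h, _⟩ => by simp at h⟩
  indec h := by simp [LTree.sub, LTree.leaf, LTree.children] at h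
  sub := by rw [Word.comp_nil]; rfl
  leaves := by simp [LTree.leaf, LTree.leaves]
  root := rfl
  lpath := by simp [LTree.leaf, LTree.lpath, LTree.leftLabels]
  rpath := by simp [LTree.leaf, LTree.rpath]
  lsub := by simp [LTree.leaf, LTree.lsub, LTree.leftLabels]
  stem := LTree.stemForest_nil

/-- The case `i = 1` stands apart because the one-node tree has label `1` while its statistic `root`
is `0`. -/
theorem le_lmax (h : Matches t w) (ht : t.IsBeta) {i : ℕ} (h1 : 1 ≤ i) (h2 : i ≤ t.label) :
    i = 1 ∨ i ≤ Word.lmax w := by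
  rw [← h.root]
  rcases ht with rfl | ⟨hne, -⟩
  · exact Or.inl (le_antisymm h2 h1)
  · rw [LTree.root, if_neg hne]
    exact Or.inr h2

theorem lam (h : Matches t w) {i : ℕ} (h1 : 1 ≤ i) (h2 : i = 1 ∨ i ≤ Word.lmax w) :
    Matches (LTree.lam i t) (Word.phi i w) where
  avoider := by
    have := Word.isAvoider_phi h.avoider h1 h2
    have := t.nodes_pos
    rwa [LTree.nodes_lam, show t.nodes + 1 - 1 = t.nodes - 1 + 1 by omega]
  indec _ := Word.indec_phi h.avoider h1 h2
  sub := by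
    rw [Word.comp_of_indec (Word.indec_phi h.avoider h1 h2)]
    rfl
  leaves := by rw [LTree.leaves_lam, Word.asc_phi h.avoider h1 h2, h.leaves]
  root := by rw [LTree.root_lam, Word.lmax_phi h.avoider h1 h2]
  lpath := by
    rw [LTree.lpath, LTree.leftLabels_lam, Word.lmin_phi h.avoider h1 h2, ← h.lpath]
    rfl
  rpath := by rw [LTree.rpath_lam, Word.rmax_phi h.avoider h1 h2, h.rpath]
  lsub := by
    rw [LTree.lsub, LTree.leftLabels_lam, Word.ldr_phi h.avoider h1 h2, ← h.lsub,
      List.count_cons]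
    simp [LTree.lsub]
  stem := by
    rw [Word.lir_phi h.avoider h1 h2, ← h.stem]
    simp only [LTree.lam, LTree.children]
    rw [LTree.stemForest_cons, LTree.stemForest_nil, LTree.stemBelow_node]
    exact if_congr h.eq_nil_iff.symm rfl rfl

theorem oplus (hu : Matches u w) (hv : Matches v w') (hu0 : u.children ≠ [])
    (hv0 : v.children ≠ []) (hsub : u.sub = 1) :
    Matches (LTree.oplus u v) (Word.oplus w w') where
  avoider := by
    have h1 := hu.avoider.oplus hv.avoider
    have h2 := LTree.nodes_oplus u v
    have h3 := u.nodes_pos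
    have h4 := v.nodes_pos
    rwa [show (LTree.oplus u v).nodes - 1 = u.nodes - 1 + (v.nodes - 1) by omega]
  indec h := by
    have h1 := List.length_pos_of_ne_nil hv0
    have h2 : (LTree.oplus u v).sub = u.sub + v.sub := List.length_append
    rw [LTree.sub] at h2 hsub
    change 0 < v.sub at h1
    rw [LTree.sub, h2, LTree.sub, hsub] at h
    omega
  sub := by
    rw [Word.comp_oplus hu.avoider.1 hv.avoider.1 (hu.indec hsub), ← hv.sub, ← hsub]
    exact List.length_append
  leaves := by
    rw [LTree.leaves_oplus hu0 hv0, Word.asc_oplus hu.avoider.1 hv.avoider.1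
      (mt hu.eq_nil_iff.1 hu0) (mt hv.eq_nil_iff.1 hv0), hu.leaves, hv.leaves]
    omega
  root := by
    rw [LTree.root_oplus hu0, Word.lmax_oplus hu.avoider.1 hv.avoider.1, hu.root, hv.root]
  lpath := by
    rw [LTree.lpath, LTree.leftLabels_oplus hu0, Word.lmin_oplus hu.avoider.1 hv.avoider.1
      (mt hu.eq_nil_iff.1 hu0), ← hu.lpath, LTree.lpath]
  rpath := by
    rw [LTree.rpath_oplus hv0, Word.rmax_oplus hu.avoider.1 hv.avoider.1
      (mt hv.eq_nil_iff.1 hv0), hv.rpath]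
  lsub := by
    rw [LTree.lsub, LTree.leftLabels_oplus hu0, Word.ldr_oplus hu.avoider.1 hv.avoider.1
      (mt hu.eq_nil_iff.1 hu0) (mt hv.eq_nil_iff.1 hv0), ← hu.lsub, LTree.lsub]
  stem := by
    have hs := hu.stem
    have hlen := hu.length
    have hI := hu.indec hsub
    obtain ⟨a, cs⟩ := u
    obtain ⟨c, rfl⟩ := List.length_eq_one_iff.1 hsub
    rw [Word.lir_oplus hu.avoider.1 hv.avoider.1, ← hv.stem]
    simp only [LTree.oplus, LTree.children, List.cons_append, List.nil_append] at hs ⊢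
    have hn : (LTree.node a [c]).nodes = 1 + c.nodes := by simp [LTree.nodes]
    rw [LTree.stemForest_cons] at hs ⊢
    -- The increasing run passes into the second summand only if the first is increasing, hence,
    -- being indecomposable, a single letter. This occurs exactly when the only child of the first
    -- root is a leaf, which is when the peeling moves on to the next subtree.
    split_ifs at hs ⊢ with h1 h2 h2
    · rw [← LTree.nodes_eq_one_iff] at h1
      have : w.length = 1 := by omega
      rw [this]
    · rw [← LTree.nodes_eq_one_iff] at h1
      rw [LTree.stemForest_nil] at hs
      omega
    · have := hI.length_eq_one_of_lir h2
      rw [← LTree.nodes_eq_one_iff] at h1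
      omega
    · exact hs

end Matches

-- Bijectivity of `f`

namespace SatisfiesRecursion

variable {f : BetaTree → List ℕ}

theorem matchesTree (hf : SatisfiesRecursion f) (t : BetaTree) : Matches t.1 (f t) := by
  induction t using BetaTree.induction with
  | hleaf => rw [hf.1]; exact Matches.leaf
  | hlam i t h1 h2 ih => rw [hf.2.1]; exact ih.lam h1 (ih.le_lmax t.2 h1 h2)
  | hoplus u v hu hv hsub ihu ihv =>
    rw [hf.2.2]
    exact ihu.oplus ihv (BetaTree.children_ne_nil hu) (BetaTree.children_ne_nil hv) hsub

theorem ne_nil (hf : SatisfiesRecursion f) {t : BetaTree} (ht : t ≠ BetaTree.leaf) :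
    f t ≠ [] :=
  mt (hf.matchesTree t).eq_nil_iff.1 (BetaTree.children_ne_nil ht)

theorem not_indec_oplus (hf : SatisfiesRecursion f) {u v : BetaTree} (hu : u ≠ BetaTree.leaf)
    (hv : v ≠ BetaTree.leaf) : ¬ Word.Indec (Word.oplus (f u) (f v)) :=
  Word.not_indec_oplus (hf.matchesTree u).avoider.1 (hf.matchesTree v).avoider.1 (hf.ne_nil hu)
    (hf.ne_nil hv)

theorem indec_lam (hf : SatisfiesRecursion f) {i : ℕ} {t : BetaTree} (h1 : 1 ≤ i)
    (h2 : i ≤ t.1.label) : Word.Indec (Word.phi i (f t)) :=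
  Word.indec_phi (hf.matchesTree t).avoider h1 ((hf.matchesTree t).le_lmax t.2 h1 h2)

/-- Emptiness and indecomposability of the word tell which construction was applied last; `φ` is
then inverted by `phi_injective`, and a sum by splitting off its first component. -/
theorem injective (hf : SatisfiesRecursion f) : Function.Injective f := by
  intro t
  induction t using BetaTree.induction with
  | hleaf =>
    intro t' h
    rw [hf.1] at h
    by_contra hne
    exact hf.ne_nil (fun h' => hne h'.symm) h.symm
  | hlam i t h1 h2 ih =>
    intro t' h
    rw [hf.2.1] at h
    have hI := hf.indec_lam h1 h2
    induction t' using BetaTree.induction with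
    | hleaf => rw [hf.1] at h; exact absurd h hI.1
    | hlam i' t' h1' h2' _ =>
      rw [hf.2.1] at h
      obtain ⟨rfl, h3⟩ := Word.phi_injective (hf.matchesTree t).avoider h1
        ((hf.matchesTree t).le_lmax t.2 h1 h2) (hf.matchesTree t').avoider h1'
        ((hf.matchesTree t').le_lmax t'.2 h1' h2') h
      obtain rfl := ih h3
      rfl
    | hoplus u v hu hv _ _ _ =>
      rw [hf.2.2] at h
      rw [h] at hI
      exact absurd hI (hf.not_indec_oplus hu hv)
  | hoplus u v hu hv hsub ihu ihv =>
    intro t' h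
    rw [hf.2.2] at h
    induction t' using BetaTree.induction with
    | hleaf =>
      rw [hf.1] at h
      have h1 := congrArg List.length h
      rw [Word.length_oplus, List.length_nil] at h1
      have := List.length_pos_of_ne_nil (hf.ne_nil hu)
      omega
    | hlam i' t' h1' h2' _ =>
      rw [hf.2.1] at h
      exact absurd (h ▸ hf.indec_lam h1' h2') (hf.not_indec_oplus hu hv)
    | hoplus u' v' hu' hv' hsub' _ _ =>
      rw [hf.2.2] at h
      obtain ⟨h3, h4⟩ := Word.oplus_left_cancel (hf.matchesTree u).avoider.1 (hf.matchesTree v).avoider.1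
        (hf.matchesTree u').avoider.1 (hf.matchesTree v').avoider.1 ((hf.matchesTree u).indec hsub)
        ((hf.matchesTree u').indec hsub') h
      obtain rfl := ihu h3
      obtain rfl := ihv h4
      rfl

/-- Induction on the length: an indecomposable avoider is an image under `φ`, and any other nonempty
one is a sum of shorter avoiders. -/
theorem exists_preimage (hf : SatisfiesRecursion f) (n : ℕ) :
    ∀ w, Word.IsAvoider n w → ∃ t, f t = w := by
  induction n using Nat.strong_induction_on with
  | _ n ih =>
    intro w hw
    by_cases h0 : w = []
    · exact ⟨BetaTree.leaf, by rw [hf.1, h0]⟩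
    by_cases hI : Word.Indec w
    · have hn : n ≠ 0 := by
        rintro rfl
        exact h0 (Word.isPerm_zero.1 hw.1)
      obtain ⟨m, rfl⟩ := Nat.exists_eq_succ_of_ne_zero hn
      obtain ⟨i, v, hv, h1, h2, rfl⟩ := Word.exists_phi_of_indec hw hI
      obtain ⟨t, rfl⟩ := ih m (by omega) v hv
      -- The index `1` is allowed for every tree, including the one-node tree; otherwise `lmax` is
      -- the root label by `Matches.root`.
      have h3 : i ≤ t.1.label := by
        have h4 := t.2.isBelow.one_le_label
        rcases h2 with rfl | h2
        · exact h4
        · rw [← (hf.matchesTree t).root, LTree.root] at h2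
          split_ifs at h2 <;> omega
      exact ⟨BetaTree.lam i t h1 h3, hf.2.1 i t h1 h3⟩
    · obtain ⟨k, l, u, v, hu, hv, hk, hl, hkl, rfl⟩ := Word.exists_oplus_of_not_indec hw h0 hI
      obtain ⟨s, rfl⟩ := ih k (by omega) u hu
      obtain ⟨t, rfl⟩ := ih l (by omega) v hv
      have hs : s ≠ BetaTree.leaf := by
        rintro rfl
        have := hu.1.length
        rw [hf.1] at this
        simp at this
        omega
      have ht : t ≠ BetaTree.leaf := by
        rintro rfl
        have := hv.1.length
        rw [hf.1] at this
        simp at this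
        omega
      exact ⟨BetaTree.oplus s t hs ht, hf.2.2 s t hs ht⟩

theorem bijOn (hf : SatisfiesRecursion f) (n : ℕ) :
    Set.BijOn f {t : BetaTree | t.1.nodes = n + 1} {π : List ℕ | Word.IsAvoider n π} := by
  refine ⟨fun t ht => ?_, hf.injective.injOn, fun w hw => ?_⟩
  · have h1 := (hf.matchesTree t).avoider
    rw [show t.1.nodes = n + 1 from ht, Nat.add_sub_cancel] at h1
    exact h1
  · obtain ⟨t, rfl⟩ := hf.exists_preimage n w hw
    refine ⟨t, ?_, rfl⟩
    change t.1.nodes = n + 1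
    rw [← (hf.matchesTree t).length, Word.IsPerm.length hw.1]

end SatisfiesRecursion

theorem theorem1 :
    (∃! f : BetaTree → List ℕ, SatisfiesRecursion f) ∧
    ∀ f : BetaTree → List ℕ, SatisfiesRecursion f →
      (∀ n : ℕ, Set.BijOn f {t : BetaTree | t.1.nodes = n + 1}
        {π : List ℕ | Word.IsAvoider n π}) ∧
      ∀ t : BetaTree,
        t.1.sub = Word.comp (f t) ∧
        t.1.leaves = 1 + Word.asc (f t) ∧
        t.1.root = Word.lmax (f t) ∧
        t.1.lpath = Word.lmin (f t) ∧
        t.1.rpath = Word.rmax (f t) ∧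
        t.1.lsub = Word.ldr (f t) ∧
        t.1.stemhm = Word.lir (f t) := by
  refine ⟨⟨BetaTree.word, satisfiesRecursion_word, fun g hg => hg.eq satisfiesRecursion_word⟩,
    fun f hf => ⟨hf.bijOn, fun t => ?_⟩⟩
  have h := hf.matchesTree t
  exact ⟨h.sub, h.leaves, h.root, h.lpath, h.rpath, h.lsub, t.2.stemhm_eq.trans h.stem⟩
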